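/- **Setting.** Let $f:\mathbb R^n\to\mathbb R^n$ and $g:\mathbb R^n\to\mathbb R^{n\times m}$ be locally Lipschitz, let $g(x)$ have full column rank for all $x$, and let $g^\dagger=(g^Tg)^{-1}g^T$ be bounded and locally Lipschitz. Fix $x_d\in\mathbb R^n$ and put $z(e)=e+x_d$, $u_d=-g^\dagger(x_d)f(x_d)$, $F(e)=f(z(e))+g(z(e))u_d$, $G(e)=g(z(e))$. Let $\bar O$ be a finite set of observations $o$, each with a $C^1$ function $h_o$ such that $h_o(x_d)<0$, and put $\mathcal X_o=\{h_o\le 0\}$, $b_o=-1/h_o$, $B(e)=\sum_{o\in\bar O}\big(b_o(z(e))-b_o(x_d)-\nabla b_o(x_d)e\big)^2$, $\bar B=B/(1+B)$. Let $Q$ be positive definite and radially unbounded, $R$ symmetric positive definite, $r(e,\mu)=Q(e)+\mu^TR\mu+B(e)$ and $G_R=GR^{-1}G^T$. Let $\chi\subset\mathbb R^n$ be compact, and let $V^*$ be $C^1$ on a neighbourhood of $\chi$, positive definite on $\chi$, and solve $0=\min_\mu\{\nabla V^*(e)(F(e)+G(e)\mu)+r(e,\mu)\}$, $V^*(0)=0$,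 at the points of $\chi$ where $h_o(z(e))<0$ for all $o\in\bar O$. Near $\chi$ let $\sigma(y,c)\in\mathbb R^L$ (kernels) and $W(e)\in\mathbb R^L$ (ideal weights) be $C^1$; let $c(e)=(c_1(e),\dots,c_L(e))$ be continuous on $\chi$ with distinct entries in $\chi$. Define $\epsilon$ by $V^*(y)=W(e)^T\sigma(y,c(e))+\epsilon(e,y)+\bar B(y)$. Let $Y:\mathbb R^n\to\mathbb R^{p_1}$ be continuous, $\theta\in\mathbb R^{p_1\times n}$, $\|\theta\|\le\bar\theta$ and $\epsilon_\theta=f-\theta^TY$. Let $\zeta,a>0$ be such that the closed ball $B_a(e)\subset\chi$ whenever $\|e\|\le\zeta$, and let $e_i(e,t)\in B_a(e)$, $i=1,\dots,N$, $N\ge1$. All gains $k_{c1},k_{c2},k_{a1},k_{a2},\gamma_1,\beta,k_\theta,\beta_\theta,\Delta t$ are positive. $\|\cdot\|$ is the 2-norm of vectors and matrices, except that $p_1\times n$ weight matrices carry the norm of their vectorization. $\nabla\sigma$, $\nabla\epsilon$ are gradients in $y$. **Closed loop.** Put $\hat F(y,\hat\theta)=\hat\theta^TY(z(y))-g(z(y))g^\dagger(x_d)\hat\theta^TY(x_d)$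 and $$\hat\mu(y,e,\hat W_a)=-\tfrac12R^{-1}G(y)^T\big(\nabla\sigma(y,c(e))^T\hat W_a+\nabla\bar B(y)^T\big),$$ $$\delta(y,e,\hat W_c,\hat W_a,\hat\theta)=r(y,\hat\mu)+\big(\hat W_c^T\nabla\sigma(y,c(e))+\nabla\bar B(y)\big)\big(\hat F(y,\hat\theta)+G(y)\hat\mu\big),\qquad \omega=\nabla\sigma(y,c(e))\big(\hat F(y,\hat\theta)+G(y)\hat\mu\big),$$ $\rho=1+\gamma_1\omega^T\omega$, $\Lambda=\omega\omega^T/\rho^2$, $G_\sigma=\nabla\sigma G_R\nabla\sigma^T$. No index means evaluation at $y=e(t)$, the index $i$ evaluation at $y=e_i(e(t),t)$. The auxiliary system $\dot e=F(e)+G(e)\mu$ (that is, $\dot x=f(x)+g(x)u$ with $x=z(e)$, $u=u_d+\mu$) is controlled by $\mu=\hat\mu(e,e,\hat W_a)$ with $$\dot{\hat W}_c=-k_{c1}\Gamma\tfrac{\omega}{\rho^2}\delta-\tfrac{k_{c2}}N\Gamma\sum_i\tfrac{\omega_i}{\rho_i^2}\delta_i,\qquad \dot\Gamma=\beta\Gamma-k_{c1}\Gamma\Lambda\Gamma-\tfrac{k_{c2}}N\Gamma\sum_i\Lambda_i\Gamma,$$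 $$\dot{\hat W}_a=-k_{a1}(\hat W_a-\hat W_c)-k_{a2}\hat W_a+\tfrac{k_{c1}G_\sigma^T\hat W_a\omega^T\hat W_c}{4\rho^2}+\sum_i\tfrac{k_{c2}G_{\sigma i}^T\hat W_a\omega_i^T\hat W_c}{4N\rho_i^2},$$ $$\dot{\hat\theta}=\mathrm{proj}\Big\{k_\theta\Gamma_\theta\sum_{i=1}^M\mathcal Y_i\big[x(t_i)-x(\max\{0,t_i-\Delta t\})-\mathcal U_i-\hat\theta^T\mathcal Y_i\big]^T\Big\},\qquad \dot\Gamma_\theta=\beta_\theta\Gamma_\theta-k_\theta\Gamma_\theta\Big(\sum_i\mathcal Y_i\mathcal Y_i^T\Big)\Gamma_\theta,$$ where $t_i=t_i(t)\in[0,t]$, and $\mathcal Y_i$, $\mathcal U_i$ are the integrals of $Y(x)$, $g(x)u$ over $[\max\{0,t_i-\Delta t\},t_i]$. Here $\mathrm{proj}\{\tau\}=\tau$ if $\|\hat\theta\|\le\bar\theta$ or $\mathrm{tr}(\hat\theta^T\tau)\le0$, and otherwise $\mathrm{proj}\{\tau\}=\tau-\min\{1,(\|\hat\theta\|^2-\bar\theta^2)/\varrho\}\,\frac{\mathrm{tr}(\hat\theta^T\tau)}{\mathrm{tr}(\hat\theta^T\Gamma_\theta\hat\theta)}\Gamma_\theta\hat\theta$,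 with $\varrho>0$. The matrices $\Gamma(0)$, $\Gamma_\theta(0)$ are prescribed, symmetric and positive definite. Solutions on $[0,\infty)$ are continuous and satisfy the equations with right derivatives at every $t\ge0$. Put $\tilde W_c=W(e)-\hat W_c$, $\tilde W_a=W(e)-\hat W_a$, $\tilde\theta=\theta-\hat\theta$, $Z_L=(e,\tilde W_c,\tilde W_a,\mathrm{vec}\,\tilde\theta)$ and $$V_L=V^*(e)+\tfrac12\tilde W_c^T\Gamma^{-1}\tilde W_c+\tfrac12\|\tilde W_a\|^2+\mathrm{tr}(\tilde\theta^T\Gamma_\theta^{-1}\tilde\theta).$$ **Excitation assumptions.** There are $T,T_\theta,\lambda_\theta>0$ and $\underline c_1,\underline c_2,\underline c_3\ge0$, not all zero, such that along the solution $\lambda_{\min}\{\sum_i\mathcal Y_i\mathcal Y_i^T\}\ge\lambda_\theta$ for $t\ge T_\theta$, and for all $t\ge0$: $\underline c_1I\le\frac1N\int_t^{t+T}\sum_i\Lambda_i\,d\tau$, $\underline c_2I\le\frac1N\sum_i\Lambda_i(t)$, $\underline c_3I\le\int_t^{t+T}\Lambda\,d\tau$. **Constants.** $\overline{(\cdot)}$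 is the supremum over $\|e\|\le\zeta$, $y=e$; for $Y$, $gg^\dagger$, $G_\sigma$ (with the factors $\|W\|$, $\|W\|^2$ under the same bar), $\Delta_F$, $\Delta$ below it is the supremum over $\|e\|\le\zeta$, $y\in B_a(e)$; in (and only in) $\overline\Gamma$, $\underline\Gamma$ and their analogues with index $\theta$ bars denote bounds of the gain matrices. Let $$\overline\Gamma=\frac{e^{\beta T}}{\min\{k_{c1}\underline c_3+k_{c2}\max\{\underline c_1,\underline c_2T\},\,\lambda_{\min}\{\Gamma(0)^{-1}\}\}},\qquad\underline\Gamma=\frac1{\max\{\lambda_{\max}\{\Gamma(0)^{-1}\},\frac{k_{c1}+k_{c2}}{4\gamma_1\beta}\}},$$ $$\overline\Gamma_\theta=\frac1{\min\{e^{-\beta_\theta T_\theta}\lambda_{\min}\{\Gamma_\theta(0)^{-1}\},\,k_\theta\lambda_\theta/\beta_\theta\}},\qquad\underline\Gamma_\theta=\frac1{\max\{\lambda_{\max}\{\Gamma_\theta(0)^{-1}\},\,k_\theta M\Delta t^2\nu^2/\beta_\theta\}},$$ $$K_\theta=\beta_\theta/\overline\Gamma_\theta,\qquad D_\theta=2k_\theta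 M\Delta t^2\,\nu\,\sup_{\|e\|\le\zeta}\|\epsilon_\theta(z(e))\|,\qquad\nu=\sup_{\|e\|\le\zeta}\|Y(z(e))\|,\qquad\underline c=\frac{\underline c_2}2+\frac\beta{2\overline\Gamma k_{c2}},$$ $\kappa=\frac{3\sqrt3(k_{c1}+k_{c2})}{16\sqrt{\gamma_1}}$, $\Delta_F=W(e)^T\nabla\sigma(y,c(e))+\nabla\bar B(y)$, $\Delta=\delta(y,e,W(e),W(e),\theta)$, $d=\overline{\|F\|}+\frac12\overline{\|G_R\nabla\sigma^TW\|}+\frac12\overline{\|G_R\nabla\bar B^T\|}$, and $$\varphi_a=\tfrac\kappa4\overline{\|G_\sigma\|}\,\overline{\|W\|}+\tfrac12\overline{\|\nabla W\|}\,\overline{\|G_R\nabla\sigma^T\|},\qquad\varphi_{c\theta}=\kappa\,\overline{\|\Delta_F\|}\big(\overline{\|Y\circ z\|}+\overline{\|g(z(\cdot))g^\dagger(x_d)\|}\,\|Y(x_d)\|\big),$$ $$\varphi_{ac}=k_{a1}+\tfrac\kappa4\overline{\|G_\sigma\|\|W\|}+\tfrac1{2\underline\Gamma}\overline{\|\nabla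 W\|\|G_R\nabla\sigma^T\|},\qquad\iota_c=\kappa\overline{|\Delta|}+\tfrac1{\underline\Gamma}\overline{\|\nabla W\|}\,d,$$ $$\iota_a=k_{a2}\overline{\|W\|}+\tfrac\kappa4\overline{\|G_\sigma\|\|W\|^2}+\overline{\|\nabla W\|}\,d+\tfrac12\overline{\|\nabla V^*\|}\,\overline{\|G_R\nabla\sigma^T\|},$$ $$\iota=\frac{\iota_c^2}{\underline ck_{c2}}+\frac{\iota_a^2}{k_{a1}+k_{a2}}+\frac{D_\theta^2}{K_\theta}+\overline{\|\nabla V^*\|\,\|G_R\|\,\|\nabla\epsilon\|}.$$ Let $\psi,v_l,\underline v_l,\overline v_l$ be class $\mathcal K$ functions such that, for all $Z=(e,w_c,w_a,\vartheta)$ with $e\in\chi$, $$\psi(\|e\|)\le Q(e)+B(e),\qquad v_l(\|Z\|)\le\tfrac{\psi(\|e\|)}2+\tfrac{\underline ck_{c2}}4\|w_c\|^2+\tfrac{k_{a1}+k_{a2}}4\|w_a\|^2+\tfrac{K_\theta}4\|\vartheta\|^2,$$ and $\underline v_l(\|Z\|)\le V_L\le\overline v_l(\|Z\|)$ at $Z_L=Z$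 for all symmetric $\Gamma,\Gamma_\theta$ with $\underline\Gamma I\le\Gamma\le\overline\Gamma I$, $\underline\Gamma_\theta I\le\Gamma_\theta\le\overline\Gamma_\theta I$. **Claim.** Suppose that $\iota$ is in the range of $v_l$ and $$\underline c>\frac{\varphi_{c\theta}+\varphi_{ac}}{k_{c2}},\quad k_{a1}+k_{a2}>2\varphi_a+\varphi_{ac},\quad K_\theta>\varphi_{c\theta},\quad v_l^{-1}(\iota)<\overline v_l^{-1}(\underline v_l(\zeta)).$$ Then $Z_L$ is uniformly ultimately bounded, with ultimate bound $b=\underline v_l^{-1}\big(\overline v_l(v_l^{-1}(\iota))\big)$, along all solutions that satisfy the excitation assumptions (with the given constants) and start with $\|Z_L(0)\|\le\overline v_l^{-1}(\underline v_l(\zeta))$: for each $\eta>0$ there is a time $\tau$, the same for all these solutions, such that $\|Z_L(t)\|\le b+\eta$ for all $t\ge\max\{0,\tau\}$; and each of them satisfies $\limsup_{t\to\infty}\|Z_L(t)\|\le b$ and $\|Z_L(t)\|\le\zeta$ for all $t\ge0$. Moreover each of them stays in the safe set: $x(t)\in\mathrm{Int}(\mathcal X_o)$ for all $t\ge0$ and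 $o\in\bar O$. -/

import Mathlib

open Set Filter Topology MeasureTheory
open ContinuousLinearMap (adjoint)
open scoped RealInnerProductSpace

noncomputable section

namespace StaF

/-! ## Spaces, matrices, class K functions

A real `a × b` matrix is represented by the linear map `E b →L[ℝ] E a` between Euclidean spaces:
its operator norm is the matrix 2-norm, `adjoint` is the transpose and `≤` is the Loewner order. -/

/-- Euclidean space of dimension `k`. -/
abbrev E (k : ℕ) := EuclideanSpace ℝ (Fin k)

/-- Real `p × n` weight matrices, stored by rows, with the norm of `vec`
(that is, the Frobenius norm). -/
abbrev WMat (p n : ℕ) := PiLp 2 (fun _ : Fin p => E n)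

/-- `ϑᵀ y`. -/
def tmul {p n : ℕ} (ϑ : WMat p n) (y : E p) : E n := ∑ j, y j • ϑ j

/-- `y vᵀ`. -/
def outer {p n : ℕ} (y : E p) (v : E n) : WMat p n := WithLp.toLp 2 fun j => y j • v

/-- `A ϑ` for a square matrix `A`. -/
def lmul {p n : ℕ} (A : E p →L[ℝ] E p) (ϑ : WMat p n) : WMat p n :=
  WithLp.toLp 2 fun j => ∑ k, (A (EuclideanSpace.single k 1)) j • ϑ k

/-- Symmetric positive definite matrices. -/
def IsPosDef {k : ℕ} (A : E k →L[ℝ] E k) : Prop :=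
  IsSelfAdjoint A ∧ ∀ v, v ≠ 0 → 0 < ⟪v, A v⟫

/-- Smallest eigenvalue of a symmetric matrix. -/
def lamMin {k : ℕ} (A : E k →L[ℝ] E k) : ℝ := sInf (spectrum ℝ A)

/-- Largest eigenvalue of a symmetric matrix. -/
def lamMax {k : ℕ} (A : E k →L[ℝ] E k) : ℝ := sSup (spectrum ℝ A)

/-- `v vᵀ`. -/
def selfOuter {k : ℕ} (v : E k) : E k →L[ℝ] E k := InnerProductSpace.rankOne ℝ v v

/-- The left pseudo-inverse `(AᵀA)⁻¹ Aᵀ` (of a matrix of full column rank). -/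
def pinv {n m : ℕ} (A : E m →L[ℝ] E n) : E n →L[ℝ] E m :=
  (adjoint A ∘L A).inverse ∘L adjoint A

/-- Class `K` functions on `[0, ∞)`. -/
def IsClassK (α : ℝ → ℝ) : Prop :=
  ContinuousOn α (Ici 0) ∧ StrictMonoOn α (Ici 0) ∧ α 0 = 0

/-- The inverse of a class `K` function (meaningful on its range `α '' [0, ∞)`). -/
def invK (α : ℝ → ℝ) : ℝ → ℝ := Function.invFunOn α (Ici 0)

/-- The smooth projection operator, weighted with the gain matrix `A`: the direction `τ` is kept
where the estimate `ϑ` lies in the ball of radius `θbar` or where `τ` does not point outwards;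
otherwise its outward component is removed progressively over the layer
`θbar² < ‖ϑ‖² ≤ θbar² + ϱ`. -/
def proj {p n : ℕ} (θbar ϱ : ℝ) (A : E p →L[ℝ] E p) (ϑ τ : WMat p n) : WMat p n :=
  open Classical in
  if ‖ϑ‖ ≤ θbar ∨ ⟪ϑ, τ⟫ ≤ 0 then τ
  else τ - (min 1 ((‖ϑ‖ ^ 2 - θbar ^ 2) / ϱ) * (⟪ϑ, τ⟫ / ⟪ϑ, lmul A ϑ⟫)) • lmul A ϑ

/-- `y` is continuous on `[0, ∞)` and its right derivative at each time `t ≥ 0` is `rhs t`. -/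
def Solves {H : Type*} [NormedAddCommGroup H] [NormedSpace ℝ H] (y rhs : ℝ → H) : Prop :=
  ContinuousOn y (Ici 0) ∧ ∀ t, 0 ≤ t → HasDerivWithinAt y (rhs t) (Ici t) t

/-! ## The data -/

/-- The data of the optimal control problem and of the learning scheme: state dimension `n`, input
dimension `m`, `L` kernels, `p` drift features, `N` sampled points, history stack of size `M`,
observations `O`. -/
structure Setup (n m L p N M : ℕ) (O : Type*) where
  /-- drift -/
  f : E n → E n
  /-- control directions -/
  g : E n → (E m →L[ℝ] E n)
  /-- functions defining the regions of interest `{x | 0 ≤ h o x}` -/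
  h : O → E n → ℝ
  /-- observations negated at the current automaton state -/
  neg : Finset O
  /-- regulation point -/
  xd : E n
  /-- state cost -/
  Q : E n → ℝ
  /-- control cost matrix -/
  R : E m →L[ℝ] E m
  /-- value function, in the error coordinate `e = x - xd` -/
  V : E n → ℝ
  /-- compact approximation set -/
  χ : Set (E n)
  /-- an open set around `χ` on which the functions below are regular -/
  Ω : Set (E n)
  /-- kernels, as a function of the point and of the centers -/
  σ : E n → (Fin L → E n) → E L
  /-- state-following centers -/
  c : E n → Fin L → E n
  /-- ideal weight function -/
  W : E n → E L
  /-- radius of the balls in which off-policy points are sampled -/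
  a : ℝ
  /-- sampling functions -/
  smp : Fin N → E n → ℝ → E n
  /-- drift features -/
  Y : E n → E p
  /-- ideal drift weights -/
  θ : WMat p n
  /-- radius of the analysis ball for the composite error -/
  ζ : ℝ
  /-- critic gains, normalization gain, forgetting factor, initial gain matrix -/
  kc1 : ℝ
  kc2 : ℝ
  γ1 : ℝ
  β : ℝ
  Γ0 : E L →L[ℝ] E L
  /-- actor gains -/
  ka1 : ℝ
  ka2 : ℝ
  /-- identification gain, forgetting factor, integration window, initial gain matrix -/
  kθ : ℝ
  βθ : ℝ
  Δt : ℝ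
  Γθ0 : E p →L[ℝ] E p
  /-- radius and layer width of the projection -/
  θbar : ℝ
  ϱ : ℝ

/-- The constants of the two excitation assumptions. -/
structure Excitation where
  T : ℝ
  c1 : ℝ
  c2 : ℝ
  c3 : ℝ
  Tθ : ℝ
  lamθ : ℝ

/-- The conditions on the constants of the excitation assumptions. -/
structure Excitation.Admissible (X : Excitation) : Prop where
  T_pos : 0 < X.T
  c1_nonneg : 0 ≤ X.c1
  c2_nonneg : 0 ≤ X.c2
  c3_nonneg : 0 ≤ X.c3
  some_pos : 0 < X.c1 ∨ 0 < X.c2 ∨ 0 < X.c3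
  Tθ_pos : 0 < X.Tθ
  lamθ_pos : 0 < X.lamθ

namespace Setup

variable {n m L p N M : ℕ} {O : Type*} (S : Setup n m L p N M O)

/-! ## The auxiliary system and the optimal control problem -/

/-- `z(e) = e + x_d`. -/
def z (e : E n) : E n := e + S.xd

/-- `g†(x_d)`. -/
def gd : E n →L[ℝ] E m := pinv (S.g S.xd)

/-- Steady-state control `u_d = -g†(x_d) f(x_d)`. -/
def ud : E m := -S.gd (S.f S.xd)

/-- Drift of the auxiliary system. -/
def F (e : E n) : E n := S.f (S.z e) + S.g (S.z e) S.ud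

/-- Control directions of the auxiliary system. -/
def G (e : E n) : E m →L[ℝ] E n := S.g (S.z e)

/-- Control barrier function `b_o = -1 / h_o`. -/
def b (o : O) (x : E n) : ℝ := -1 / S.h o x

/-- Recentered barrier function. -/
def B (e : E n) : ℝ :=
  ∑ o ∈ S.neg, (S.b o (S.z e) - S.b o S.xd - fderiv ℝ (S.b o) S.xd e) ^ 2

/-- `B / (1 + B)`. -/
def Bbar (y : E n) : ℝ := S.B y / (1 + S.B y)

/-- Instantaneous cost. -/
def r (e : E n) (μ : E m) : ℝ := S.Q e + ⟪μ, S.R μ⟫ + S.B e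

/-- Hamiltonian; `q` stands for the (transposed) gradient. -/
def Ham (e q : E n) (μ : E m) : ℝ := ⟪q, S.F e + S.G e μ⟫ + S.r e μ

/-- The points whose image under `z` satisfies `h_o < 0` for each negated `o`
(where the barrier functions live). -/
def safe : Set (E n) := {e | ∀ o ∈ S.neg, S.h o (S.z e) < 0}

/-- `V` solves the HJB equation `0 = min_μ H(e, ∇V(e), μ)`, `V(0) = 0`, on `χ`, wherever the
barrier functions are defined. -/
def HJB : Prop :=
  S.V 0 = 0 ∧ ∀ e ∈ S.χ ∩ S.safe, IsLeast (range fun μ => S.Ham e (gradient S.V e) μ) 0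

/-- `G_R = G R⁻¹ Gᵀ`. -/
def GR (y : E n) : E n →L[ℝ] E n := S.G y ∘L S.R.inverse ∘L adjoint (S.G y)

/-! ## Approximation of the value function and of the policy -/

/-- `∇_y σ(y, c(e))`. -/
def dσ (e y : E n) : E n →L[ℝ] E L := fderiv ℝ (fun y' => S.σ y' (S.c e)) y

/-- `G_σ = ∇σ G_R ∇σᵀ` at the point `y`, for the centers of `e`. -/
def Gσ (e y : E n) : E L →L[ℝ] E L := S.dσ e y ∘L S.GR y ∘L adjoint (S.dσ e y)

/-- Reconstruction error `ε(e, y)` of `V(y) = W(e)ᵀ σ(y, c(e)) + ε(e, y) + B̄(y)`. -/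
def eps (e y : E n) : ℝ := S.V y - ⟪S.W e, S.σ y (S.c e)⟫ - S.Bbar y

/-- `V̂(y, e, Ŵ_c)`. -/
def Vhat (y e : E n) (wc : E L) : ℝ := ⟪wc, S.σ y (S.c e)⟫ + S.Bbar y

/-- `μ̂(y, e, Ŵ_a)`. -/
def muhat (y e : E n) (wa : E L) : E m :=
  -((1 / 2 : ℝ) • S.R.inverse
    (adjoint (S.G y) (adjoint (S.dσ e y) wa + gradient S.Bbar y)))

/-- `F̂(y, θ̂) = θ̂ᵀ Y(z(y)) - g(z(y)) g†(x_d) θ̂ᵀ Y(x_d)`. -/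
def Fhat (y : E n) (ϑ : WMat p n) : E n :=
  tmul ϑ (S.Y (S.z y)) - S.g (S.z y) (S.gd (tmul ϑ (S.Y S.xd)))

/-- Bellman error `δ(y, e, Ŵ_c, Ŵ_a, θ̂)`. -/
def bellman (y e : E n) (wc wa : E L) (ϑ : WMat p n) : ℝ :=
  S.r y (S.muhat y e wa) +
    ⟪gradient (fun y' => S.Vhat y' e wc) y, S.Fhat y ϑ + S.G y (S.muhat y e wa)⟫

/-- Regressor `ω` evaluated at `y`. -/
def omega (y e : E n) (wa : E L) (ϑ : WMat p n) : E L :=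
  S.dσ e y (S.Fhat y ϑ + S.G y (S.muhat y e wa))

/-- Normalization `ρ = 1 + γ₁ ωᵀω`. -/
def rho (w : E L) : ℝ := 1 + S.γ1 * ‖w‖ ^ 2

/-- `Λ = ω ωᵀ / ρ²`. -/
def Lam (w : E L) : E L →L[ℝ] E L := (1 / S.rho w ^ 2) • selfOuter w

/-- Drift reconstruction error `ε_θ(x) = f(x) - θᵀ Y(x)`. -/
def epsθ (x : E n) : E n := S.f x - tmul S.θ (S.Y x)

/-! ## Assumptions -/

/-- The input matrix has full column rank, and its left pseudo-inverse is bounded and locally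
Lipschitz. -/
def InputAssumption : Prop :=
  (∀ x, Function.Injective (S.g x)) ∧ (∃ C, ∀ x, ‖pinv (S.g x)‖ ≤ C) ∧
    LocallyLipschitz fun x => pinv (S.g x)

/-- Standing assumptions on the data. -/
structure Standing : Prop where
  f_lip : LocallyLipschitz S.f
  g_lip : LocallyLipschitz S.g
  h_smooth : ∀ o, ContDiff ℝ 1 (S.h o)
  xd_safe : ∀ o ∈ S.neg, S.h o S.xd < 0
  Q_zero : S.Q 0 = 0
  Q_pos : ∀ e, e ≠ 0 → 0 < S.Q e
  Q_unbounded : Tendsto S.Q (cocompact (E n)) atTop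
  R_posDef : IsPosDef S.R
  χ_compact : IsCompact S.χ
  Ω_open : IsOpen S.Ω
  χ_sub : S.χ ⊆ S.Ω
  V_smooth : ContDiffOn ℝ 1 S.V S.Ω
  V_pos : ∀ e ∈ S.χ, e ≠ 0 → 0 < S.V e
  V_hjb : S.HJB
  σ_smooth : ContDiffOn ℝ 1 (fun q : E n × (Fin L → E n) => S.σ q.1 q.2)
    (S.Ω ×ˢ univ.pi fun _ => S.Ω)
  c_cont : ContinuousOn S.c S.χ
  c_mem : ∀ e ∈ S.χ, ∀ l, S.c e l ∈ S.χ
  c_distinct : ∀ e ∈ S.χ, Function.Injective (S.c e)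
  W_smooth : ContDiffOn ℝ 1 S.W S.Ω
  a_pos : 0 < S.a
  ζ_pos : 0 < S.ζ
  ball_sub : ∀ e, ‖e‖ ≤ S.ζ → Metric.closedBall e S.a ⊆ S.χ
  N_pos : 0 < N
  smp_mem : ∀ i e t, 0 ≤ t → S.smp i e t ∈ Metric.closedBall e S.a
  Y_cont : Continuous S.Y
  θ_bound : ‖S.θ‖ ≤ S.θbar
  kc1_pos : 0 < S.kc1
  kc2_pos : 0 < S.kc2
  γ1_pos : 0 < S.γ1
  β_pos : 0 < S.β
  Γ0_posDef : IsPosDef S.Γ0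
  ka1_pos : 0 < S.ka1
  ka2_pos : 0 < S.ka2
  kθ_pos : 0 < S.kθ
  βθ_pos : 0 < S.βθ
  Δt_pos : 0 < S.Δt
  Γθ0_posDef : IsPosDef S.Γθ0
  ϱ_pos : 0 < S.ϱ

/-! ## The closed loop -/

/-- The signals of the closed loop on `[0, ∞)`: regulation error `e`, critic and actor weights
`Ŵ_c`, `Ŵ_a`, critic gain `Γ`, drift weights `θ̂`, identification gain `Γ_θ`, and history stack. -/
structure Trajectory {n m L p N M : ℕ} {O : Type*} (_S : Setup n m L p N M O) where
  e : ℝ → E n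
  wc : ℝ → E L
  wa : ℝ → E L
  Γ : ℝ → (E L →L[ℝ] E L)
  ϑ : ℝ → WMat p n
  Γθ : ℝ → (E p →L[ℝ] E p)
  /-- the recording times `t_i` of the data that the history stack holds at time `t` -/
  stamp : Fin M → ℝ → ℝ

namespace Trajectory

variable {S}
variable (tr : S.Trajectory)

/-- Plant state. -/
def x (t : ℝ) : E n := S.z (tr.e t)

/-- Feedback policy. -/
def μ (t : ℝ) : E m := S.muhat (tr.e t) (tr.e t) (tr.wa t)

/-- Input `u = u_d + μ` of the plant. -/
def u (t : ℝ) : E m := S.ud + tr.μ t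

/-- Sampled points `e_i(e(t), t)`. -/
def pt (i : Fin N) (t : ℝ) : E n := S.smp i (tr.e t) t

/-- `ω(t)`. -/
def om (t : ℝ) : E L := S.omega (tr.e t) (tr.e t) (tr.wa t) (tr.ϑ t)

/-- `ω_i(t)`. -/
def omi (i : Fin N) (t : ℝ) : E L := S.omega (tr.pt i t) (tr.e t) (tr.wa t) (tr.ϑ t)

/-- `δ_t`. -/
def δ (t : ℝ) : ℝ := S.bellman (tr.e t) (tr.e t) (tr.wc t) (tr.wa t) (tr.ϑ t)

/-- `δ_{ti}`. -/
def δi (i : Fin N) (t : ℝ) : ℝ :=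
  S.bellman (tr.pt i t) (tr.e t) (tr.wc t) (tr.wa t) (tr.ϑ t)

/-- `𝒴(s) = ∫ Y(x)` over the integration window that ends at `s`. -/
def intY (s : ℝ) : E p := ∫ τ in (max 0 (s - S.Δt))..s, S.Y (tr.x τ)

/-- `𝒰(s) = ∫ g(x) u` over the integration window that ends at `s`. -/
def intU (s : ℝ) : E n := ∫ τ in (max 0 (s - S.Δt))..s, S.g (tr.x τ) (tr.u τ)

/-- `Σ_i 𝒴_i 𝒴_iᵀ`. -/
def stackMat (t : ℝ) : E p →L[ℝ] E p := ∑ i, selfOuter (tr.intY (tr.stamp i t))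

/-- `Σ_i 𝒴_i [x(t_i) - x(t_i - Δt) - 𝒰_i - θ̂ᵀ𝒴_i]ᵀ`. -/
def stackErr (t : ℝ) : WMat p n :=
  ∑ i, outer (tr.intY (tr.stamp i t))
    (tr.x (tr.stamp i t) - tr.x (max 0 (tr.stamp i t - S.Δt)) - tr.intU (tr.stamp i t)
      - tmul (tr.ϑ t) (tr.intY (tr.stamp i t)))

/-- Critic update law. -/
def wcRHS (t : ℝ) : E L :=
  -((S.kc1 * tr.δ t / S.rho (tr.om t) ^ 2) • tr.Γ t (tr.om t))
    - (S.kc2 / N) • tr.Γ t (∑ i, (tr.δi i t / S.rho (tr.omi i t) ^ 2) • tr.omi i t)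

/-- Critic gain update law. -/
def ΓRHS (t : ℝ) : E L →L[ℝ] E L :=
  S.β • tr.Γ t - S.kc1 • (tr.Γ t ∘L S.Lam (tr.om t) ∘L tr.Γ t)
    - (S.kc2 / N) • (tr.Γ t ∘L (∑ i, S.Lam (tr.omi i t)) ∘L tr.Γ t)

/-- Actor update law. -/
def waRHS (t : ℝ) : E L :=
  -(S.ka1 • (tr.wa t - tr.wc t)) - S.ka2 • tr.wa t
    + (S.kc1 * ⟪tr.om t, tr.wc t⟫ / (4 * S.rho (tr.om t) ^ 2)) •
        adjoint (S.Gσ (tr.e t) (tr.e t)) (tr.wa t)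
    + ∑ i, (S.kc2 * ⟪tr.omi i t, tr.wc t⟫ / (4 * N * S.rho (tr.omi i t) ^ 2)) •
        adjoint (S.Gσ (tr.e t) (tr.pt i t)) (tr.wa t)

/-- Drift parameter update law (integral concurrent learning, projected). -/
def ϑRHS (t : ℝ) : WMat p n :=
  proj S.θbar S.ϱ (tr.Γθ t) (tr.ϑ t) (S.kθ • lmul (tr.Γθ t) (tr.stackErr t))

/-- Identification gain update law. -/
def ΓθRHS (t : ℝ) : E p →L[ℝ] E p :=
  S.βθ • tr.Γθ t - S.kθ • (tr.Γθ t ∘L tr.stackMat t ∘L tr.Γθ t)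

/-- The signals solve the auxiliary system `ė = F(e) + G(e) μ` under `μ = μ̂(e, e, Ŵ_a)`, together
with the update laws. (Right derivatives let the history stack and the sampled points be switched
along the trajectory.) -/
structure IsSolution : Prop where
  stamp_mem : ∀ i t, 0 ≤ t → tr.stamp i t ∈ Icc 0 t
  e_sol : Solves tr.e fun t => S.F (tr.e t) + S.G (tr.e t) (tr.μ t)
  wc_sol : Solves tr.wc tr.wcRHS
  wa_sol : Solves tr.wa tr.waRHS
  Γ_sol : Solves tr.Γ tr.ΓRHS
  ϑ_sol : Solves tr.ϑ tr.ϑRHS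
  Γθ_sol : Solves tr.Γθ tr.ΓθRHS
  Γ_init : tr.Γ 0 = S.Γ0
  Γθ_init : tr.Γθ 0 = S.Γθ0

/-- The history stack is rich enough from time `Tθ` on. -/
def RichStack (X : Excitation) : Prop :=
  ∀ t, X.Tθ ≤ t → X.lamθ ≤ lamMin (tr.stackMat t)

/-- The excitation conditions on the regressors. -/
def Excited (X : Excitation) : Prop :=
  (∀ t, 0 ≤ t → X.c1 • (1 : E L →L[ℝ] E L) ≤
      (1 / N : ℝ) • ∫ τ in t..(t + X.T), ∑ i, S.Lam (tr.omi i τ)) ∧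
  (∀ t, 0 ≤ t → X.c2 • (1 : E L →L[ℝ] E L) ≤ (1 / N : ℝ) • ∑ i, S.Lam (tr.omi i t)) ∧
  (∀ t, 0 ≤ t → X.c3 • (1 : E L →L[ℝ] E L) ≤ ∫ τ in t..(t + X.T), S.Lam (tr.om τ))

end Trajectory

/-! ## Composite error and Lyapunov function -/

/-- Norm of the composite error `Z_L` with components `e, W̃_c, W̃_a, vec θ̃`. -/
def normZ (e : E n) (wc wa : E L) (ϑ : WMat p n) : ℝ :=
  √(‖e‖ ^ 2 + ‖wc‖ ^ 2 + ‖wa‖ ^ 2 + ‖ϑ‖ ^ 2)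

/-- `‖Z_L(t)‖`, with `W̃_c = W(e) - Ŵ_c`, `W̃_a = W(e) - Ŵ_a`, `θ̃ = θ - θ̂`. -/
def Trajectory.errNorm {S : Setup n m L p N M O} (tr : S.Trajectory) (t : ℝ) : ℝ :=
  normZ (tr.e t) (S.W (tr.e t) - tr.wc t) (S.W (tr.e t) - tr.wa t) (S.θ - tr.ϑ t)

/-- `V_L`, as a function of the composite error and of the current gain matrices `Γ`, `Γ_θ`;
the last term is `tr(θ̃ᵀ Γ_θ⁻¹ θ̃)`. -/
def VL (Γ : E L →L[ℝ] E L) (Γθ : E p →L[ℝ] E p) (e : E n) (wc wa : E L) (ϑ : WMat p n) : ℝ :=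
  S.V e + 1 / 2 * ⟪wc, Γ.inverse wc⟫ + 1 / 2 * ‖wa‖ ^ 2 + ⟪ϑ, lmul Γθ.inverse ϑ⟫

/-! ## Constants -/

/-- Supremum over the errors `e` of norm at most `ζ`. -/
def supBall (φ : E n → ℝ) : ℝ := sSup (φ '' Metric.closedBall 0 S.ζ)

/-- Supremum for functions that are also evaluated at sampled points: over the errors `e` of norm
at most `ζ` and the points `y` of the closed ball of radius `a` about `e`. -/
def supSmp (φ : E n → E n → ℝ) : ℝ :=
  sSup ((fun q : E n × E n => φ q.1 q.2) ''
    {q | ‖q.1‖ ≤ S.ζ ∧ q.2 ∈ Metric.closedBall q.1 S.a})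

/-- Upper bound for the critic gain matrix. -/
def ΓUp (X : Excitation) : ℝ :=
  1 / (Real.exp (-S.β * X.T) *
    min (S.kc1 * X.c3 + S.kc2 * max X.c1 (X.c2 * X.T)) (lamMin S.Γ0.inverse))

/-- Lower bound for the critic gain matrix. -/
def ΓLow : ℝ := 1 / max (lamMax S.Γ0.inverse) ((S.kc1 + S.kc2) / (4 * S.γ1 * S.β))

/-- Upper bound for the identification gain matrix. -/
def ΓθUp (X : Excitation) : ℝ :=
  1 / min (Real.exp (-S.βθ * X.Tθ) * lamMin S.Γθ0.inverse) (S.kθ * X.lamθ / S.βθ)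

/-- Lower bound for the identification gain matrix. -/
def ΓθLow : ℝ :=
  1 / max (lamMax S.Γθ0.inverse)
    (S.kθ * M * S.Δt ^ 2 * S.supBall (fun e => ‖S.Y (S.z e)‖) ^ 2 / S.βθ)

/-- `K_θ`. -/
def Kθ (X : Excitation) : ℝ := S.βθ / S.ΓθUp X

/-- `D_θ`. -/
def Dθ : ℝ :=
  2 * S.kθ * M * S.Δt ^ 2 * S.supBall (fun e => ‖S.Y (S.z e)‖) *
    S.supBall (fun e => ‖S.epsθ (S.z e)‖)

/-- The constant `c̲`. -/
def cLow (X : Excitation) : ℝ := X.c2 / 2 + S.β / (2 * S.ΓUp X * S.kc2)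

/-- `Δ_F = (W(e)ᵀ ∇_y σ(y, c(e)) + ∇B̄(y))ᵀ`. -/
def ΔF (e y : E n) : E n := adjoint (S.dσ e y) (S.W e) + gradient S.Bbar y

/-- The remainder `Δ` of the Bellman error, that is its value when all weight errors vanish. -/
def Δ (e y : E n) : ℝ := S.bellman y e (S.W e) (S.W e) S.θ

/-- `3√3 (k_{c1} + k_{c2}) / (16 √γ₁)`. -/
def κ : ℝ := 3 * √3 * (S.kc1 + S.kc2) / (16 * √S.γ1)

/-- `∇_e W`. -/
def dW (e : E n) : E n →L[ℝ] E L := fderiv ℝ S.W e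

/-- `G_R ∇_e σᵀ`. -/
def GRσ (e : E n) : E L →L[ℝ] E n := S.GR e ∘L adjoint (S.dσ e e)

/-- The common bound `‖F‖ + ‖G_R ∇σᵀ W‖ / 2 + ‖G_R ∇B̄ᵀ‖ / 2`. -/
def drive : ℝ :=
  S.supBall (fun e => ‖S.F e‖) + S.supBall (fun e => ‖S.GRσ e (S.W e)‖) / 2
    + S.supBall (fun e => ‖S.GR e (gradient S.Bbar e)‖) / 2

def φa : ℝ :=
  S.κ / 4 * S.supSmp (fun e y => ‖S.Gσ e y‖) * S.supBall (fun e => ‖S.W e‖)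
    + S.supBall (fun e => ‖S.dW e‖) * S.supBall (fun e => ‖S.GRσ e‖) / 2

def φcθ : ℝ :=
  S.κ * S.supSmp (fun e y => ‖S.ΔF e y‖) *
    (S.supSmp (fun _ y => ‖S.Y (S.z y)‖)
      + S.supSmp (fun _ y => ‖S.g (S.z y) ∘L S.gd‖) * ‖S.Y S.xd‖)

def φac : ℝ :=
  S.ka1 + S.κ / 4 * S.supSmp (fun e y => ‖S.Gσ e y‖ * ‖S.W e‖)
    + S.supBall (fun e => ‖S.dW e‖ * ‖S.GRσ e‖) / (2 * S.ΓLow)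

def ιc : ℝ :=
  S.κ * S.supSmp (fun e y => |S.Δ e y|) + S.supBall (fun e => ‖S.dW e‖) / S.ΓLow * S.drive

def ιa : ℝ :=
  S.ka2 * S.supBall (fun e => ‖S.W e‖)
    + S.κ / 4 * S.supSmp (fun e y => ‖S.Gσ e y‖ * ‖S.W e‖ ^ 2)
    + S.supBall (fun e => ‖S.dW e‖) * S.drive
    + S.supBall (fun e => ‖gradient S.V e‖) * S.supBall (fun e => ‖S.GRσ e‖) / 2

/-- The constant `ι`. -/
def ι (X : Excitation) : ℝ :=
  S.ιc ^ 2 / (S.cLow X * S.kc2) + S.ιa ^ 2 / (S.ka1 + S.ka2) + S.Dθ ^ 2 / S.Kθ X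
    + S.supBall (fun e =>
        ‖gradient S.V e‖ * ‖S.GR e‖ * ‖gradient (fun y => S.eps e y) e‖)

/-- The class `K` functions of the Lyapunov analysis: `ψ(‖e‖) ≤ Q(e) + B(e)`;
`v_l(‖Z‖) ≤ ψ(‖e‖)/2 + c̲ k_{c2}‖W̃_c‖²/4 + (k_{a1}+k_{a2})‖W̃_a‖²/4 + K_θ‖θ̃‖²/4`; and
`v̲(‖Z‖) ≤ V_L ≤ v̄(‖Z‖)` whatever the gain matrices are within their bounds. -/
structure ClassKBounds (X : Excitation) (ψ vl vlo vup : ℝ → ℝ) : Prop where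
  ψ_K : IsClassK ψ
  vl_K : IsClassK vl
  vlo_K : IsClassK vlo
  vup_K : IsClassK vup
  ψ_le : ∀ e ∈ S.χ, ψ ‖e‖ ≤ S.Q e + S.B e
  vl_le : ∀ e ∈ S.χ, ∀ (wc wa : E L) (ϑ : WMat p n),
    vl (normZ e wc wa ϑ) ≤ ψ ‖e‖ / 2 + S.cLow X * S.kc2 / 4 * ‖wc‖ ^ 2
      + (S.ka1 + S.ka2) / 4 * ‖wa‖ ^ 2 + S.Kθ X / 4 * ‖ϑ‖ ^ 2
  VL_bounds : ∀ (Γ : E L →L[ℝ] E L) (Γθ : E p →L[ℝ] E p),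
    S.ΓLow • (1 : E L →L[ℝ] E L) ≤ Γ → Γ ≤ S.ΓUp X • (1 : E L →L[ℝ] E L) →
    S.ΓθLow • (1 : E p →L[ℝ] E p) ≤ Γθ → Γθ ≤ S.ΓθUp X • (1 : E p →L[ℝ] E p) →
    ∀ e ∈ S.χ, ∀ (wc wa : E L) (ϑ : WMat p n),
      vlo (normZ e wc wa ϑ) ≤ S.VL Γ Γθ e wc wa ϑ ∧
        S.VL Γ Γθ e wc wa ϑ ≤ vup (normZ e wc wa ϑ)

/-- The gain conditions; the last two say that `v_l⁻¹(ι)` exists and is less than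
`v̄⁻¹(v̲(ζ))`. -/
structure GainConditions (X : Excitation) (vl vlo vup : ℝ → ℝ) : Prop where
  critic : (S.φcθ + S.φac) / S.kc2 < S.cLow X
  actor : 2 * S.φa + S.φac < S.ka1 + S.ka2
  ident : S.φcθ < S.Kθ X
  ι_mem : S.ι X ∈ vl '' Ici 0
  region : invK vl (S.ι X) < invK vup (vlo S.ζ)

/-- The trajectories that the result is about: solutions of the closed loop that satisfy the
excitation assumptions and start in the ball of radius `v̄⁻¹(v̲(ζ))`. -/
def Trajectory.Covered {S : Setup n m L p N M O} (tr : S.Trajectory) (X : Excitation)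
    (vlo vup : ℝ → ℝ) : Prop :=
  tr.IsSolution ∧ tr.RichStack X ∧ tr.Excited X ∧ tr.errNorm 0 ≤ invK vup (vlo S.ζ)

/-- The ultimate bound `v̲⁻¹(v̄(v_l⁻¹(ι)))`. -/
def ultBound (X : Excitation) (vl vlo vup : ℝ → ℝ) : ℝ :=
  invK vlo (vup (invK vl (S.ι X)))

end Setup

end StaF

end

/-! The composite function `V_L` decreases strictly wherever the composite error is large. As long
as `‖e‖ ≤ ζ` has held up to time `t`, its right derivative is at most `ι - v_l(‖Z_L‖)`
(`exists_lyap_deriv`). Being squeezed between `v̲(‖Z_L‖)` and `v̄(‖Z_L‖)`, it falls at a definite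
rate down to any level `v̄(r)` with `r > v_l⁻¹(ι)` (`lyap_decay`). A first-exit argument then keeps
`‖Z_L‖ ≤ ζ` (`errNorm_le`), and the rate gives a settling time that depends on the constants alone
(`exists_uniform_time`). Right derivatives suffice throughout, so jumps of the history stack and of
the sampled points do no harm.

The derivative estimate rests on four facts. Gains: the inverse of a least-squares gain solves the
linear equation `(Γ⁻¹)' = A - β Γ⁻¹`, so its quadratic forms obey scalar comparison (`IsGain`).
Excitation bounds them from below, and the forgetting factor turns that bound into damping. Critic
and actor: since `μ̂` minimizes the approximate Hamiltonian, the Bellman error contains the actor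
error, apart from its effect on `ω`, only quadratically (`bellman_eq`). The cubic term this creates
in the critic law is cancelled exactly by the bilinear terms of the actor law (`sample_term_le`).
Value function: the HJB equation turns the derivative of `V*` into `-(Q + B)` plus approximation
errors (`value_term_le`). Identification: integrating the dynamics over the windows exposes `θ̃` in
the prediction error (`stackErr_eq`), and the projection only helps (`ident_term_le`). Completing
squares under the gain conditions (`young_combination`) gives the claim.

Safety comes from the same HJB equation. It bounds `B` on the safe part of `χ` by a continuous
function of `∇V*`, so no barrier blows up there and each `h_o` stays uniformly negative
(`exists_margin`). A connected subset of `χ` that contains a safe point is therefore safe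
(`subset_safe_of_isPreconnected`). In particular the whole `ζ`-ball is safe, so safety follows from
invariance of that ball, and the barrier gradients are continuous where suprema are taken.

Two points need care. The lower bound of the identification gain holds only while `e` remains in the
ball, or for a short initial time. The ordering `v̲(ζ) ≤ v̄(ζ)` needs a composite error of norm `ζ`,
so the zero-dimensional case is treated apart. -/

namespace StaF

/-! ## Comparison lemmas for right derivatives -/

section Comparison

variable {φ φ' : ℝ → ℝ} {a b : ℝ}

theorem le_of_right_deriv_nonpos (hab : a ≤ b) (hc : ContinuousOn φ (Icc a b))
    (hd : ∀ t ∈ Ico a b, HasDerivWithinAt φ (φ' t) (Ici t) t) (h : ∀ t ∈ Ico a b, φ' t ≤ 0) :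
    φ b ≤ φ a :=
  image_le_of_deriv_right_le_deriv_boundary (B := fun _ => φ a) (B' := fun _ => 0) hc hd le_rfl
    continuousOn_const (fun _ _ => hasDerivWithinAt_const _ _ _) h ⟨hab, le_rfl⟩

/-- Either `φ` reaches the level `m`, and then it cannot rise above it because its derivative there
is negative, or it stays above `m` and loses at rate `c` all the time. -/
theorem le_max_of_right_deriv_le {m c : ℝ} (hm : 0 < c) (hab : a ≤ b)
    (hc : ContinuousOn φ (Icc a b))
    (hd : ∀ t ∈ Ico a b, HasDerivWithinAt φ (φ' t) (Ici t) t)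
    (h : ∀ t ∈ Ico a b, m ≤ φ t → φ' t ≤ -c) :
    φ b ≤ max m (φ a - c * (b - a)) := by
  by_cases hex : ∃ t ∈ Icc a b, φ t ≤ m
  · obtain ⟨t, ht, htm⟩ := hex
    refine le_max_of_le_left ?_
    refine image_le_of_deriv_right_lt_deriv_boundary (f := φ) (f' := φ') (a := t) (b := b)
      (B := fun _ => m) (B' := fun _ => 0) (hc.mono (Icc_subset_Icc_left ht.1))
      (fun s hs => hd s ⟨ht.1.trans hs.1, hs.2⟩) htm (fun _ => hasDerivAt_const _ _) ?_
      ⟨ht.2, le_rfl⟩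
    intro s hs hsm
    have := h s ⟨ht.1.trans hs.1, hs.2⟩ hsm.ge
    linarith
  · push Not at hex
    refine le_max_of_le_right ?_
    have h1 := le_of_right_deriv_nonpos (φ := fun t => φ t + c * t) (φ' := fun t => φ' t + c * 1)
      hab (hc.add (by fun_prop))
      (fun t ht => (hd t ht).add ((hasDerivAt_id t).const_mul c).hasDerivWithinAt)
      (fun t ht => by have := h t ht (hex t ⟨ht.1, ht.2.le⟩).le; linarith)
    linarith

/-- Above a level `m > c / β` the derivative is at most `c - β m < 0`, so no level `m` exceeding
both `φ a` and `c / β` is passed; then `m` tends to the maximum. -/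
theorem le_max_of_right_deriv_le_affine {β c : ℝ} (hβ : 0 < β) (hab : a ≤ b)
    (hc : ContinuousOn φ (Icc a b))
    (hd : ∀ t ∈ Ico a b, HasDerivWithinAt φ (φ' t) (Ici t) t)
    (h : ∀ t ∈ Ico a b, φ' t ≤ -β * φ t + c) :
    φ b ≤ max (φ a) (c / β) := by
  refine le_of_forall_gt_imp_ge_of_dense fun m hm => ?_
  obtain ⟨hm1, hm2⟩ := max_lt_iff.1 hm
  have hm3 : c < β * m := by rwa [div_lt_iff₀ hβ, mul_comm] at hm2
  refine (le_max_of_right_deriv_le (m := m) (c := β * m - c) (by linarith) hab hc hd ?_).trans ?_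
  · intro t ht hmt
    have := h t ht
    nlinarith
  · refine max_le le_rfl ?_
    have : 0 ≤ (β * m - c) * (b - a) := mul_nonneg (by linarith) (by linarith)
    linarith

theorem hasDerivWithinAt_exp_mul {φ : ℝ → ℝ} {d β t : ℝ} {s : Set ℝ}
    (hd : HasDerivWithinAt φ d s t) :
    HasDerivWithinAt (fun t => Real.exp (β * t) * φ t) (Real.exp (β * t) * (d + β * φ t)) s t := by
  have h1 : HasDerivAt (fun t => Real.exp (β * t)) (Real.exp (β * t) * (β * 1)) t :=
    ((hasDerivAt_id t).const_mul β).exp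
  refine (h1.hasDerivWithinAt.mul hd).congr_deriv ?_
  ring

end Comparison

/-! ## Symmetric matrices -/

section Symmetric

variable {k : ℕ}

theorem isPosDef_isInvertible {A : E k →L[ℝ] E k} (hA : IsPosDef A) : A.IsInvertible := by
  have hinj : Function.Injective (A : E k →ₗ[ℝ] E k) := by
    rw [← LinearMap.ker_eq_bot, LinearMap.ker_eq_bot']
    intro v hv
    by_contra hne
    have := hA.2 v hne
    have hv' : A v = 0 := hv
    simp [hv'] at this
  exact ⟨(LinearEquiv.ofInjectiveEndo _ hinj).toContinuousLinearEquiv, by ext; rfl⟩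

theorem isInvertible_of_injective {A : E k →L[ℝ] E k} (hA : ∀ v, A v = 0 → v = 0) :
    A.IsInvertible := by
  have hinj : Function.Injective (A : E k →ₗ[ℝ] E k) := by
    rw [← LinearMap.ker_eq_bot, LinearMap.ker_eq_bot']
    exact hA
  exact ⟨(LinearEquiv.ofInjectiveEndo _ hinj).toContinuousLinearEquiv, by ext; rfl⟩

theorem isSelfAdjoint_inner {A : E k →L[ℝ] E k} (hA : IsSelfAdjoint A) (v w : E k) :
    ⟪A v, w⟫ = ⟪v, A w⟫ := hA.isSymmetric v w

theorem isSelfAdjoint_of_inner {A : E k →L[ℝ] E k} (hA : ∀ v w : E k, ⟪A v, w⟫ = ⟪v, A w⟫) :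
    IsSelfAdjoint A :=
  ContinuousLinearMap.isSelfAdjoint_iff_isSymmetric.2 hA

theorem loewner_iff {A B : E k →L[ℝ] E k} (hA : IsSelfAdjoint A) (hB : IsSelfAdjoint B) :
    A ≤ B ↔ ∀ v, ⟪v, A v⟫ ≤ ⟪v, B v⟫ := by
  rw [ContinuousLinearMap.le_def, ContinuousLinearMap.isPositive_iff']
  constructor
  · intro h v
    have := h.2 v
    simp only [sub_apply, inner_sub_left] at this
    rw [isSelfAdjoint_inner hA, isSelfAdjoint_inner hB] at this
    linarith
  · refine fun h => ⟨hB.sub hA, fun v => ?_⟩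
    simp only [sub_apply, inner_sub_left]
    rw [isSelfAdjoint_inner hA, isSelfAdjoint_inner hB]
    linarith [h v]

theorem isSelfAdjoint_smul_one (c : ℝ) : IsSelfAdjoint (c • (1 : E k →L[ℝ] E k)) :=
  isSelfAdjoint_of_inner fun v w => by simp [inner_smul_left, inner_smul_right]

theorem inner_smul_one (c : ℝ) (v : E k) : ⟪v, (c • (1 : E k →L[ℝ] E k)) v⟫ = c * ‖v‖ ^ 2 := by
  simp [inner_smul_right]

theorem loewner_inner {A B : E k →L[ℝ] E k} (h : A ≤ B) (v : E k) : ⟪v, A v⟫ ≤ ⟪v, B v⟫ := by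
  have := ((ContinuousLinearMap.le_def _ _).1 h).inner_nonneg_right v
  simp only [sub_apply, inner_sub_right] at this
  linarith

theorem mem_spectrum_of_hasEigenvalue {A : E k →L[ℝ] E k} {μ : ℝ}
    (h : Module.End.HasEigenvalue (A : E k →ₗ[ℝ] E k) μ) : μ ∈ spectrum ℝ A := by
  obtain ⟨v, hv⟩ := h.exists_hasEigenvector
  intro hu
  obtain ⟨B, hB⟩ := hu.exists_left_inv
  have h1 : (algebraMap ℝ (E k →L[ℝ] E k) μ - A) v = 0 := by
    have := hv.apply_eq_smul
    simp only [ContinuousLinearMap.coe_coe] at this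
    simp [this, Algebra.algebraMap_eq_smul_one]
  have h2 := congrArg (fun C : E k →L[ℝ] E k => C v) hB
  simp only [mul_apply_eq_comp, h1, map_zero, one_apply_eq_self] at h2
  exact hv.2 h2.symm

theorem exists_eigenvector_of_mem_spectrum {A : E k →L[ℝ] E k} {μ : ℝ} (h : μ ∈ spectrum ℝ A) :
    ∃ v, v ≠ 0 ∧ A v = μ • v := by
  by_contra hcon
  push Not at hcon
  apply h
  have : (algebraMap ℝ (E k →L[ℝ] E k) μ - A).IsInvertible := by
    refine isInvertible_of_injective fun v hv => ?_
    by_contra hne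
    refine hcon v hne ?_
    simp only [sub_apply, Algebra.algebraMap_eq_smul_one,
      smul_apply, one_apply_eq_self] at hv
    exact (sub_eq_zero.1 hv).symm
  obtain ⟨e, he⟩ := this
  rw [spectrum.mem_resolventSet_iff, ← he]
  exact (ContinuousLinearEquiv.unitsEquiv ℝ (E k)).symm e |>.isUnit

/-- The infimum of the Rayleigh quotient is an eigenvalue, hence not below the infimum of the
spectrum. -/
theorem lamMin_mul_le {A : E k →L[ℝ] E k} (hA : IsSelfAdjoint A) (v : E k) :
    lamMin A * ‖v‖ ^ 2 ≤ ⟪v, A v⟫ := by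
  rcases eq_or_ne v 0 with rfl | hv
  · simp
  have : Nontrivial (E k) := ⟨v, 0, hv⟩
  have h1 := LinearMap.IsSymmetric.hasEigenvalue_iInf_of_finiteDimensional
    (T := (A : E k →ₗ[ℝ] E k)) hA.isSymmetric
  have h2 : lamMin A ≤ _ := csInf_le (spectrum.isCompact A).bddBelow
    (mem_spectrum_of_hasEigenvalue h1)
  have hv2 : 0 < ‖v‖ ^ 2 := by positivity
  have hbd : BddBelow (range fun x : { x : E k // x ≠ 0 } =>
      RCLike.re ⟪(A : E k →ₗ[ℝ] E k) x, x⟫ / ‖(x : E k)‖ ^ 2) := by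
    refine ⟨-‖A‖, ?_⟩
    rintro _ ⟨x, rfl⟩
    have hx : 0 < ‖(x : E k)‖ ^ 2 := by have := norm_pos_iff.2 x.2; positivity
    rw [le_div_iff₀ hx]
    have h3 := abs_real_inner_le_norm (A x) (x : E k)
    have h4 := A.le_opNorm x
    have h5 := (abs_le.1 h3).1
    simp only [ContinuousLinearMap.coe_coe, RCLike.re_to_real]
    nlinarith [norm_nonneg (x : E k)]
  have h3 := ciInf_le hbd ⟨v, hv⟩
  have h4 := h2.trans h3
  simp only [ContinuousLinearMap.coe_coe, RCLike.re_to_real] at h4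
  rw [le_div_iff₀ hv2, real_inner_comm] at h4
  exact h4

theorem lamMax_eq_neg (A : E k →L[ℝ] E k) : lamMax A = -lamMin (-A) := by
  have h : spectrum ℝ (-A) = -spectrum ℝ A := spectrum.neg_eq A |>.symm
  unfold lamMax lamMin
  rw [h, Real.sInf_def, neg_neg, neg_neg]

theorem le_lamMax_mul {A : E k →L[ℝ] E k} (hA : IsSelfAdjoint A) (v : E k) :
    ⟪v, A v⟫ ≤ lamMax A * ‖v‖ ^ 2 := by
  have := lamMin_mul_le (A := -A) (isSelfAdjoint_of_inner fun a b => by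
    simp [isSelfAdjoint_inner hA]) v
  rw [lamMax_eq_neg]
  simp only [neg_apply, inner_neg_right] at this
  linarith

theorem isPosDef_inverse {A : E k →L[ℝ] E k} (hA : IsPosDef A) : IsPosDef A.inverse := by
  have hi := isPosDef_isInvertible hA
  refine ⟨isSelfAdjoint_of_inner fun v w => ?_, fun v hv => ?_⟩
  · have := isSelfAdjoint_inner hA.1 (A.inverse v) (A.inverse w)
    rw [hi.self_apply_inverse, hi.self_apply_inverse] at this
    exact this.symm
  · have h1 := hA.2 (A.inverse v) fun h => hv (by rw [← hi.self_apply_inverse v, h, map_zero])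
    rwa [hi.self_apply_inverse, real_inner_comm] at h1

/-- Nontriviality matters: in dimension zero the spectrum is empty and its `sInf` is `0`. -/
theorem lamMin_pos [Nontrivial (E k)] {A : E k →L[ℝ] E k} (hA : IsPosDef A) : 0 < lamMin A := by
  have h1 := LinearMap.IsSymmetric.hasEigenvalue_iInf_of_finiteDimensional
    (T := (A : E k →ₗ[ℝ] E k)) hA.1.isSymmetric
  have h2 : lamMin A ∈ spectrum ℝ A :=
    (spectrum.isCompact A).sInf_mem ⟨_, mem_spectrum_of_hasEigenvalue h1⟩
  obtain ⟨v, hv, hAv⟩ := exists_eigenvector_of_mem_spectrum h2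
  have h3 := hA.2 v hv
  rw [hAv, inner_smul_right, real_inner_self_eq_norm_sq] at h3
  have : 0 < ‖v‖ ^ 2 := by have := norm_pos_iff.2 hv; positivity
  exact pos_of_mul_pos_left h3 this.le

theorem lamMin_le_lamMax [Nontrivial (E k)] {A : E k →L[ℝ] E k} (hA : IsSelfAdjoint A) :
    lamMin A ≤ lamMax A := by
  obtain ⟨v, hv⟩ := exists_ne (0 : E k)
  have := (lamMin_mul_le hA v).trans (le_lamMax_mul hA v)
  have h2 : 0 < ‖v‖ ^ 2 := by have := norm_pos_iff.2 hv; positivity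
  exact le_of_mul_le_mul_right this h2

/-- An upper bound of a symmetric matrix is inverted to a lower bound of its inverse. -/
theorem inverse_lower_bound {P : E k →L[ℝ] E k} (hs : IsSelfAdjoint P) (hi : P.IsInvertible)
    (hpos : ∀ v, 0 ≤ ⟪v, P v⟫) {D : ℝ} (hD : 0 < D) (h : ∀ v, ⟪v, P v⟫ ≤ D * ‖v‖ ^ 2) (v : E k) :
    1 / D * ‖v‖ ^ 2 ≤ ⟪v, P.inverse v⟫ := by
  set u := P.inverse v with hu
  have hv : v = P u := (hi.self_apply_inverse v).symm
  -- Positivity at `u - P u / D`, once expanded, bounds `⟪u, P u⟫` below by `2/D ‖P u‖²` minus `1/D²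
  -- ⟪P u, P (P u)⟫`, and the latter is at most `1/D ‖P u‖²`.
  have h0 := hpos (u - (1 / D) • P u)
  have h1 := h (P u)
  have h3 : ⟪P u, P u⟫ = ‖P u‖ ^ 2 := real_inner_self_eq_norm_sq _
  have h4 : ⟪u, P (P u)⟫ = ‖P u‖ ^ 2 := by rw [← isSelfAdjoint_inner hs, h3]
  simp only [map_sub, map_smul, inner_sub_left, inner_sub_right, inner_smul_left,
    inner_smul_right, h3, h4, RCLike.conj_to_real] at h0
  have h5 : (1 / D) * ((1 / D) * ⟪P u, P (P u)⟫) ≤ (1 / D) * ‖P u‖ ^ 2 := by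
    refine mul_le_mul_of_nonneg_left ?_ (by positivity)
    rw [one_div, inv_mul_le_iff₀ hD]
    exact h1
  rw [hv, real_inner_comm]
  linarith

/-- Coercivity and Cauchy–Schwarz give `D ‖u‖ ≤ ‖P u‖` for `u = P⁻¹ v`. -/
theorem inverse_upper_bound {P : E k →L[ℝ] E k} (hi : P.IsInvertible)
    {D : ℝ} (hD : 0 < D) (h : ∀ v, D * ‖v‖ ^ 2 ≤ ⟪v, P v⟫) (v : E k) :
    ⟪v, P.inverse v⟫ ≤ 1 / D * ‖v‖ ^ 2 := by
  set u := P.inverse v with hu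
  have hv : v = P u := (hi.self_apply_inverse v).symm
  rw [hv]
  have h1 := h u
  have h2 := real_inner_le_norm u (P u)
  have h3 : D * ‖u‖ ≤ ‖P u‖ := by
    rcases (norm_nonneg u).eq_or_lt with h0 | h0
    · rw [← h0]; simp
    · nlinarith
  have h4 : ‖u‖ ≤ 1 / D * ‖P u‖ := by
    rw [one_div, le_inv_mul_iff₀ hD]; exact h3
  have h5 := real_inner_comm u (P u)
  rw [h5]
  nlinarith [norm_nonneg (P u)]

theorem selfOuter_apply (v w : E k) : selfOuter v w = ⟪v, w⟫ • v := by
  simp [selfOuter]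

theorem inner_selfOuter (v w : E k) : ⟪w, selfOuter v w⟫ = ⟪v, w⟫ ^ 2 := by
  rw [selfOuter_apply, inner_smul_right, real_inner_comm w v, sq]

theorem isSelfAdjoint_selfOuter (v : E k) : IsSelfAdjoint (selfOuter v) :=
  isSelfAdjoint_of_inner fun a b => by
    simp only [selfOuter_apply, inner_smul_left, inner_smul_right, RCLike.conj_to_real]
    rw [real_inner_comm v a]; ring

theorem norm_selfOuter_le (v : E k) : ‖selfOuter v‖ ≤ ‖v‖ ^ 2 := by
  refine ContinuousLinearMap.opNorm_le_bound _ (by positivity) fun w => ?_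
  rw [selfOuter_apply, norm_smul]
  have := norm_inner_le_norm (𝕜 := ℝ) v w
  nlinarith [norm_nonneg v]

end Symmetric


/-! ## Weight matrices -/

section Weights

variable {p n : ℕ}

instance : ContinuousSMul ℝ (WMat p n) := inferInstance

instance : ContinuousAdd (WMat p n) := inferInstance

instance : ContinuousConstSMul ℝ (WMat p n) := inferInstance

/-- The columns of a weight matrix. -/
noncomputable def col (i : Fin n) : WMat p n →L[ℝ] E p :=
  LinearMap.toContinuousLinearMap
    { toFun := fun ϑ => WithLp.toLp 2 fun j => ϑ j i
      map_add' := fun _ _ => by ext; simp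
      map_smul' := fun _ _ => by ext; simp }

@[simp] theorem col_apply (i : Fin n) (ϑ : WMat p n) (j : Fin p) : col i ϑ j = ϑ j i := rfl

theorem ext_col {ϑ ϑ' : WMat p n} (h : ∀ i, col i ϑ = col i ϑ') : ϑ = ϑ' := by
  ext j i
  have := congrArg (fun v : E p => v j) (h i)
  simpa using this

theorem inner_eq_sum_col (ϑ ϑ' : WMat p n) : ⟪ϑ, ϑ'⟫ = ∑ i, ⟪col i ϑ, col i ϑ'⟫ := by
  simp only [PiLp.inner_apply, col_apply]
  exact Finset.sum_comm

theorem norm_sq_eq_sum_col (ϑ : WMat p n) : ‖ϑ‖ ^ 2 = ∑ i, ‖col i ϑ‖ ^ 2 := by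
  simp_rw [← real_inner_self_eq_norm_sq]
  exact inner_eq_sum_col ϑ ϑ

/-- This reduces matrix-weighted estimates in the Frobenius inner product to vector estimates, one
per column. -/
theorem col_lmul (A : E p →L[ℝ] E p) (i : Fin n) (ϑ : WMat p n) :
    col i (lmul A ϑ) = A (col i ϑ) := by
  have h : col i ϑ = ∑ k, (ϑ k i) • EuclideanSpace.single k (1 : ℝ) := by
    ext j
    simp [Pi.single_apply]
  rw [h, map_sum]
  ext j
  simp [lmul, mul_comm]

theorem col_outer (i : Fin n) (y : E p) (v : E n) : col i (outer y v) = v i • y := by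
  ext j
  simp [outer, mul_comm]

theorem tmul_apply (ϑ : WMat p n) (y : E p) (i : Fin n) : tmul ϑ y i = ⟪col i ϑ, y⟫ := by
  simp [tmul, PiLp.inner_apply]

theorem tmul_sub (ϑ ϑ' : WMat p n) (y : E p) : tmul (ϑ - ϑ') y = tmul ϑ y - tmul ϑ' y := by
  simp [tmul, smul_sub, Finset.sum_sub_distrib]

theorem continuous_tmul_right (ϑ : WMat p n) : Continuous (tmul ϑ) := by
  unfold tmul
  fun_prop

theorem norm_tmul_le (ϑ : WMat p n) (y : E p) : ‖tmul ϑ y‖ ≤ ‖ϑ‖ * ‖y‖ := by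
  refine le_of_sq_le_sq ?_ (by positivity)
  rw [mul_pow, norm_sq_eq_sum_col, EuclideanSpace.norm_sq_eq, Finset.sum_mul]
  refine Finset.sum_le_sum fun i _ => ?_
  rw [tmul_apply, Real.norm_eq_abs, ← mul_pow]
  exact pow_le_pow_left₀ (abs_nonneg _) (abs_real_inner_le_norm _ _) 2

theorem inner_outer (ϑ : WMat p n) (y : E p) (v : E n) : ⟪ϑ, outer y v⟫ = ⟪tmul ϑ y, v⟫ := by
  rw [inner_eq_sum_col, PiLp.inner_apply]
  refine Finset.sum_congr rfl fun i _ => ?_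
  rw [col_outer, inner_smul_right, tmul_apply]
  simp

theorem lmul_lmul (A B : E p →L[ℝ] E p) (ϑ : WMat p n) :
    lmul A (lmul B ϑ) = lmul (A ∘L B) ϑ :=
  ext_col fun i => by simp [col_lmul]

theorem lmul_sub (A : E p →L[ℝ] E p) (ϑ ϑ' : WMat p n) :
    lmul A (ϑ - ϑ') = lmul A ϑ - lmul A ϑ' :=
  ext_col fun i => by simp [col_lmul]

theorem lmul_smul (A : E p →L[ℝ] E p) (c : ℝ) (ϑ : WMat p n) :
    lmul A (c • ϑ) = c • lmul A ϑ :=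
  ext_col fun i => by simp [col_lmul]

theorem lmul_id (ϑ : WMat p n) : lmul (.id ℝ (E p)) ϑ = ϑ :=
  ext_col fun i => by simp [col_lmul]

theorem inner_lmul_lower {A : E p →L[ℝ] E p} {c : ℝ} (h : ∀ v, c * ‖v‖ ^ 2 ≤ ⟪v, A v⟫)
    (ϑ : WMat p n) : c * ‖ϑ‖ ^ 2 ≤ ⟪ϑ, lmul A ϑ⟫ := by
  rw [inner_eq_sum_col, norm_sq_eq_sum_col, Finset.mul_sum]
  exact Finset.sum_le_sum fun i _ => by rw [col_lmul]; exact h _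

theorem inner_lmul_sum_selfOuter {ι : Type*} (s : Finset ι) (y : ι → E p) (ϑ : WMat p n) :
    ⟪ϑ, lmul (∑ i ∈ s, selfOuter (y i)) ϑ⟫ = ∑ i ∈ s, ‖tmul ϑ (y i)‖ ^ 2 := by
  simp only [inner_eq_sum_col, col_lmul, sum_apply, inner_sum, inner_selfOuter]
  rw [Finset.sum_comm]
  refine Finset.sum_congr rfl fun i _ => ?_
  rw [EuclideanSpace.norm_sq_eq]
  refine Finset.sum_congr rfl fun j _ => ?_
  rw [tmul_apply, Real.norm_eq_abs, sq_abs, real_inner_comm]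

/-- Symmetry of `P t` merges the two cross terms of the product rule. -/
theorem hasDerivWithinAt_inner_apply {P : ℝ → (E p →L[ℝ] E p)} {P' : E p →L[ℝ] E p}
    {w : ℝ → E p} {w' : E p} {s : Set ℝ} {t : ℝ} (hs : IsSelfAdjoint (P t))
    (hP : HasDerivWithinAt P P' s t) (hw : HasDerivWithinAt w w' s t) :
    HasDerivWithinAt (fun τ => ⟪w τ, P τ (w τ)⟫) (2 * ⟪w t, P t w'⟫ + ⟪w t, P' (w t)⟫) s t := by
  refine (hw.inner ℝ (hP.clm_apply hw)).congr_deriv ?_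
  have h1 := isSelfAdjoint_inner hs (w t) w'
  have h2 := real_inner_comm (P t (w t)) w'
  rw [inner_add_right]
  linarith

theorem hasDerivWithinAt_inner_lmul {P : ℝ → (E p →L[ℝ] E p)} {P' : E p →L[ℝ] E p}
    {ϑ : ℝ → WMat p n} {ϑ' : WMat p n} {s : Set ℝ} {t : ℝ} (hs : IsSelfAdjoint (P t))
    (hP : HasDerivWithinAt P P' s t) (hϑ : HasDerivWithinAt ϑ ϑ' s t) :
    HasDerivWithinAt (fun τ => ⟪ϑ τ, lmul (P τ) (ϑ τ)⟫)
      (2 * ⟪ϑ t, lmul (P t) ϑ'⟫ + ⟪ϑ t, lmul P' (ϑ t)⟫) s t := by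
  simp only [inner_eq_sum_col, col_lmul]
  have h : ∀ i ∈ Finset.univ, HasDerivWithinAt (fun τ => ⟪col i (ϑ τ), P τ (col i (ϑ τ))⟫)
      (2 * ⟪col i (ϑ t), P t (col i ϑ')⟫ + ⟪col i (ϑ t), P' (col i (ϑ t))⟫) s t := by
    intro i _
    have h1 : HasDerivWithinAt (fun τ => col i (ϑ τ)) (col i ϑ') s t :=
      (col i).hasFDerivAt.comp_hasDerivWithinAt t hϑ
    exact hasDerivWithinAt_inner_apply hs hP h1
  refine (HasDerivWithinAt.fun_sum h).congr_deriv ?_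
  rw [Finset.sum_add_distrib, Finset.mul_sum]

end Weights


/-! ## Least-squares gain matrices -/

theorem isSelfAdjoint_inverse {k : ℕ} {A : E k →L[ℝ] E k} (hA : IsSelfAdjoint A)
    (hi : A.IsInvertible) : IsSelfAdjoint A.inverse :=
  isSelfAdjoint_of_inner fun v w => by
    have := isSelfAdjoint_inner hA (A.inverse v) (A.inverse w)
    rw [hi.self_apply_inverse, hi.self_apply_inverse] at this
    exact this.symm

theorem hasDerivWithinAt_inverse {k : ℕ} {Γ : ℝ → (E k →L[ℝ] E k)} {Γ' : E k →L[ℝ] E k}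
    {s : Set ℝ} {t : ℝ} (hi : (Γ t).IsInvertible) (hd : HasDerivWithinAt Γ Γ' s t) :
    HasDerivWithinAt (fun τ => (Γ τ).inverse) (-((Γ t).inverse ∘L Γ' ∘L (Γ t).inverse)) s t := by
  obtain ⟨e, he⟩ := hi
  set u := (ContinuousLinearEquiv.unitsEquiv ℝ (E k)).symm e with hu
  have h1 : (u : E k →L[ℝ] E k) = Γ t := he
  have h3 := hasFDerivAt_ringInverse (𝕜 := ℝ) u
  have h2 : ((u⁻¹ : (E k →L[ℝ] E k)ˣ) : E k →L[ℝ] E k) = (Γ t).inverse := by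
    rw [← he, ContinuousLinearMap.inverse_equiv]; rfl
  rw [h1] at h3
  have h4 := h3.comp_hasDerivWithinAt t hd
  rw [ContinuousLinearMap.ringInverse_eq_inverse] at h4
  refine h4.congr_deriv ?_
  rw [h2]
  rfl

theorem continuousWithinAt_inverse {k : ℕ} {Γ : ℝ → (E k →L[ℝ] E k)}
    {s : Set ℝ} {t : ℝ} (hi : (Γ t).IsInvertible) (hd : ContinuousWithinAt Γ s t) :
    ContinuousWithinAt (fun τ => (Γ τ).inverse) s t := by
  obtain ⟨e, he⟩ := hi
  set u := (ContinuousLinearEquiv.unitsEquiv ℝ (E k)).symm e with hu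
  have h1 : (u : E k →L[ℝ] E k) = Γ t := he
  have h3 := (hasFDerivAt_ringInverse (𝕜 := ℝ) u).continuousAt
  rw [ContinuousLinearMap.ringInverse_eq_inverse, h1] at h3
  exact h3.comp_continuousWithinAt hd

/-- `Γ` solves `Γ' = β Γ - Γ A Γ` from a symmetric positive definite initial value. -/
structure IsGain {k : ℕ} (β : ℝ) (Γ A : ℝ → (E k →L[ℝ] E k)) : Prop where
  pos : 0 < β
  sol : Solves Γ fun t => β • Γ t - Γ t ∘L A t ∘L Γ t
  init : IsPosDef (Γ 0)
  symm : ∀ t, 0 ≤ t → IsSelfAdjoint (A t)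
  bdd : ∀ t, ∃ C, ∀ s ∈ Icc 0 t, ‖A s‖ ≤ C

namespace IsGain

variable {k : ℕ} {β : ℝ} {Γ A : ℝ → (E k →L[ℝ] E k)} (h : IsGain β Γ A)

include h

/-- If `Γ t v = 0`, the curve `y = Γ v` solves the linear equation `y' = β y - Γ A y` and vanishes
at `t`. By uniqueness it vanishes at time `0`, where `Γ` is positive definite. -/
theorem isInvertible {t : ℝ} (ht : 0 ≤ t) : (Γ t).IsInvertible := by
  refine isInvertible_of_injective fun v hv => ?_
  obtain ⟨C, hC⟩ := h.bdd t
  obtain ⟨D, hD⟩ := isCompact_Icc.exists_bound_of_continuousOn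
    (h.sol.1.mono (fun x hx => hx.1 : Icc 0 t ⊆ Ici 0))
  -- Chosen large enough that `exp (2 c s) ‖Γ s v‖²` is nondecreasing on `[0, t]`.
  set c := β + D * C with hc
  have hyd : ∀ s ∈ Ico 0 t, HasDerivWithinAt (fun s => Γ s v)
      ((β • Γ s - Γ s ∘L A s ∘L Γ s) v) (Ici s) s := fun s hs => by
    simpa using (h.sol.2 s hs.1).clm_apply (hasDerivWithinAt_const s (Ici s) v)
  have hyc : ContinuousOn (fun s => Γ s v) (Icc 0 t) :=
    (h.sol.1.mono (fun x hx => hx.1 : Icc 0 t ⊆ Ici 0)).clm_apply continuousOn_const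
  have key := le_of_right_deriv_nonpos (φ := fun s => -(Real.exp (2 * c * s) * ‖Γ s v‖ ^ 2)) ht
    ((ContinuousOn.mul (by fun_prop) (hyc.norm.pow 2)).neg)
    (fun s hs => (hasDerivWithinAt_exp_mul (hyd s hs).norm_sq).neg) ?_
  · rw [hv] at key
    simp only [norm_zero, mul_zero, Real.exp_zero, one_mul, ne_eq, OfNat.ofNat_ne_zero,
      not_false_eq_true, zero_pow, neg_zero] at key
    have h0 : Γ 0 v = 0 := by
      rw [← norm_eq_zero]
      nlinarith [norm_nonneg (Γ 0 v)]
    rw [← (isPosDef_isInvertible h.init).inverse_apply_self v, h0, map_zero]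
  · intro s hs
    have hs' : s ∈ Icc 0 t := ⟨hs.1, hs.2.le⟩
    set y := Γ s v
    have h1 : ‖(Γ s) (A s y)‖ ≤ D * C * ‖y‖ := by
      refine ((Γ s).le_opNorm _).trans ?_
      have h2 := ((A s).le_opNorm y).trans
        (mul_le_mul_of_nonneg_right (hC s hs') (norm_nonneg y))
      calc _ ≤ D * (C * ‖y‖) := mul_le_mul (hD s hs') h2 (norm_nonneg _)
            ((norm_nonneg _).trans (hD s hs'))
        _ = _ := by ring
    have h3 := (abs_le.1 (abs_real_inner_le_norm y ((Γ s) (A s y)))).2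
    have h4 : ‖y‖ * ‖(Γ s) (A s y)‖ ≤ ‖y‖ * (D * C * ‖y‖) :=
      mul_le_mul_of_nonneg_left h1 (norm_nonneg _)
    have h5 : (β • Γ s - Γ s ∘L A s ∘L Γ s) v = β • y - Γ s (A s y) := rfl
    have h6 := h.pos
    rw [h5, inner_sub_right, inner_smul_right, real_inner_self_eq_norm_sq, neg_nonpos]
    refine mul_nonneg (Real.exp_pos _).le ?_
    nlinarith [sq_nonneg ‖y‖]

theorem continuousOn_inverse : ContinuousOn (fun t => (Γ t).inverse) (Ici 0) :=
  fun t ht => continuousWithinAt_inverse (h.isInvertible ht) (h.sol.1 t ht)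

/-- Passing to the inverse makes the Riccati equation linear; the bounds on the gain are read off
from this equation, one vector `v` at a time. -/
theorem hasDerivWithinAt_inverse {t : ℝ} (ht : 0 ≤ t) :
    HasDerivWithinAt (fun τ => (Γ τ).inverse) (A t - β • (Γ t).inverse) (Ici t) t := by
  have hi := h.isInvertible ht
  refine (StaF.hasDerivWithinAt_inverse hi (h.sol.2 t ht)).congr_deriv ?_
  ext1 v
  simp [hi.self_apply_inverse, hi.inverse_apply_self]

theorem hasDerivWithinAt_form {t : ℝ} (ht : 0 ≤ t) (v w : E k) :
    HasDerivWithinAt (fun τ => ⟪v, (Γ τ).inverse w⟫) (⟪v, A t w⟫ - β * ⟪v, (Γ t).inverse w⟫)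
      (Ici t) t := by
  have h1 := (h.hasDerivWithinAt_inverse ht).clm_apply (hasDerivWithinAt_const t (Ici t) w)
  have h2 := (hasDerivWithinAt_const t (Ici t) v).inner ℝ h1
  refine h2.congr_deriv ?_
  simp [inner_sub_right, inner_smul_right]

theorem continuousOn_form (v w : E k) :
    ContinuousOn (fun τ => ⟪v, (Γ τ).inverse w⟫) (Ici 0) :=
  ContinuousOn.inner continuousOn_const (h.continuousOn_inverse.clm_apply continuousOn_const)

/-- The antisymmetric part of `Γ⁻¹` starts at zero and, as `A` is symmetric, solves `φ' = -β φ`.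
Comparison in both orders of `v` and `w` forces it to vanish. -/
theorem isSelfAdjoint_inverse {t : ℝ} (ht : 0 ≤ t) : IsSelfAdjoint (Γ t).inverse := by
  refine isSelfAdjoint_of_inner fun v w => ?_
  have key : ∀ v w : E k, ⟪w, (Γ t).inverse v⟫ - ⟪v, (Γ t).inverse w⟫ ≤ 0 := by
    intro v w
    have h1 := le_max_of_right_deriv_le_affine (c := 0)
      (φ := fun t => ⟪w, (Γ t).inverse v⟫ - ⟪v, (Γ t).inverse w⟫) h.pos ht
      (((h.continuousOn_form w v).sub (h.continuousOn_form v w)).mono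
        (fun x hx => hx.1 : Icc 0 t ⊆ Ici 0))
      (fun s hs => (h.hasDerivWithinAt_form hs.1 w v).sub (h.hasDerivWithinAt_form hs.1 v w))
      (fun s hs => by
        have := isSelfAdjoint_inner (h.symm s hs.1) w v
        rw [real_inner_comm] at this
        rw [this]
        linarith)
    have h2 := isSelfAdjoint_inner (isPosDef_inverse h.init).1 w v
    rw [real_inner_comm] at h2
    simpa [h2] using h1
  rw [real_inner_comm]
  exact le_antisymm (by linarith [key v w]) (by linarith [key w v])

theorem isSelfAdjoint {t : ℝ} (ht : 0 ≤ t) : IsSelfAdjoint (Γ t) := by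
  have h1 := StaF.isSelfAdjoint_inverse (h.isSelfAdjoint_inverse ht) (h.isInvertible ht).inverse
  rwa [(h.isInvertible ht).inverse_inverse] at h1

theorem form_le {t c : ℝ} (ht : 0 ≤ t) (v : E k)
    (hA : ∀ s ∈ Ico 0 t, ⟪v, A s v⟫ ≤ c * ‖v‖ ^ 2) :
    ⟪v, (Γ t).inverse v⟫ ≤ max (lamMax (Γ 0).inverse) (c / β) * ‖v‖ ^ 2 := by
  have h1 := le_max_of_right_deriv_le_affine (c := c * ‖v‖ ^ 2) h.pos ht
    ((h.continuousOn_form v v).mono (fun x hx => hx.1 : Icc 0 t ⊆ Ici 0))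
    (fun s hs => h.hasDerivWithinAt_form hs.1 v v)
    (fun s hs => by linarith [hA s hs])
  refine h1.trans ?_
  rw [max_mul_of_nonneg _ _ (sq_nonneg _)]
  refine max_le_max (le_lamMax_mul (isPosDef_inverse h.init).1 v) ?_
  rw [div_mul_eq_mul_div]

/-- The form of `exp (β s) Γ⁻¹` has derivative `exp (β s) ⟪v, A v⟫ ≥ 0`: forgetting is the only
source of loss. -/
theorem exp_mul_form_le {a b : ℝ} (ha : 0 ≤ a) (hab : a ≤ b) (v : E k)
    (hA : ∀ s ∈ Ico a b, 0 ≤ ⟪v, A s v⟫) :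
    Real.exp (-β * (b - a)) * ⟪v, (Γ a).inverse v⟫ ≤ ⟪v, (Γ b).inverse v⟫ := by
  have h1 := le_of_right_deriv_nonpos
    (φ := fun s => -(Real.exp (β * s) * ⟪v, (Γ s).inverse v⟫)) hab
    ((ContinuousOn.mul (by fun_prop) ((h.continuousOn_form v v).mono
      (fun x hx => ha.trans hx.1 : Icc a b ⊆ Ici 0))).neg)
    (fun s hs => (hasDerivWithinAt_exp_mul
      (h.hasDerivWithinAt_form (ha.trans hs.1) v v)).neg)
    (fun s hs => by
      rw [neg_nonpos]
      exact mul_nonneg (Real.exp_pos _).le (by linarith [hA s hs]))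
  simp only [neg_le_neg_iff] at h1
  have h2 : Real.exp (-β * (b - a)) = Real.exp (-(β * b)) * Real.exp (β * a) := by
    rw [← Real.exp_add]; ring_nf
  rw [h2, mul_assoc, Real.exp_neg, inv_mul_le_iff₀ (Real.exp_pos _)]
  exact h1

theorem form_nonneg {t : ℝ} (ht : 0 ≤ t) (v : E k) (hA : ∀ s ∈ Ico 0 t, 0 ≤ ⟪v, A s v⟫) :
    0 ≤ ⟪v, (Γ t).inverse v⟫ := by
  refine le_trans (mul_nonneg (Real.exp_pos _).le ?_) (h.exp_mul_form_le le_rfl ht v hA)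
  rcases eq_or_ne v 0 with rfl | hv
  · simp
  · exact ((isPosDef_inverse h.init).2 v hv).le

theorem min_le_form {a b c : ℝ} (ha : 0 ≤ a) (hab : a ≤ b) (v : E k)
    (hA : ∀ s ∈ Ico a b, c ≤ ⟪v, A s v⟫) :
    min ⟪v, (Γ a).inverse v⟫ (c / β) ≤ ⟪v, (Γ b).inverse v⟫ := by
  have h1 := le_max_of_right_deriv_le_affine (c := -c)
    (φ := fun s => -⟪v, (Γ s).inverse v⟫) h.pos hab
    ((h.continuousOn_form v v).mono (fun x hx => ha.trans hx.1 : Icc a b ⊆ Ici 0)).neg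
    (fun s hs => (h.hasDerivWithinAt_form (ha.trans hs.1) v v).neg)
    (fun s hs => by linarith [hA s hs])
  rw [neg_div, max_neg_neg] at h1
  linarith

/-- Integrates the derivative of `exp (β s) ⟪v, Γ⁻¹ v⟫` over `[a, b]`. A minorant `g` stands in for
`⟪v, A v⟫`, whose integrability in time is not known. -/
theorem exp_mul_integral_le_form {a b : ℝ} (ha : 0 ≤ a) (hab : a ≤ b) (v : E k) {g : ℝ → ℝ}
    (hg : IntegrableOn g (Icc a b)) (hgA : ∀ s ∈ Ico a b, g s ≤ ⟪v, A s v⟫)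
    (hA : ∀ s ∈ Ico 0 b, 0 ≤ ⟪v, A s v⟫) :
    Real.exp (-β * (b - a)) * ∫ s in a..b, g s ≤ ⟪v, (Γ b).inverse v⟫ := by
  have h1 := intervalIntegral.integral_le_sub_of_hasDeriv_right_of_le
    (g := fun s => Real.exp (β * s) * ⟪v, (Γ s).inverse v⟫)
    (φ := fun s => Real.exp (β * a) * g s) hab
    (ContinuousOn.mul (by fun_prop) ((h.continuousOn_form v v).mono
      (fun x hx => ha.trans hx.1 : Icc a b ⊆ Ici 0)))
    (fun s hs => (hasDerivWithinAt_exp_mul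
      (h.hasDerivWithinAt_form (ha.trans hs.1.le) v v)).mono Ioi_subset_Ici_self)
    (hg.const_mul _) (fun s hs => by
      have h2 := hgA s ⟨hs.1.le, hs.2⟩
      have h3 := hA s ⟨ha.trans hs.1.le, hs.2⟩
      have h4 : Real.exp (β * a) ≤ Real.exp (β * s) :=
        Real.exp_le_exp.2 (mul_le_mul_of_nonneg_left hs.1.le h.pos.le)
      rw [sub_add_cancel]
      exact (mul_le_mul_of_nonneg_left h2 (Real.exp_pos _).le).trans
        (mul_le_mul_of_nonneg_right h4 h3))
  rw [intervalIntegral.integral_const_mul] at h1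
  have h5 := h.form_nonneg ha v fun s hs => hA s ⟨hs.1, hs.2.trans_le hab⟩
  have h2 : Real.exp (-β * (b - a)) = Real.exp (-(β * b)) * Real.exp (β * a) := by
    rw [← Real.exp_add]; ring_nf
  rw [h2, mul_assoc, Real.exp_neg, inv_mul_le_iff₀ (Real.exp_pos _)]
  have := mul_nonneg (Real.exp_pos (β * a)).le h5
  linarith

/-- Bounds of the inverse give Loewner bounds of the gain. -/
theorem loewner_bounds {t lo up : ℝ} (ht : 0 ≤ t) (hlo : 0 < lo)
    (hup : ∀ v, ⟪v, (Γ t).inverse v⟫ ≤ lo * ‖v‖ ^ 2)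
    (hlow : ∀ v, up * ‖v‖ ^ 2 ≤ ⟪v, (Γ t).inverse v⟫) (hupos : Nontrivial (E k) → 0 < up)
    (hpos : ∀ v, 0 ≤ ⟪v, (Γ t).inverse v⟫) :
    (1 / lo) • (1 : E k →L[ℝ] E k) ≤ Γ t ∧ Γ t ≤ (1 / up) • (1 : E k →L[ℝ] E k) := by
  have hi := (h.isInvertible ht)
  constructor
  · rw [loewner_iff (isSelfAdjoint_smul_one _) (h.isSelfAdjoint ht)]
    intro v
    rw [inner_smul_one]
    have := inverse_lower_bound (h.isSelfAdjoint_inverse ht) hi.inverse hpos hlo hup v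
    rwa [hi.inverse_inverse] at this
  · rw [loewner_iff (h.isSelfAdjoint ht) (isSelfAdjoint_smul_one _)]
    intro v
    rcases subsingleton_or_nontrivial (E k) with hs | hs
    · simp [Subsingleton.elim v 0]
    rw [inner_smul_one]
    have := inverse_upper_bound hi.inverse (hupos hs) hlow v
    rwa [hi.inverse_inverse] at this

end IsGain


/-! ### Gradient calculus in Euclidean space -/

theorem hasGradientAt_inner {n L : ℕ} {s : E n → E L} {A : E n →L[ℝ] E L} {y : E n}
    (h : HasFDerivAt s A y) (w : E L) : HasGradientAt (fun y' => ⟪w, s y'⟫) (adjoint A w) y := by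
  rw [hasGradientAt_iff_hasFDerivAt]
  refine ((innerSL ℝ w).hasFDerivAt.comp y h).congr_fderiv ?_
  ext v
  simp [ContinuousLinearMap.adjoint_inner_left]

theorem hasGradientAt_add {n : ℕ} {f g : E n → ℝ} {f' g' y : E n}
    (hf : HasGradientAt f f' y) (hg : HasGradientAt g g' y) :
    HasGradientAt (fun y' => f y' + g y') (f' + g') y := by
  rw [hasGradientAt_iff_hasFDerivAt] at *
  rw [map_add]
  exact hf.add hg

theorem hasGradientAt_sub {n : ℕ} {f g : E n → ℝ} {f' g' y : E n}
    (hf : HasGradientAt f f' y) (hg : HasGradientAt g g' y) :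
    HasGradientAt (fun y' => f y' - g y') (f' - g') y := by
  rw [hasGradientAt_iff_hasFDerivAt] at *
  rw [map_sub]
  exact hf.sub hg

theorem continuousOn_gradient {n : ℕ} {f : E n → ℝ} {U : Set (E n)} (hU : IsOpen U)
    (hf : ContDiffOn ℝ 1 f U) : ContinuousOn (gradient f) U :=
  (LinearIsometryEquiv.continuous _).comp_continuousOn
    (hf.continuousOn_fderiv_of_isOpen hU le_rfl)

namespace Setup

variable {n m L p N M : ℕ} {O : Type*} {S : Setup n m L p N M O}

/-! ## Regularity of the data -/

theorem isSelfAdjoint_GR (hS : S.Standing) (y : E n) : IsSelfAdjoint (S.GR y) := by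
  refine isSelfAdjoint_of_inner fun v w => ?_
  have hR := (isPosDef_inverse hS.R_posDef).1
  simp only [GR, ContinuousLinearMap.comp_apply]
  rw [← ContinuousLinearMap.adjoint_inner_right, isSelfAdjoint_inner hR,
    ContinuousLinearMap.adjoint_inner_left]

theorem continuous_z : Continuous S.z := by
  unfold z
  fun_prop

theorem continuous_F (hS : S.Standing) : Continuous S.F := by
  have hf := hS.f_lip.continuous.comp S.continuous_z
  have hg := hS.g_lip.continuous.comp S.continuous_z
  exact hf.add (hg.clm_apply continuous_const)

theorem continuous_G (hS : S.Standing) : Continuous S.G :=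
  hS.g_lip.continuous.comp S.continuous_z

theorem continuous_GR (hS : S.Standing) : Continuous S.GR := by
  have h := S.continuous_G hS
  exact h.clm_comp (continuous_const.clm_comp ((LinearIsometryEquiv.continuous _).comp h))

theorem B_nonneg (e : E n) : 0 ≤ S.B e := Finset.sum_nonneg fun _ _ => sq_nonneg _

theorem isOpen_safe (hS : S.Standing) : IsOpen S.safe := by
  have : S.safe = ⋂ o ∈ S.neg, {e | S.h o (S.z e) < 0} := by
    ext; simp [safe]
  rw [this]
  refine isOpen_biInter_finset fun o _ => ?_
  exact isOpen_lt ((hS.h_smooth o).continuous.comp S.continuous_z) continuous_const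

theorem contDiffOn_B (hS : S.Standing) : ContDiffOn ℝ 1 S.B S.safe := by
  unfold B
  refine ContDiffOn.sum fun o ho => ContDiffOn.pow ?_ 2
  have hz : ContDiff ℝ 1 S.z := by unfold z; fun_prop
  have h1 : ContDiffOn ℝ 1 (fun e => S.b o (S.z e)) S.safe := by
    unfold b
    exact contDiffOn_const.div ((hS.h_smooth o).comp hz).contDiffOn fun e he => (he o ho).ne
  exact (h1.sub contDiffOn_const).sub (ContinuousLinearMap.contDiff _).contDiffOn

theorem contDiffOn_Bbar (hS : S.Standing) : ContDiffOn ℝ 1 S.Bbar S.safe :=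
  (contDiffOn_B hS).div (contDiffOn_const.add (contDiffOn_B hS))
    fun e _ => by have := S.B_nonneg e; positivity

/-- The minimum in the HJB equation is attained at `-R⁻¹ Gᵀ ∇V / 2`. -/
theorem hjb_value (hS : S.Standing) {e : E n} (he : e ∈ S.χ ∩ S.safe) :
    S.Q e + S.B e = -⟪gradient S.V e, S.F e⟫
      + 1 / 4 * ⟪gradient S.V e, S.GR e (gradient S.V e)⟫ := by
  obtain ⟨⟨μ₀, hμ₀⟩, hmin⟩ := hS.V_hjb.2 e he
  set q := gradient S.V e
  have hR := hS.R_posDef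
  have hRi := isPosDef_isInvertible hR
  set w := S.R.inverse (adjoint (S.G e) q) with hw
  have hRw : S.R w = adjoint (S.G e) q := hRi.self_apply_inverse _
  have hGR : ⟪q, S.GR e q⟫ = ⟪w, S.R w⟫ := by
    simp only [GR, ContinuousLinearMap.comp_apply]
    rw [← ContinuousLinearMap.adjoint_inner_left, ← hw, hRw, real_inner_comm]
  -- Completing the square in `μ`.
  have hHam : ∀ μ, S.Ham e q μ = ⟪q, S.F e⟫ + S.Q e + S.B e - 1 / 4 * ⟪w, S.R w⟫
      + ⟪μ + (1 / 2 : ℝ) • w, S.R (μ + (1 / 2 : ℝ) • w)⟫ := by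
    intro μ
    have h1 : ⟪q, S.G e μ⟫ = ⟪w, S.R μ⟫ := by
      rw [← ContinuousLinearMap.adjoint_inner_left, ← hRw, isSelfAdjoint_inner hR.1]
    have h2 : ⟪μ, S.R w⟫ = ⟪w, S.R μ⟫ := by
      rw [← isSelfAdjoint_inner hR.1, real_inner_comm]
    simp only [Ham, r, inner_add_right, inner_add_left, map_add, map_smul, inner_smul_left,
      inner_smul_right, h1, h2, RCLike.conj_to_real]
    ring
  -- The square vanishes at `-w/2`, so the remaining constant is nonnegative; at the minimizer `μ₀`
  -- the square is nonnegative and the total is zero, so the constant is also nonpositive.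
  have h1 : 0 ≤ S.Ham e q (-((1 / 2 : ℝ) • w)) := hmin ⟨_, rfl⟩
  have h2 : S.Ham e q μ₀ = 0 := hμ₀
  rw [hHam] at h1 h2
  have h3 : 0 ≤ ⟪μ₀ + (1 / 2 : ℝ) • w, S.R (μ₀ + (1 / 2 : ℝ) • w)⟫ := by
    rcases eq_or_ne (μ₀ + (1 / 2 : ℝ) • w) 0 with h | h
    · rw [h]; simp
    · exact (hR.2 _ h).le
  simp only [neg_add_cancel, map_zero, inner_zero_left] at h1
  rw [hGR]
  linarith

theorem continuousOn_hjb (hS : S.Standing) :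
    ContinuousOn (fun e => -⟪gradient S.V e, S.F e⟫
      + 1 / 4 * ⟪gradient S.V e, S.GR e (gradient S.V e)⟫) S.Ω := by
  have hV := continuousOn_gradient hS.Ω_open hS.V_smooth
  exact (hV.inner (continuous_F hS).continuousOn).neg.add
    (continuousOn_const.mul (hV.inner ((continuous_GR hS).continuousOn.clm_apply hV)))

theorem Q_nonneg (hS : S.Standing) (e : E n) : 0 ≤ S.Q e := by
  rcases eq_or_ne e 0 with rfl | h
  · rw [hS.Q_zero]
  · exact (hS.Q_pos e h).le

/-- The HJB equation keeps `χ ∩ safe` away from the boundary of the safe set. -/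
theorem exists_margin (hS : S.Standing) {o : O} (ho : o ∈ S.neg) :
    ∃ δ > 0, ∀ e ∈ S.χ ∩ S.safe, S.h o (S.z e) ≤ -δ := by
  obtain ⟨C, hC⟩ := hS.χ_compact.exists_bound_of_continuousOn
    ((continuousOn_hjb hS).mono hS.χ_sub)
  obtain ⟨D, hD⟩ := hS.χ_compact.exists_bound_of_continuousOn
    ((fderiv ℝ (S.b o) S.xd).continuous.continuousOn)
  -- An upper bound for `b_o` on `χ ∩ safe`. There `B` is at most `|C|` by the HJB equation, so
  -- `b_o` exceeds its linearization at `x_d` by at most `|C| + 1`, and `D` bounds the linear term.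
  -- As `b_o = 1 / (-h_o)`, the margin is `1 / K`.
  set K := max 1 (|C| + 1 + |S.b o S.xd| + D) with hK
  have hK0 : 0 < K := lt_max_of_lt_left one_pos
  refine ⟨1 / K, by positivity, fun e he => ?_⟩
  have h1 := hjb_value hS he
  have h2 := (hC e he.1)
  rw [← h1, Real.norm_eq_abs] at h2
  have h3 : (S.b o (S.z e) - S.b o S.xd - fderiv ℝ (S.b o) S.xd e) ^ 2 ≤ S.B e :=
    Finset.single_le_sum (f := fun o => (S.b o (S.z e) - S.b o S.xd
      - fderiv ℝ (S.b o) S.xd e) ^ 2) (fun _ _ => sq_nonneg _) ho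
  have h4 := Q_nonneg hS e
  have h5 := hD e he.1
  have h6 := (abs_le.1 h2).2
  have h7 : S.b o (S.z e) - S.b o S.xd - fderiv ℝ (S.b o) S.xd e ≤ |C| + 1 := by
    have := le_abs_self C
    have := abs_nonneg C
    nlinarith
  have h8 : S.b o (S.z e) ≤ K := by
    refine le_trans ?_ (le_max_right _ _)
    have := le_abs_self (S.b o S.xd)
    have := (abs_le.1 h5).2
    linarith
  have h9 := he.2 o ho
  have h10 : S.b o (S.z e) = 1 / (-S.h o (S.z e)) := by
    unfold b; rw [neg_div, div_neg]
  rw [h10, div_le_iff₀ (by linarith)] at h8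
  have : 1 / K ≤ -S.h o (S.z e) := by
    rw [div_le_iff₀ hK0]; linarith
  linarith

/-- A clopen argument: the safe set is open, and the margin makes its complement in `C` relatively
open too, since a point of `C` with some `h_o > -δ_o` cannot be safe. -/
theorem subset_safe_of_isPreconnected (hS : S.Standing) {C : Set (E n)} (hC : IsPreconnected C)
    (hCχ : C ⊆ S.χ) {e₀ : E n} (h₀ : e₀ ∈ C) (h₀s : e₀ ∈ S.safe) : C ⊆ S.safe := by
  have hm : ∀ o : O, ∃ δ > 0, o ∈ S.neg → ∀ e ∈ S.χ ∩ S.safe, S.h o (S.z e) ≤ -δ := by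
    intro o
    by_cases ho : o ∈ S.neg
    · obtain ⟨δ, h1, h2⟩ := exists_margin hS ho
      exact ⟨δ, h1, fun _ => h2⟩
    · exact ⟨1, one_pos, fun h => absurd h ho⟩
  choose δ hδ hmar using hm
  -- Together with the safe set, `v` covers the whole space; by the margin the two sets are disjoint
  -- inside `χ`.
  set v : Set (E n) := ⋃ o ∈ S.neg, {e | -δ o < S.h o (S.z e)} with hv
  have hvo : IsOpen v := isOpen_biUnion fun o _ =>
    isOpen_lt continuous_const ((hS.h_smooth o).continuous.comp S.continuous_z)
  have huv : S.safe ∪ v = univ := by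
    ext e
    simp only [mem_union, mem_univ, iff_true]
    by_contra hcon
    push Not at hcon
    refine hcon.1 fun o ho => ?_
    have h2 := hcon.2
    simp only [hv, mem_iUnion, mem_ofPred_eq, not_exists, not_lt] at h2
    linarith [h2 o ho, hδ o]
  intro e he
  by_contra hes
  have hev : e ∈ v := by
    have : e ∈ S.safe ∪ v := huv ▸ mem_univ e
    exact this.resolve_left hes
  obtain ⟨y, hyC, hys, hyv⟩ := hC S.safe v (isOpen_safe hS) hvo (huv ▸ subset_univ C)
    ⟨e₀, h₀, h₀s⟩ ⟨e, he, hev⟩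
  simp only [hv, mem_iUnion, mem_ofPred_eq] at hyv
  obtain ⟨o, ho, hlt⟩ := hyv
  linarith [hmar o ho y ⟨hCχ hyC, hys⟩]

theorem mem_χ (hS : S.Standing) {e : E n} (he : ‖e‖ ≤ S.ζ) : e ∈ S.χ :=
  hS.ball_sub e he (Metric.mem_closedBall_self hS.a_pos.le)

theorem mem_Ω (hS : S.Standing) {e : E n} (he : ‖e‖ ≤ S.ζ) : e ∈ S.Ω := hS.χ_sub (mem_χ hS he)

/-- The ball is connected and contains `0`, where `h_o(x_d) < 0`. This is all of the safety claim
except for the invariance of the ball. -/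
theorem mem_safe (hS : S.Standing) {e : E n} (he : ‖e‖ ≤ S.ζ) : e ∈ S.safe := by
  refine subset_safe_of_isPreconnected hS (C := Metric.closedBall 0 S.ζ)
    (convex_closedBall _ _).isPreconnected
    (fun y hy => mem_χ hS (by simpa using hy)) (e₀ := 0) (by simpa using hS.ζ_pos.le)
    (fun o ho => by simpa [z] using hS.xd_safe o ho) (by simpa using he)

theorem smp_mem_χ_safe (hS : S.Standing) {e y : E n} (he : ‖e‖ ≤ S.ζ)
    (hy : y ∈ Metric.closedBall e S.a) : y ∈ S.χ ∩ S.safe :=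
  ⟨hS.ball_sub e he hy, subset_safe_of_isPreconnected hS (convex_closedBall _ _).isPreconnected
    (hS.ball_sub e he) (Metric.mem_closedBall_self hS.a_pos.le) (mem_safe hS he) hy⟩

/-! ### The kernels -/

theorem isOpen_center_domain (hS : S.Standing) :
    IsOpen (S.Ω ×ˢ univ.pi fun _ : Fin L => S.Ω) :=
  hS.Ω_open.prod (isOpen_set_pi finite_univ fun _ _ => hS.Ω_open)

theorem center_mem (hS : S.Standing) {e y : E n} (he : e ∈ S.χ) (hy : y ∈ S.Ω) :
    (y, S.c e) ∈ S.Ω ×ˢ univ.pi fun _ : Fin L => S.Ω :=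
  ⟨hy, fun l _ => hS.χ_sub (hS.c_mem e he l)⟩

theorem hasFDerivAt_σ_comp (hS : S.Standing) {e y : E n} (he : e ∈ S.χ) (hy : y ∈ S.Ω) :
    HasFDerivAt (fun y' => S.σ y' (S.c e))
      (fderiv ℝ (fun q : E n × (Fin L → E n) => S.σ q.1 q.2) (y, S.c e) ∘L
        ContinuousLinearMap.inl ℝ (E n) (Fin L → E n)) y := by
  have h1 := ((hS.σ_smooth.contDiffAt ((isOpen_center_domain hS).mem_nhds
    (center_mem hS he hy))).differentiableAt one_ne_zero).hasFDerivAt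
  exact h1.comp y (f := fun y' : E n => (y', S.c e)) (hasFDerivAt_prodMk_left y (S.c e))

theorem hasFDerivAt_σ (hS : S.Standing) {e y : E n} (he : e ∈ S.χ) (hy : y ∈ S.Ω) :
    HasFDerivAt (fun y' => S.σ y' (S.c e)) (S.dσ e y) y :=
  (hasFDerivAt_σ_comp hS he hy).differentiableAt.hasFDerivAt

/-- The centers `c(e)` are merely continuous, so the `y`-derivative is obtained as a partial
derivative of the jointly `C¹` kernels, evaluated along `(y, c(e))`. -/
theorem continuousOn_dσ (hS : S.Standing) :
    ContinuousOn (fun q : E n × E n => S.dσ q.1 q.2) (S.χ ×ˢ S.Ω) := by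
  have h1 := hS.σ_smooth.continuousOn_fderiv_of_isOpen (isOpen_center_domain hS) le_rfl
  have h2 : ContinuousOn (fun q : E n × E n => (q.2, S.c q.1)) (S.χ ×ˢ S.Ω) :=
    continuousOn_snd.prodMk (hS.c_cont.comp continuousOn_fst fun q hq => hq.1)
  have h3 := (h1.comp h2 fun q hq => center_mem hS hq.1 hq.2).clm_comp
    (continuousOn_const (c := ContinuousLinearMap.inl ℝ (E n) (Fin L → E n)))
  refine h3.congr fun q hq => ?_
  exact (hasFDerivAt_σ_comp hS hq.1 hq.2).fderiv

theorem hasGradientAt_Bbar (hS : S.Standing) {y : E n} (hy : y ∈ S.safe) :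
    HasGradientAt S.Bbar (gradient S.Bbar y) y :=
  (((contDiffOn_Bbar hS).contDiffAt ((isOpen_safe hS).mem_nhds hy)).differentiableAt
    one_ne_zero).hasGradientAt

theorem hasGradientAt_V (hS : S.Standing) {y : E n} (hy : y ∈ S.Ω) :
    HasGradientAt S.V (gradient S.V y) y :=
  ((hS.V_smooth.contDiffAt (hS.Ω_open.mem_nhds hy)).differentiableAt one_ne_zero).hasGradientAt

theorem hasFDerivAt_W (hS : S.Standing) {y : E n} (hy : y ∈ S.Ω) :
    HasFDerivAt S.W (S.dW y) y :=
  ((hS.W_smooth.contDiffAt (hS.Ω_open.mem_nhds hy)).differentiableAt one_ne_zero).hasFDerivAt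

theorem gradient_Vhat (hS : S.Standing) {e y : E n} (he : e ∈ S.χ) (hy : y ∈ S.χ ∩ S.safe)
    (w : E L) : gradient (fun y' => S.Vhat y' e w) y
      = adjoint (S.dσ e y) w + gradient S.Bbar y :=
  (hasGradientAt_add (hasGradientAt_inner (hasFDerivAt_σ hS he (hS.χ_sub hy.1)) w)
    (hasGradientAt_Bbar hS hy.2)).gradient

theorem gradient_eps (hS : S.Standing) {e y : E n} (he : e ∈ S.χ) (hy : y ∈ S.χ ∩ S.safe) :
    gradient (fun y' => S.eps e y') y
      = gradient S.V y - adjoint (S.dσ e y) (S.W e) - gradient S.Bbar y :=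
  (hasGradientAt_sub (hasGradientAt_sub (hasGradientAt_V hS (hS.χ_sub hy.1))
    (hasGradientAt_inner (hasFDerivAt_σ hS he (hS.χ_sub hy.1)) (S.W e)))
    (hasGradientAt_Bbar hS hy.2)).gradient

end Setup


namespace Setup

variable {n m L p N M : ℕ} {O : Type*} {S : Setup n m L p N M O}

/-! ## Feedback, Bellman error and regressor in terms of the weight errors -/

theorem G_muhat (y e : E n) (w : E L) : S.G y (S.muhat y e w)
    = -((1 / 2 : ℝ) • S.GR y (adjoint (S.dσ e y) w + gradient S.Bbar y)) := by
  simp only [muhat, GR, map_neg, map_smul, ContinuousLinearMap.comp_apply]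

theorem inner_muhat (hS : S.Standing) (y e : E n) (w : E L) :
    ⟪S.muhat y e w, S.R (S.muhat y e w)⟫
      = 1 / 4 * ⟪adjoint (S.dσ e y) w + gradient S.Bbar y,
          S.GR y (adjoint (S.dσ e y) w + gradient S.Bbar y)⟫ := by
  set v := adjoint (S.dσ e y) w + gradient S.Bbar y with hv
  have hRi := isPosDef_isInvertible hS.R_posDef
  simp only [muhat, GR, map_neg, map_smul, ← hv, hRi.self_apply_inverse, inner_neg_left,
    inner_neg_right, inner_smul_left, inner_smul_right, ContinuousLinearMap.comp_apply,
    RCLike.conj_to_real]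
  rw [ContinuousLinearMap.adjoint_inner_right, real_inner_comm]
  ring

theorem Fhat_sub (y : E n) (ϑ ϑ' : WMat p n) :
    S.Fhat y (ϑ - ϑ') = S.Fhat y ϑ - S.Fhat y ϑ' := by
  simp only [Fhat, tmul_sub, map_sub]
  abel

theorem norm_Fhat_le (y : E n) (ϑ : WMat p n) :
    ‖S.Fhat y ϑ‖ ≤ (‖S.Y (S.z y)‖ + ‖S.g (S.z y) ∘L S.gd‖ * ‖S.Y S.xd‖) * ‖ϑ‖ := by
  have h1 := norm_tmul_le ϑ (S.Y (S.z y))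
  have h2 := (S.g (S.z y) ∘L S.gd).le_opNorm (tmul ϑ (S.Y S.xd))
  have h3 := mul_le_mul_of_nonneg_left (norm_tmul_le ϑ (S.Y S.xd))
    (norm_nonneg (S.g (S.z y) ∘L S.gd))
  have h4 := norm_sub_le (tmul ϑ (S.Y (S.z y))) ((S.g (S.z y) ∘L S.gd) (tmul ϑ (S.Y S.xd)))
  have h5 : S.Fhat y ϑ
      = tmul ϑ (S.Y (S.z y)) - (S.g (S.z y) ∘L S.gd) (tmul ϑ (S.Y S.xd)) := rfl
  rw [h5]
  linarith

/-- With `q = Δ_F` and `s = ∇σᵀ W̃_a`, the control-dependent part of the ideal Hamiltonian is `¼⟪q -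
s, G_R (q - s)⟫ - ½⟪q, G_R (q - s)⟫`. Its terms linear in `s` cancel, because `s = 0` is the
minimizing policy. The critic error enters through `ω` as it actually is, not through its ideal
value. -/
theorem bellman_eq (hS : S.Standing) {e y : E n} (he : e ∈ S.χ) (hy : y ∈ S.χ ∩ S.safe)
    (wc wa : E L) (ϑ : WMat p n) :
    S.bellman y e wc wa ϑ = S.Δ e y - ⟪S.omega y e wa ϑ, S.W e - wc⟫
      + 1 / 4 * ⟪S.Gσ e y (S.W e - wa), S.W e - wa⟫ - ⟪S.ΔF e y, S.Fhat y (S.θ - ϑ)⟫ := by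
  have hsym := isSelfAdjoint_GR hS y
  set q := S.ΔF e y with hq
  set s := adjoint (S.dσ e y) (S.W e - wa) with hs
  have hq' : adjoint (S.dσ e y) (S.W e) + gradient S.Bbar y = q := rfl
  have hqs : adjoint (S.dσ e y) wa + gradient S.Bbar y = q - s := by
    rw [hs, map_sub, ← hq']; abel
  have hc : adjoint (S.dσ e y) wc + gradient S.Bbar y = q - adjoint (S.dσ e y) (S.W e - wc) := by
    rw [map_sub, ← hq']; abel
  have hU : ⟪S.Gσ e y (S.W e - wa), S.W e - wa⟫ = ⟪s, S.GR y s⟫ := by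
    simp only [Gσ, ContinuousLinearMap.comp_apply]
    rw [← ContinuousLinearMap.adjoint_inner_right, real_inner_comm]
  have hom : ⟪S.omega y e wa ϑ, S.W e - wc⟫ = ⟪adjoint (S.dσ e y) (S.W e - wc),
      S.Fhat y ϑ + S.G y (S.muhat y e wa)⟫ := by
    rw [omega, ← ContinuousLinearMap.adjoint_inner_right, real_inner_comm]
  have hqsym : ⟪s, S.GR y q⟫ = ⟪q, S.GR y s⟫ := by
    rw [← isSelfAdjoint_inner hsym, real_inner_comm]
  rw [hU, hom, Δ, bellman, bellman, gradient_Vhat hS he hy, gradient_Vhat hS he hy, r, r,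
    inner_muhat hS, inner_muhat hS, hqs, hc, hq', G_muhat, G_muhat, hqs, hq', Fhat_sub]
  simp only [inner_add_right, inner_sub_left, inner_sub_right, inner_neg_right, inner_smul_right,
    map_sub, hqsym]
  ring

theorem rho_pos (hS : S.Standing) (w : E L) : 0 < S.rho w := by
  have := hS.γ1_pos
  unfold rho
  positivity

/-- The sharp maximum, attained where `√γ₁ ‖w‖ = 1/√3`; it is the source of the constant `κ`. -/
theorem norm_div_rho_sq_le (hS : S.Standing) (w : E L) :
    ‖w‖ / S.rho w ^ 2 ≤ 3 * √3 / (16 * √S.γ1) := by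
  have hγ := hS.γ1_pos
  have hg : 0 < √S.γ1 := Real.sqrt_pos.2 hγ
  have hg2 : √S.γ1 ^ 2 = S.γ1 := Real.sq_sqrt hγ.le
  have h3 : 0 < √(3 : ℝ) := Real.sqrt_pos.2 (by norm_num)
  have h32 : √(3 : ℝ) ^ 2 = 3 := Real.sq_sqrt (by norm_num)
  rw [div_le_div_iff₀ (pow_pos (rho_pos hS w) 2) (by positivity)]
  unfold rho
  set g := √S.γ1
  set c := √(3 : ℝ)
  set x := g * ‖w‖ with hx
  have hx0 : 0 ≤ x := by positivity
  have e1 : 1 + S.γ1 * ‖w‖ ^ 2 = 1 + x ^ 2 := by rw [hx, mul_pow, hg2]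
  have e2 : ‖w‖ * (16 * g) = 16 * x := by rw [hx]; ring
  rw [e1, e2]
  -- The difference has a double root at the maximizer `x = 1 / c`, with `c = √3`, and its other
  -- factor is positive for `x ≥ 0`.
  have key : 3 * c * (1 + x ^ 2) ^ 2 - 16 * x
      = c / 3 * (c * x - 1) ^ 2 * ((c * x) ^ 2 + 2 * (c * x) + 9) := by
    have hc3 : c ^ 3 = 3 * c := by rw [pow_succ, h32]
    have hc4 : c ^ 4 = 9 := by
      rw [show c ^ 4 = (c ^ 2) ^ 2 by ring, h32]; norm_num
    have hc5 : c ^ 5 = 9 * c := by rw [pow_succ, hc4]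
    ring_nf
    rw [hc5, hc3, h32]
    ring
  have hcx : 0 ≤ c * x := by positivity
  have : 0 ≤ c / 3 * (c * x - 1) ^ 2 * ((c * x) ^ 2 + 2 * (c * x) + 9) := by positivity
  linarith

theorem inner_Lam (w v : E L) : ⟪v, S.Lam w v⟫ = ⟪w, v⟫ ^ 2 / S.rho w ^ 2 := by
  rw [Lam, smul_apply, inner_smul_right, inner_selfOuter]
  ring

theorem isSelfAdjoint_Lam (w : E L) : IsSelfAdjoint (S.Lam w) :=
  isSelfAdjoint_of_inner fun a b => by
    simp only [Lam, smul_apply, inner_smul_left, inner_smul_right,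
      isSelfAdjoint_inner (isSelfAdjoint_selfOuter w), RCLike.conj_to_real]

theorem norm_sq_div_rho_sq_le (hS : S.Standing) (w : E L) :
    ‖w‖ ^ 2 / S.rho w ^ 2 ≤ 1 / (4 * S.γ1) := by
  have hγ := hS.γ1_pos
  rw [div_le_div_iff₀ (pow_pos (rho_pos hS w) 2) (by positivity)]
  unfold rho
  nlinarith [sq_nonneg (1 - S.γ1 * ‖w‖ ^ 2)]

theorem norm_Lam_le (hS : S.Standing) (w : E L) : ‖S.Lam w‖ ≤ 1 / (4 * S.γ1) := by
  refine le_trans ?_ (norm_sq_div_rho_sq_le hS w)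
  rw [Lam, norm_smul, Real.norm_of_nonneg (by positivity), one_div, inv_mul_eq_div]
  gcongr
  exact norm_selfOuter_le w

theorem inner_Lam_nonneg (w v : E L) : 0 ≤ ⟪v, S.Lam w v⟫ := by
  rw [inner_Lam]; positivity

theorem inner_Lam_le (hS : S.Standing) (w v : E L) :
    ⟪v, S.Lam w v⟫ ≤ 1 / (4 * S.γ1) * ‖v‖ ^ 2 := by
  refine (real_inner_le_norm _ _).trans ?_
  have h1 := ((S.Lam w).le_opNorm v).trans
    (mul_le_mul_of_nonneg_right (norm_Lam_le hS w) (norm_nonneg v))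
  have := mul_le_mul_of_nonneg_left h1 (norm_nonneg v)
  linarith

/-! ## Suprema over the analysis set -/

/-- Pairs of an error of norm at most `ζ` and a point of the ball of radius `a` about it. -/
def smpSet (S : Setup n m L p N M O) : Set (E n × E n) :=
  {q | ‖q.1‖ ≤ S.ζ ∧ q.2 ∈ Metric.closedBall q.1 S.a}

theorem isCompact_smpSet : IsCompact S.smpSet := by
  refine Metric.isCompact_of_isClosed_isBounded ?_ ?_
  · exact (isClosed_le continuous_fst.norm continuous_const).inter
      (isClosed_le (continuous_snd.dist continuous_fst) continuous_const)
  · refine (Metric.isBounded_closedBall (x := (0 : E n)) (r := S.ζ)).prod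
      (Metric.isBounded_closedBall (x := (0 : E n)) (r := S.ζ + S.a)) |>.subset ?_
    rintro ⟨e, y⟩ ⟨he, hy⟩
    refine ⟨by simpa using he, ?_⟩
    simp only [Metric.mem_closedBall, dist_zero_right] at hy ⊢
    have := norm_le_norm_add_norm_sub e y
    rw [dist_eq_norm, norm_sub_rev] at hy
    have he' : ‖e‖ ≤ S.ζ := he
    linarith

/-- Continuity on a compact set guarantees boundedness, so that the `sSup` really is an upper bound.
-/
theorem le_supSmp {φ : E n → E n → ℝ} (h : ContinuousOn (fun q : E n × E n => φ q.1 q.2) S.smpSet)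
    {e y : E n} (he : ‖e‖ ≤ S.ζ) (hy : y ∈ Metric.closedBall e S.a) : φ e y ≤ S.supSmp φ :=
  le_csSup (isCompact_smpSet.bddAbove_image h) ⟨(e, y), ⟨he, hy⟩, rfl⟩

theorem le_supBall {φ : E n → ℝ} (h : ContinuousOn φ (Metric.closedBall 0 S.ζ))
    {e : E n} (he : ‖e‖ ≤ S.ζ) : φ e ≤ S.supBall φ :=
  le_csSup ((isCompact_closedBall _ _).bddAbove_image h) ⟨e, by simpa using he, rfl⟩

theorem supSmp_nonneg {φ : E n → E n → ℝ} (h : ∀ e y, 0 ≤ φ e y) : 0 ≤ S.supSmp φ :=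
  Real.sSup_nonneg (by rintro _ ⟨q, _, rfl⟩; exact h _ _)

theorem supBall_nonneg {φ : E n → ℝ} (h : ∀ e, 0 ≤ φ e) : 0 ≤ S.supBall φ :=
  Real.sSup_nonneg (by rintro _ ⟨q, _, rfl⟩; exact h _)

theorem smpSet_maps (hS : S.Standing) {q : E n × E n} (hq : q ∈ S.smpSet) :
    q.1 ∈ S.χ ∧ q.2 ∈ S.χ ∩ S.safe :=
  ⟨mem_χ hS hq.1, smp_mem_χ_safe hS hq.1 hq.2⟩

theorem continuousOn_smp_dσ (hS : S.Standing) :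
    ContinuousOn (fun q : E n × E n => S.dσ q.1 q.2) S.smpSet :=
  (continuousOn_dσ hS).mono fun _ hq =>
    ⟨(smpSet_maps hS hq).1, hS.χ_sub (smpSet_maps hS hq).2.1⟩

theorem continuousOn_smp_W (hS : S.Standing) :
    ContinuousOn (fun q : E n × E n => S.W q.1) S.smpSet :=
  hS.W_smooth.continuousOn.comp continuousOn_fst fun _ hq => hS.χ_sub (smpSet_maps hS hq).1

theorem continuousOn_smp_adjoint_dσ (hS : S.Standing) :
    ContinuousOn (fun q : E n × E n => adjoint (S.dσ q.1 q.2)) S.smpSet :=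
  (LinearIsometryEquiv.continuous _).comp_continuousOn (continuousOn_smp_dσ hS)

theorem continuousOn_smp_GR (hS : S.Standing) :
    ContinuousOn (fun q : E n × E n => S.GR q.2) S.smpSet :=
  ((continuous_GR hS).comp continuous_snd).continuousOn

theorem continuousOn_smp_Gσ (hS : S.Standing) :
    ContinuousOn (fun q : E n × E n => S.Gσ q.1 q.2) S.smpSet :=
  (continuousOn_smp_dσ hS).clm_comp
    ((continuousOn_smp_GR hS).clm_comp (continuousOn_smp_adjoint_dσ hS))

theorem continuousOn_smp_gradient_Bbar (hS : S.Standing) :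
    ContinuousOn (fun q : E n × E n => gradient S.Bbar q.2) S.smpSet :=
  (continuousOn_gradient (isOpen_safe hS) (contDiffOn_Bbar hS)).comp continuousOn_snd
    fun _ hq => (smpSet_maps hS hq).2.2

/-- No continuity of `Q` is assumed. The HJB equation replaces `Q + B` by an expression in `∇V` and
the dynamics, which makes `Δ` continuous on the sampling set. -/
theorem Δ_eq (hS : S.Standing) {e y : E n} (he : e ∈ S.χ) (hy : y ∈ S.χ ∩ S.safe) :
    S.Δ e y = (-⟪gradient S.V y, S.F y⟫ + 1 / 4 * ⟪gradient S.V y, S.GR y (gradient S.V y)⟫)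
      + 1 / 4 * ⟪S.ΔF e y, S.GR y (S.ΔF e y)⟫
      + ⟪S.ΔF e y, S.Fhat y S.θ + -((1 / 2 : ℝ) • S.GR y (S.ΔF e y))⟫ := by
  rw [← hjb_value hS hy]
  simp only [Δ, bellman, gradient_Vhat hS he hy, r, inner_muhat hS, G_muhat, ΔF]
  ring

theorem continuousOn_smp_ΔF (hS : S.Standing) :
    ContinuousOn (fun q : E n × E n => S.ΔF q.1 q.2) S.smpSet :=
  ((continuousOn_smp_adjoint_dσ hS).clm_apply (continuousOn_smp_W hS)).add
    (continuousOn_smp_gradient_Bbar hS)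

theorem continuous_Yz (hS : S.Standing) : Continuous fun y => S.Y (S.z y) :=
  hS.Y_cont.comp S.continuous_z

theorem continuous_Fhat (hS : S.Standing) (ϑ : WMat p n) : Continuous fun y => S.Fhat y ϑ :=
  ((continuous_tmul_right ϑ).comp (continuous_Yz hS)).sub
    ((continuous_G hS).clm_apply continuous_const)

theorem continuousOn_smp_Δ (hS : S.Standing) :
    ContinuousOn (fun q : E n × E n => S.Δ q.1 q.2) S.smpSet := by
  have hF := continuousOn_smp_ΔF hS
  have h1 : ContinuousOn (fun q : E n × E n => -⟪gradient S.V q.2, S.F q.2⟫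
      + 1 / 4 * ⟪gradient S.V q.2, S.GR q.2 (gradient S.V q.2)⟫) S.smpSet :=
    (continuousOn_hjb hS).comp continuousOn_snd fun _ hq => hS.χ_sub (smpSet_maps hS hq).2.1
  have h2 := (continuousOn_smp_GR hS).clm_apply hF
  have h3 : ContinuousOn (fun q : E n × E n => S.Fhat q.2 S.θ) S.smpSet :=
    ((continuous_Fhat hS S.θ).comp continuous_snd).continuousOn
  have h4 := (h1.add (continuousOn_const (c := (1 / 4 : ℝ)) |>.mul (hF.inner h2))).add
    (hF.inner (h3.add (continuousOn_const (c := (1 / 2 : ℝ)) |>.smul h2).neg))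
  exact h4.congr fun q hq => Δ_eq hS (smpSet_maps hS hq).1 (smpSet_maps hS hq).2

theorem diag_mem_smpSet (hS : S.Standing) {e : E n} (he : e ∈ Metric.closedBall 0 S.ζ) :
    (e, e) ∈ S.smpSet :=
  ⟨by simpa using he, Metric.mem_closedBall_self hS.a_pos.le⟩

theorem continuousOn_ball_of_smp (hS : S.Standing) {H : Type*} [TopologicalSpace H]
    {φ : E n → E n → H} (h : ContinuousOn (fun q : E n × E n => φ q.1 q.2) S.smpSet) :
    ContinuousOn (fun e => φ e e) (Metric.closedBall 0 S.ζ) :=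
  h.comp (f := fun e : E n => (e, e)) (by fun_prop) fun _ he => diag_mem_smpSet hS he

end Setup


/-! ### Weighted Cauchy–Schwarz and the projection operator -/

/-- Cauchy–Schwarz for the form of `P`, obtained from positivity at `‖v‖ u - ‖u‖ v`. It controls the
drift of the ideal weights as seen through `Γ⁻¹`. -/
theorem inner_apply_le_of_form_le {k : ℕ} {P : E k →L[ℝ] E k} (hs : IsSelfAdjoint P)
    (hpos : ∀ v, 0 ≤ ⟪v, P v⟫) {D : ℝ} (h : ∀ v, ⟪v, P v⟫ ≤ D * ‖v‖ ^ 2) (u v : E k) :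
    ⟪u, P v⟫ ≤ D * ‖u‖ * ‖v‖ := by
  rcases eq_or_ne u 0 with rfl | hu
  · simp
  rcases eq_or_ne v 0 with rfl | hv
  · simp
  have hu' := norm_pos_iff.2 hu
  have hv' := norm_pos_iff.2 hv
  have h1 := hpos (‖v‖ • u - ‖u‖ • v)
  have h2 := mul_le_mul_of_nonneg_left (h u) (sq_nonneg ‖v‖)
  have h3 := mul_le_mul_of_nonneg_left (h v) (sq_nonneg ‖u‖)
  have h4 : ⟪v, P u⟫ = ⟪u, P v⟫ := by rw [← isSelfAdjoint_inner hs, real_inner_comm]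
  simp only [map_sub, map_smul, inner_sub_left, inner_sub_right, inner_smul_left,
    inner_smul_right, RCLike.conj_to_real, h4] at h1
  have h5 : (‖u‖ * ‖v‖) * ⟪u, P v⟫ ≤ (‖u‖ * ‖v‖) * (D * ‖u‖ * ‖v‖) := by nlinarith
  exact le_of_mul_le_mul_left h5 (by positivity)

/-- The projection only helps: it does not decrease the inner product with the estimation error. -/
theorem inner_lmul_le_inner_lmul_proj {p n : ℕ} {θbar ϱ : ℝ} {Γ P : E p →L[ℝ] E p}
    {θ ϑ τ : WMat p n} (hϱ : 0 < ϱ) (hθ : ‖θ‖ ≤ θbar) (hP : P ∘L Γ = .id ℝ (E p))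
    (hΓ : 0 ≤ ⟪ϑ, lmul Γ ϑ⟫) :
    ⟪θ - ϑ, lmul P τ⟫ ≤ ⟪θ - ϑ, lmul P (proj θbar ϱ Γ ϑ τ)⟫ := by
  unfold proj
  split_ifs with h
  · exact le_rfl
  push Not at h
  obtain ⟨h1, h2⟩ := h
  set s := min 1 ((‖ϑ‖ ^ 2 - θbar ^ 2) / ϱ) * (⟪ϑ, τ⟫ / ⟪ϑ, lmul Γ ϑ⟫) with hs
  have h0 : 0 ≤ θbar := (norm_nonneg θ).trans hθ
  have hs0 : 0 ≤ s := by
    refine mul_nonneg (le_min zero_le_one (div_nonneg ?_ hϱ.le)) (div_nonneg h2.le hΓ)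
    nlinarith
  rw [lmul_sub, lmul_smul, lmul_lmul, hP, lmul_id, inner_sub_right, inner_smul_right]
  -- After multiplication by `P = Γ⁻¹` the correction is a nonnegative multiple of `-ϑ`. It pairs
  -- nonnegatively with `θ - ϑ` because the true `θ` lies in the ball that `ϑ` has left.
  have h3 : ⟪θ - ϑ, ϑ⟫ ≤ 0 := by
    rw [inner_sub_left, real_inner_self_eq_norm_sq]
    have := real_inner_le_norm θ ϑ
    nlinarith [norm_nonneg ϑ]
  nlinarith [mul_nonpos_of_nonneg_of_nonpos hs0 h3]

namespace Setup

variable {n m L p N M : ℕ} {O : Type*} {S : Setup n m L p N M O}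

/-! ## Pointwise estimates of the terms of the Lyapunov derivative -/

/-- Bound of the cross terms that one sampled point contributes, as a function of the norms of the
weight errors. -/
noncomputable def sampleBound (S : Setup n m L p N M O) (c a d : ℝ) : ℝ :=
  c * S.supSmp (fun e y => |S.Δ e y|)
    + S.supSmp (fun e y => ‖S.ΔF e y‖) * (S.supSmp (fun _ y => ‖S.Y (S.z y)‖)
      + S.supSmp (fun _ y => ‖S.g (S.z y) ∘L S.gd‖) * ‖S.Y S.xd‖) * (c * d)
    + 1 / 4 * (S.supSmp (fun e y => ‖S.Gσ e y‖ * ‖S.W e‖ ^ 2) * a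
      + S.supSmp (fun e y => ‖S.Gσ e y‖ * ‖S.W e‖) * (a * c)
      + S.supSmp (fun e y => ‖S.Gσ e y‖) * S.supBall (fun e => ‖S.W e‖) * a ^ 2)

theorem continuousOn_ball_W (hS : S.Standing) :
    ContinuousOn S.W (Metric.closedBall 0 S.ζ) :=
  hS.W_smooth.continuousOn.mono fun e he => mem_Ω hS (by simpa using he)

/-- Collects everything one evaluation point contributes to the derivative of `V_L`: the critic law,
half of the `Λ` term from `(Γ⁻¹)'`, and the actor law. The critic law supplies `-Λ`, of which half
survives as damping. The cubic terms `⟪ω, W̃_c⟫ ⟪G_σ W̃_a, W̃_a⟫` of critic and actor cancel, and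
what is left carries the factor `‖ω‖ / ρ²`. -/
theorem sample_term_le (hS : S.Standing) {e y : E n} (he : ‖e‖ ≤ S.ζ)
    (hy : y ∈ Metric.closedBall e S.a) (wc wa : E L) (ϑ : WMat p n) {k : ℝ} (hk : 0 ≤ k) :
    k * S.bellman y e wc wa ϑ / S.rho (S.omega y e wa ϑ) ^ 2
          * ⟪S.W e - wc, S.omega y e wa ϑ⟫
        + k / 2 * ⟪S.W e - wc, S.Lam (S.omega y e wa ϑ) (S.W e - wc)⟫
        - k * ⟪S.omega y e wa ϑ, wc⟫ / (4 * S.rho (S.omega y e wa ϑ) ^ 2)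
          * ⟪S.W e - wa, adjoint (S.Gσ e y) wa⟫
      ≤ -(k / 2) * ⟪S.W e - wc, S.Lam (S.omega y e wa ϑ) (S.W e - wc)⟫
        + k * (3 * √3 / (16 * √S.γ1))
          * S.sampleBound ‖S.W e - wc‖ ‖S.W e - wa‖ ‖S.θ - ϑ‖ := by
  have hyχ := smp_mem_χ_safe hS he hy
  rw [bellman_eq hS (mem_χ hS he) hyχ, inner_Lam, ContinuousLinearMap.adjoint_inner_right]
  set ω := S.omega y e wa ϑ
  have hwc : ⟪ω, wc⟫ = ⟪ω, S.W e⟫ - ⟪ω, S.W e - wc⟫ := by rw [inner_sub_right]; ring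
  have hwa : ⟪S.Gσ e y (S.W e - wa), wa⟫ = ⟪S.Gσ e y (S.W e - wa), S.W e⟫
      - ⟪S.Gσ e y (S.W e - wa), S.W e - wa⟫ := by
    rw [inner_sub_right (S.Gσ e y (S.W e - wa)) (S.W e) wa]; ring
  rw [hwc, hwa, real_inner_comm ω (S.W e - wc)]
  have hρ := rho_pos hS ω
  set ρ := S.rho ω
  have hκ := norm_div_rho_sq_le hS ω
  set c := S.W e - wc
  set a := S.W e - wa
  set d := S.θ - ϑ
  have b1 : |S.Δ e y| ≤ _ := le_supSmp (φ := fun e y => |S.Δ e y|)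
    (continuousOn_smp_Δ hS).abs he hy
  have b2 : ‖S.ΔF e y‖ ≤ _ := le_supSmp (φ := fun e y => ‖S.ΔF e y‖)
    (continuousOn_smp_ΔF hS).norm he hy
  have b3 : ‖S.Y (S.z y)‖ ≤ _ := le_supSmp (φ := fun _ y => ‖S.Y (S.z y)‖)
    ((continuous_Yz hS).comp continuous_snd).continuousOn.norm he hy
  have b4 : ‖S.g (S.z y) ∘L S.gd‖ ≤ _ := le_supSmp (φ := fun _ y => ‖S.g (S.z y) ∘L S.gd‖)
    ((((continuous_G hS).comp continuous_snd).clm_comp continuous_const).norm.continuousOn) he hy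
  have b5 : ‖S.Gσ e y‖ * ‖S.W e‖ ^ 2 ≤ _ := le_supSmp (φ := fun e y => ‖S.Gσ e y‖ * ‖S.W e‖ ^ 2)
    ((continuousOn_smp_Gσ hS).norm.mul ((continuousOn_smp_W hS).norm.pow 2)) he hy
  have b6 : ‖S.Gσ e y‖ * ‖S.W e‖ ≤ _ := le_supSmp (φ := fun e y => ‖S.Gσ e y‖ * ‖S.W e‖)
    ((continuousOn_smp_Gσ hS).norm.mul (continuousOn_smp_W hS).norm) he hy
  have b7 : ‖S.Gσ e y‖ ≤ _ := le_supSmp (φ := fun e y => ‖S.Gσ e y‖)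
    (continuousOn_smp_Gσ hS).norm he hy
  have b8 : ‖S.W e‖ ≤ _ := le_supBall (φ := fun e => ‖S.W e‖) (continuousOn_ball_W hS).norm he
  have hX : |⟪ω, c⟫| ≤ ‖ω‖ * ‖c‖ := abs_real_inner_le_norm _ _
  have hWW : |⟪ω, S.W e⟫| ≤ ‖ω‖ * ‖S.W e‖ := abs_real_inner_le_norm _ _
  have hGa := (S.Gσ e y).le_opNorm a
  have hH : |⟪S.Gσ e y a, S.W e⟫| ≤ ‖S.Gσ e y‖ * ‖a‖ * ‖S.W e‖ :=
    (abs_real_inner_le_norm _ _).trans (mul_le_mul_of_nonneg_right hGa (norm_nonneg _))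
  have hU : |⟪S.Gσ e y a, a⟫| ≤ ‖S.Gσ e y‖ * ‖a‖ * ‖a‖ :=
    (abs_real_inner_le_norm _ _).trans (mul_le_mul_of_nonneg_right hGa (norm_nonneg _))
  have hT : |⟪S.ΔF e y, S.Fhat y d⟫| ≤ S.supSmp (fun e y => ‖S.ΔF e y‖)
      * ((S.supSmp (fun _ y => ‖S.Y (S.z y)‖)
        + S.supSmp (fun _ y => ‖S.g (S.z y) ∘L S.gd‖) * ‖S.Y S.xd‖) * ‖d‖) := by
    refine (abs_real_inner_le_norm _ _).trans (mul_le_mul b2 ?_ (norm_nonneg _)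
      ((norm_nonneg _).trans b2))
    refine (norm_Fhat_le y d).trans ?_
    gcongr
  have hsb : ‖ω‖ * ‖c‖ * |S.Δ e y| + ‖ω‖ * ‖c‖ * |⟪S.ΔF e y, S.Fhat y d⟫|
      + 1 / 4 * (‖ω‖ * ‖S.W e‖ * (‖S.Gσ e y‖ * ‖a‖ * ‖S.W e‖)
        + ‖ω‖ * ‖S.W e‖ * (‖S.Gσ e y‖ * ‖a‖ * ‖a‖)
        + ‖ω‖ * ‖c‖ * (‖S.Gσ e y‖ * ‖a‖ * ‖S.W e‖))
      ≤ ‖ω‖ * S.sampleBound ‖c‖ ‖a‖ ‖d‖ := by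
    have e1 := mul_le_mul_of_nonneg_left b1 (norm_nonneg c)
    have e2 := mul_le_mul_of_nonneg_left hT (norm_nonneg c)
    have e3 := mul_le_mul_of_nonneg_right b5 (norm_nonneg a)
    have e4 := mul_le_mul_of_nonneg_right b6 (mul_nonneg (norm_nonneg a) (norm_nonneg c))
    have e5 := mul_le_mul_of_nonneg_right (mul_le_mul b7 b8 (norm_nonneg _)
      ((norm_nonneg _).trans b7)) (sq_nonneg ‖a‖)
    have : ‖c‖ * |S.Δ e y| + ‖c‖ * |⟪S.ΔF e y, S.Fhat y d⟫|
      + 1 / 4 * (‖S.W e‖ * (‖S.Gσ e y‖ * ‖a‖ * ‖S.W e‖)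
        + ‖S.W e‖ * (‖S.Gσ e y‖ * ‖a‖ * ‖a‖)
        + ‖c‖ * (‖S.Gσ e y‖ * ‖a‖ * ‖S.W e‖)) ≤ S.sampleBound ‖c‖ ‖a‖ ‖d‖ := by
      unfold sampleBound
      linarith
    have h2 := mul_le_mul_of_nonneg_left this (norm_nonneg ω)
    linarith
  generalize ⟪ω, c⟫ = X at *
  generalize ⟪ω, S.W e⟫ = Wω at *
  generalize ⟪S.Gσ e y a, S.W e⟫ = H at *
  generalize ⟪S.Gσ e y a, a⟫ = U at *
  generalize ⟪S.ΔF e y, S.Fhat y d⟫ = T at *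
  generalize S.Δ e y = D at *
  have p1 : X * D ≤ ‖ω‖ * ‖c‖ * |D| := by
    refine (le_abs_self _).trans ?_
    rw [abs_mul]
    exact mul_le_mul_of_nonneg_right hX (abs_nonneg _)
  have p2 : -(X * T) ≤ ‖ω‖ * ‖c‖ * |T| := by
    refine (neg_le_abs _).trans ?_
    rw [abs_mul]
    exact mul_le_mul_of_nonneg_right hX (abs_nonneg _)
  have p3 : -(Wω * H) ≤ ‖ω‖ * ‖S.W e‖ * (‖S.Gσ e y‖ * ‖a‖ * ‖S.W e‖) := by
    refine (neg_le_abs _).trans ?_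
    rw [abs_mul]
    exact mul_le_mul hWW hH (abs_nonneg _) (by positivity)
  have p4 : Wω * U ≤ ‖ω‖ * ‖S.W e‖ * (‖S.Gσ e y‖ * ‖a‖ * ‖a‖) := by
    refine (le_abs_self _).trans ?_
    rw [abs_mul]
    exact mul_le_mul hWW hU (abs_nonneg _) (by positivity)
  have p5 : X * H ≤ ‖ω‖ * ‖c‖ * (‖S.Gσ e y‖ * ‖a‖ * ‖S.W e‖) := by
    refine (le_abs_self _).trans ?_
    rw [abs_mul]
    exact mul_le_mul hX hH (abs_nonneg _) (by positivity)
  have hsb0 : 0 ≤ S.sampleBound ‖c‖ ‖a‖ ‖d‖ := by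
    unfold sampleBound
    have := S.supSmp_nonneg (φ := fun e y => |S.Δ e y|) fun _ _ => abs_nonneg _
    have := S.supSmp_nonneg (φ := fun e y => ‖S.ΔF e y‖) fun _ _ => norm_nonneg _
    have := (norm_nonneg _).trans b3
    have := (norm_nonneg _).trans b4
    have := (norm_nonneg _).trans b7
    have := (norm_nonneg _).trans b8
    have := (mul_nonneg (norm_nonneg _) (norm_nonneg _)).trans b6
    have := (mul_nonneg (norm_nonneg _) (sq_nonneg _)).trans b5
    positivity
  have key : X * D - X * T - 1 / 4 * (Wω * H) + 1 / 4 * (Wω * U) + 1 / 4 * (X * H)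
      ≤ ‖ω‖ * S.sampleBound ‖c‖ ‖a‖ ‖d‖ := by linarith
  -- The cancellation: no product `X * U` appears on the right-hand side.
  have e0 : k * (D - X + 1 / 4 * U - T) / ρ ^ 2 * X + k / 2 * (X ^ 2 / ρ ^ 2)
      - k * (Wω - X) / (4 * ρ ^ 2) * (H - U)
      = -(k / 2) * (X ^ 2 / ρ ^ 2) + k * ((X * D - X * T - 1 / 4 * (Wω * H) + 1 / 4 * (Wω * U)
        + 1 / 4 * (X * H)) / ρ ^ 2) := by
    field_simp
    ring
  rw [e0]
  have e1 : (X * D - X * T - 1 / 4 * (Wω * H) + 1 / 4 * (Wω * U) + 1 / 4 * (X * H)) / ρ ^ 2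
      ≤ (3 * √3 / (16 * √S.γ1)) * S.sampleBound ‖c‖ ‖a‖ ‖d‖ := by
    refine (div_le_div_of_nonneg_right key (by positivity)).trans ?_
    rw [mul_div_right_comm]
    exact mul_le_mul_of_nonneg_right hκ hsb0
  have e2 := mul_le_mul_of_nonneg_left e1 hk
  linarith

theorem inner_GR_nonneg (hS : S.Standing) (y q : E n) : 0 ≤ ⟪q, S.GR y q⟫ := by
  simp only [GR, ContinuousLinearMap.comp_apply]
  rw [← ContinuousLinearMap.adjoint_inner_left]
  rcases eq_or_ne (adjoint (S.G y) q) 0 with h | h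
  · rw [h]; simp
  · exact ((isPosDef_inverse hS.R_posDef).2 _ h).le

theorem continuousOn_ball_GRσ (hS : S.Standing) :
    ContinuousOn S.GRσ (Metric.closedBall 0 S.ζ) :=
  continuousOn_ball_of_smp hS (φ := fun e y => S.GR y ∘L adjoint (S.dσ e y))
    ((continuousOn_smp_GR hS).clm_comp (continuousOn_smp_adjoint_dσ hS))

theorem continuousOn_ball_gradient_V (hS : S.Standing) :
    ContinuousOn (gradient S.V) (Metric.closedBall 0 S.ζ) :=
  (continuousOn_gradient hS.Ω_open hS.V_smooth).mono fun e he => mem_Ω hS (by simpa using he)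

theorem continuousOn_ball_dW (hS : S.Standing) :
    ContinuousOn S.dW (Metric.closedBall 0 S.ζ) :=
  (hS.W_smooth.continuousOn_fderiv_of_isOpen hS.Ω_open le_rfl).mono
    fun e he => mem_Ω hS (by simpa using he)

theorem continuousOn_ball_gradient_Bbar (hS : S.Standing) :
    ContinuousOn (gradient S.Bbar) (Metric.closedBall 0 S.ζ) :=
  continuousOn_ball_of_smp hS (φ := fun _ y => gradient S.Bbar y)
    (continuousOn_smp_gradient_Bbar hS)

theorem continuousOn_ball_gradient_eps (hS : S.Standing) :
    ContinuousOn (fun e => gradient (fun y => S.eps e y) e) (Metric.closedBall 0 S.ζ) := by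
  refine (((continuousOn_ball_gradient_V hS).sub
    ((continuousOn_ball_of_smp hS (φ := fun e y => adjoint (S.dσ e y))
      (continuousOn_smp_adjoint_dσ hS)).clm_apply
      (continuousOn_ball_W hS))).sub (continuousOn_ball_gradient_Bbar hS)).congr fun e he => ?_
  have he' : ‖e‖ ≤ S.ζ := by simpa using he
  exact gradient_eps hS (mem_χ hS he') ⟨mem_χ hS he', mem_safe hS he'⟩

/-- Decrease of the value function along the closed loop. -/
theorem value_term_le (hS : S.Standing) {e : E n} (he : ‖e‖ ≤ S.ζ) (wa : E L) :
    ⟪gradient S.V e, S.F e + S.G e (S.muhat e e wa)⟫ ≤ -(S.Q e + S.B e)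
      + S.supBall (fun e => ‖gradient S.V e‖) * S.supBall (fun e => ‖S.GRσ e‖) / 2
        * ‖S.W e - wa‖
      + S.supBall (fun e =>
        ‖gradient S.V e‖ * ‖S.GR e‖ * ‖gradient (fun y => S.eps e y) e‖) := by
  have heχ := mem_χ hS he
  have hsafe := mem_safe hS he
  have b1 : ‖gradient S.V e‖ ≤ _ := le_supBall (φ := fun e => ‖gradient S.V e‖)
    (continuousOn_ball_gradient_V hS).norm he
  have b2 : ‖S.GRσ e‖ ≤ _ := le_supBall (φ := fun e => ‖S.GRσ e‖)
    (continuousOn_ball_GRσ hS).norm he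
  have b3 : ‖gradient S.V e‖ * ‖S.GR e‖ * ‖gradient (fun y => S.eps e y) e‖ ≤ _ :=
    le_supBall (φ := fun e => ‖gradient S.V e‖ * ‖S.GR e‖ * ‖gradient (fun y => S.eps e y) e‖)
      (((continuousOn_ball_gradient_V hS).norm.mul (continuous_GR hS).norm.continuousOn).mul
        (continuousOn_ball_gradient_eps hS).norm) he
  have hv := hjb_value hS ⟨heχ, hsafe⟩
  have heps := gradient_eps hS heχ ⟨heχ, hsafe⟩
  set q := gradient S.V e
  set ε := gradient (fun y => S.eps e y) e
  have hdec : adjoint (S.dσ e e) wa + gradient S.Bbar e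
      = q - ε - adjoint (S.dσ e e) (S.W e - wa) := by
    rw [heps, map_sub]; abel
  -- The HJB equation contributes `+¼⟪q, G_R q⟫` and the feedback `-½⟪q, G_R q⟫`; the negative
  -- remainder is dropped.
  have hq := inner_GR_nonneg hS e q
  have h1 : ⟪q, S.GR e (adjoint (S.dσ e e) (S.W e - wa))⟫
      ≤ S.supBall (fun e => ‖gradient S.V e‖) * S.supBall (fun e => ‖S.GRσ e‖)
        * ‖S.W e - wa‖ := by
    refine (real_inner_le_norm _ _).trans ?_
    have := (S.GRσ e).le_opNorm (S.W e - wa)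
    rw [mul_assoc]
    exact mul_le_mul b1 (this.trans (mul_le_mul_of_nonneg_right b2 (norm_nonneg _)))
      (norm_nonneg _) ((norm_nonneg _).trans b1)
  have h2 : ⟪q, S.GR e ε⟫ ≤ ‖q‖ * ‖S.GR e‖ * ‖ε‖ := by
    refine (real_inner_le_norm _ _).trans ?_
    rw [mul_assoc]
    exact mul_le_mul_of_nonneg_left ((S.GR e).le_opNorm ε) (norm_nonneg _)
  have h3 : 0 ≤ ‖q‖ * ‖S.GR e‖ * ‖ε‖ := by positivity
  rw [G_muhat, hdec]
  simp only [inner_add_right, inner_neg_right, inner_smul_right, map_sub, inner_sub_right]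
  simp only [map_sub, inner_sub_right] at h1
  linarith

theorem norm_velocity_le (hS : S.Standing) {e : E n} (he : ‖e‖ ≤ S.ζ) (wa : E L) :
    ‖S.F e + S.G e (S.muhat e e wa)‖ ≤ S.drive + ‖S.GRσ e‖ * ‖S.W e - wa‖ / 2 := by
  have b1 : ‖S.F e‖ ≤ _ := le_supBall (φ := fun e => ‖S.F e‖)
    (continuous_F hS).norm.continuousOn he
  have b2 : ‖S.GRσ e (S.W e)‖ ≤ _ := le_supBall (φ := fun e => ‖S.GRσ e (S.W e)‖)
    ((continuousOn_ball_GRσ hS).clm_apply (continuousOn_ball_W hS)).norm he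
  have b3 : ‖S.GR e (gradient S.Bbar e)‖ ≤ _ :=
    le_supBall (φ := fun e => ‖S.GR e (gradient S.Bbar e)‖)
      ((continuous_GR hS).continuousOn.clm_apply (continuousOn_ball_gradient_Bbar hS)).norm he
  have h1 : S.F e + S.G e (S.muhat e e wa) = S.F e - (1 / 2 : ℝ) • S.GRσ e (S.W e)
      - (1 / 2 : ℝ) • S.GR e (gradient S.Bbar e) + (1 / 2 : ℝ) • S.GRσ e (S.W e - wa) := by
    rw [G_muhat]
    simp only [GRσ, ContinuousLinearMap.comp_apply, map_add, map_sub, smul_add, smul_sub]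
    abel
  have h2 := (S.GRσ e).le_opNorm (S.W e - wa)
  have hh : ∀ v : E n, ‖(1 / 2 : ℝ) • v‖ = ‖v‖ / 2 := fun v => by
    rw [norm_smul, Real.norm_of_nonneg (by norm_num)]; ring
  rw [h1]
  refine (norm_add_le _ _).trans ?_
  have h3 := norm_sub_le (S.F e - (1 / 2 : ℝ) • S.GRσ e (S.W e))
    ((1 / 2 : ℝ) • S.GR e (gradient S.Bbar e))
  have h4 := norm_sub_le (S.F e) ((1 / 2 : ℝ) • S.GRσ e (S.W e))
  rw [hh] at h3 h4
  rw [hh]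
  unfold drive
  linarith

/-- Actor version, with the product of suprema that occurs in `φa`. The next lemma, for the critic,
keeps the supremum of the product that occurs in `φac`. -/
theorem inner_dW_velocity_le (hS : S.Standing) {e : E n} (he : ‖e‖ ≤ S.ζ) (wa : E L) :
    ⟪S.W e - wa, S.dW e (S.F e + S.G e (S.muhat e e wa))⟫
      ≤ S.supBall (fun e => ‖S.dW e‖) * S.drive * ‖S.W e - wa‖
        + S.supBall (fun e => ‖S.dW e‖) * S.supBall (fun e => ‖S.GRσ e‖) / 2
          * ‖S.W e - wa‖ ^ 2 := by
  have b1 : ‖S.dW e‖ ≤ _ := le_supBall (φ := fun e => ‖S.dW e‖) (continuousOn_ball_dW hS).norm he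
  have b2 : ‖S.GRσ e‖ ≤ _ := le_supBall (φ := fun e => ‖S.GRσ e‖)
    (continuousOn_ball_GRσ hS).norm he
  have h1 := norm_velocity_le hS he wa
  have h2 : ‖S.F e + S.G e (S.muhat e e wa)‖
      ≤ S.drive + S.supBall (fun e => ‖S.GRσ e‖) * ‖S.W e - wa‖ / 2 :=
    h1.trans (by gcongr)
  refine (real_inner_le_norm _ _).trans ?_
  have h3 := ((S.dW e).le_opNorm (S.F e + S.G e (S.muhat e e wa))).trans
    (mul_le_mul b1 h2 (norm_nonneg _) ((norm_nonneg _).trans b1))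
  have h4 := mul_le_mul_of_nonneg_left h3 (norm_nonneg (S.W e - wa))
  linarith

theorem norm_dW_velocity_le (hS : S.Standing) {e : E n} (he : ‖e‖ ≤ S.ζ) (wa : E L) :
    ‖S.dW e (S.F e + S.G e (S.muhat e e wa))‖
      ≤ S.supBall (fun e => ‖S.dW e‖) * S.drive
        + S.supBall (fun e => ‖S.dW e‖ * ‖S.GRσ e‖) / 2 * ‖S.W e - wa‖ := by
  have b1 : ‖S.dW e‖ ≤ _ := le_supBall (φ := fun e => ‖S.dW e‖) (continuousOn_ball_dW hS).norm he
  have b2 : ‖S.dW e‖ * ‖S.GRσ e‖ ≤ _ := le_supBall (φ := fun e => ‖S.dW e‖ * ‖S.GRσ e‖)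
    ((continuousOn_ball_dW hS).norm.mul (continuousOn_ball_GRσ hS).norm) he
  have h1 := ((S.dW e).le_opNorm _).trans
    (mul_le_mul_of_nonneg_left (norm_velocity_le hS he wa) (norm_nonneg (S.dW e)))
  have hd : 0 ≤ S.drive := by
    have := S.supBall_nonneg (φ := fun e => ‖S.F e‖) fun _ => norm_nonneg _
    have := S.supBall_nonneg (φ := fun e => ‖S.GRσ e (S.W e)‖) fun _ => norm_nonneg _
    have := S.supBall_nonneg (φ := fun e => ‖S.GR e (gradient S.Bbar e)‖) fun _ => norm_nonneg _
    unfold drive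
    positivity
  have h2 := mul_le_mul_of_nonneg_right b1 hd
  have h3 := mul_le_mul_of_nonneg_right b2 (norm_nonneg (S.W e - wa))
  linarith

/-- Identification part of the Lyapunov derivative. -/
theorem ident_term_le {P Γ : E p →L[ℝ] E p} {θ ϑ : WMat p n} {θbar ϱ k β lo D Y ε : ℝ}
    {y : Fin M → E p} {η : Fin M → E n} {err : WMat p n}
    (hϱ : 0 < ϱ) (hk : 0 ≤ k) (hβ : 0 ≤ β) (hθ : ‖θ‖ ≤ θbar)
    (hPΓ : P ∘L Γ = .id ℝ (E p)) (hΓ : ∀ v, 0 ≤ ⟪v, Γ v⟫)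
    (hP : ∀ v, lo * ‖v‖ ^ 2 ≤ ⟪v, P v⟫) (hy : ∀ i, ‖y i‖ ≤ Y) (hη : ∀ i, ‖η i‖ ≤ ε)
    (herr : err = ∑ i, outer (y i) (tmul (θ - ϑ) (y i) + η i)) (hD : 2 * k * M * (Y * ε) ≤ D) :
    2 * ⟪θ - ϑ, lmul P (-proj θbar ϱ Γ ϑ (k • lmul Γ err))⟫
      + ⟪θ - ϑ, lmul (k • (∑ i, selfOuter (y i)) - β • P) (θ - ϑ)⟫
      ≤ -(β * lo) * ‖θ - ϑ‖ ^ 2 + D * ‖θ - ϑ‖ := by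
  have h1 := inner_lmul_le_inner_lmul_proj (τ := k • lmul Γ err) (ϑ := ϑ) hϱ hθ hPΓ
    (by
      have := inner_lmul_lower (A := Γ) (c := 0) (fun v => by simpa using hΓ v) ϑ
      simpa using this)
  set d := θ - ϑ with hd
  have h2 : lmul P (-proj θbar ϱ Γ ϑ (k • lmul Γ err))
      = -lmul P (proj θbar ϱ Γ ϑ (k • lmul Γ err)) := by
    have := lmul_smul P (-1) (proj θbar ϱ Γ ϑ (k • lmul Γ err))
    simpa using this
  have h3 : ⟪d, lmul P (k • lmul Γ err)⟫ = k * ⟪d, err⟫ := by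
    rw [lmul_smul, lmul_lmul, hPΓ, lmul_id, inner_smul_right]
  have h4 : ⟪d, err⟫ = ∑ i, (‖tmul d (y i)‖ ^ 2 + ⟪tmul d (y i), η i⟫) := by
    rw [herr, inner_sum]
    refine Finset.sum_congr rfl fun i _ => ?_
    rw [inner_outer, inner_add_right, real_inner_self_eq_norm_sq]
  have h5 : ⟪d, lmul (k • (∑ i, selfOuter (y i)) - β • P) d⟫
      = k * ∑ i, ‖tmul d (y i)‖ ^ 2 - β * ⟪d, lmul P d⟫ := by
    have : lmul (k • (∑ i, selfOuter (y i)) - β • P) d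
        = k • lmul (∑ i, selfOuter (y i)) d - β • lmul P d :=
      ext_col fun i => by simp [col_lmul]
    rw [this, inner_sub_right, inner_smul_right, inner_smul_right, inner_lmul_sum_selfOuter]
  have h6 := mul_le_mul_of_nonneg_left (inner_lmul_lower hP d) hβ
  have h7 : -∑ i, ⟪tmul d (y i), η i⟫ ≤ M * (Y * ε) * ‖d‖ := by
    rw [← Finset.sum_neg_distrib]
    have : ∀ i ∈ (Finset.univ : Finset (Fin M)), -⟪tmul d (y i), η i⟫ ≤ Y * ε * ‖d‖ := by
      intro i _
      refine (neg_le_abs _).trans ((abs_real_inner_le_norm _ _).trans ?_)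
      have a1 := (norm_tmul_le d (y i)).trans
        (mul_le_mul_of_nonneg_left (hy i) (norm_nonneg d))
      have a2 := mul_le_mul a1 (hη i) (norm_nonneg _) ((norm_nonneg _).trans a1)
      linarith
    refine (Finset.sum_le_card_nsmul _ _ _ this).trans ?_
    simp only [Finset.card_univ, Fintype.card_fin, nsmul_eq_mul]
    linarith
  -- The parameter law yields `-2k` times this sum and the gain law gives back `+k`. The net
  -- negative multiple is discarded: the damping used comes from forgetting, through `h6`.
  have h8 : 0 ≤ ∑ i, ‖tmul d (y i)‖ ^ 2 := Finset.sum_nonneg fun _ _ => sq_nonneg _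
  have h9 := mul_le_mul_of_nonneg_left h7 hk
  have h10 := mul_nonneg hk h8
  have h11 := mul_le_mul_of_nonneg_right hD (norm_nonneg d)
  rw [h3, h4, Finset.sum_add_distrib] at h1
  rw [h2, inner_neg_right, h5]
  linarith

/-- Completion of squares in the Lyapunov derivative. -/
theorem young_combination {c a d kc K Kθ φa φac φcθ ιc ιa D : ℝ}
    (hφ : 0 ≤ φcθ) (hφ' : 0 ≤ φac) (hkc : φcθ + φac < kc)
    (hK : 2 * φa + φac < K) (hK0 : 0 < K) (hKθ : φcθ < Kθ) :
    -kc * c ^ 2 - K * a ^ 2 - Kθ * d ^ 2 + φcθ * (c * d) + φac * (a * c) + φa * a ^ 2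
      + ιc * c + ιa * a + D * d
    ≤ -(kc / 4 * c ^ 2 + K / 4 * a ^ 2 + Kθ / 4 * d ^ 2)
      + (ιc ^ 2 / kc + ιa ^ 2 / K + D ^ 2 / Kθ) := by
  have hkc0 : 0 < kc := by linarith
  have hKθ0 : 0 < Kθ := by linarith
  -- The budget for each quadratic coefficient: a linear term takes a quarter of it, the cross terms
  -- (with the `φa` term for the actor) at most half by the gain conditions, and a quarter remains.
  have sq : ∀ k x i : ℝ, 0 < k → i * x ≤ k / 4 * x ^ 2 + i ^ 2 / k := by
    intro k x i hk
    have : k / 4 * x ^ 2 + i ^ 2 / k - i * x = (k * x / 2 - i) ^ 2 / k := by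
      field_simp; ring
    have h2 : 0 ≤ (k * x / 2 - i) ^ 2 / k := by positivity
    linarith
  have s1 := sq kc c ιc hkc0
  have s2 := sq K a ιa hK0
  have s3 := sq Kθ d D hKθ0
  have m1 : φcθ * (c * d) ≤ φcθ / 2 * c ^ 2 + φcθ / 2 * d ^ 2 := by
    nlinarith [mul_nonneg hφ (sq_nonneg (c - d))]
  have m2 : φac * (a * c) ≤ φac / 2 * c ^ 2 + φac / 2 * a ^ 2 := by
    nlinarith [mul_nonneg hφ' (sq_nonneg (a - c))]
  have n1 := mul_nonneg (by linarith : 0 ≤ kc - (φcθ + φac)) (sq_nonneg c)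
  have n2 := mul_nonneg (by linarith : 0 ≤ K - (2 * φa + φac)) (sq_nonneg a)
  have n3 := mul_nonneg (by linarith : 0 ≤ Kθ - φcθ) (sq_nonneg d)
  linarith

end Setup


/-! ### Integrals of vector- and matrix-valued signals -/

/-- Multiplication by the transpose of a weight matrix, as a continuous linear map. -/
noncomputable def tmulCLM {p n : ℕ} (ϑ : WMat p n) : E p →L[ℝ] E n :=
  ∑ j, (EuclideanSpace.proj j : E p →L[ℝ] ℝ).smulRight (ϑ j)

theorem tmulCLM_apply {p n : ℕ} (ϑ : WMat p n) (y : E p) : tmulCLM ϑ y = tmul ϑ y := by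
  simp [tmulCLM, tmul]

theorem tmul_intervalIntegral {p n : ℕ} (ϑ : WMat p n) {y : ℝ → E p} {a b : ℝ}
    (hy : IntervalIntegrable y volume a b) :
    tmul ϑ (∫ τ in a..b, y τ) = ∫ τ in a..b, tmul ϑ (y τ) := by
  simp_rw [← tmulCLM_apply]
  exact ((tmulCLM ϑ).intervalIntegral_comp_comm hy).symm

/-- A Loewner lower bound of an integral of positive matrices yields an integrable minorant of the
quadratic form; where the integrand is not integrable, the bound can only be trivial. -/
theorem exists_integrable_minorant {k : ℕ} {A : ℝ → (E k →L[ℝ] E k)} {a b c : ℝ} (hab : a ≤ b)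
    (hA : ∀ s v, 0 ≤ ⟪v, A s v⟫)
    (h : c • (1 : E k →L[ℝ] E k) ≤ ∫ s in a..b, A s) (v : E k) :
    ∃ g : ℝ → ℝ, IntegrableOn g (Icc a b) ∧ (∀ s, g s ≤ ⟪v, A s v⟫) ∧
      c * ‖v‖ ^ 2 ≤ ∫ s in a..b, g s := by
  by_cases hi : IntervalIntegrable A volume a b
  · set Φ : (E k →L[ℝ] E k) →L[ℝ] ℝ :=
      innerSL ℝ v ∘L ContinuousLinearMap.apply ℝ (E k) v
    have hΦ : ∀ s, Φ (A s) = ⟪v, A s v⟫ := fun s => rfl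
    refine ⟨fun s => Φ (A s), ?_, fun s => (hΦ s).le, ?_⟩
    · have h1 : IntegrableOn A (Icc a b) :=
        (intervalIntegrable_iff_integrableOn_Icc_of_le hab).1 hi
      exact Φ.integrable_comp h1
    · rw [Φ.intervalIntegral_comp_comm hi]
      have := loewner_inner h v
      rwa [inner_smul_one] at this
  · rw [intervalIntegral.integral_undef hi] at h
    have h1 := loewner_inner h v
    rw [inner_smul_one] at h1
    refine ⟨fun _ => 0, by simp, fun s => hA s v, by simpa using h1⟩

namespace Setup

variable {n m L p N M : ℕ} {O : Type*} {S : Setup n m L p N M O}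

namespace Trajectory

variable {tr : S.Trajectory} {X : Excitation}

/-! ## The critic gain -/

/-- The matrix that drives the critic gain. -/
noncomputable def regressor (tr : S.Trajectory) (t : ℝ) : E L →L[ℝ] E L :=
  S.kc1 • S.Lam (tr.om t) + (S.kc2 / N) • ∑ i, S.Lam (tr.omi i t)

theorem inner_regressor (t : ℝ) (v : E L) : ⟪v, tr.regressor t v⟫
    = S.kc1 * ⟪v, S.Lam (tr.om t) v⟫ + S.kc2 / N * ∑ i, ⟪v, S.Lam (tr.omi i t) v⟫ := by
  simp [regressor, inner_add_right, inner_smul_right, inner_sum]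

theorem inner_regressor_nonneg (hS : S.Standing) (t : ℝ) (v : E L) :
    0 ≤ ⟪v, tr.regressor t v⟫ := by
  rw [inner_regressor]
  exact add_nonneg (mul_nonneg hS.kc1_pos.le (S.inner_Lam_nonneg _ v))
    (mul_nonneg (div_nonneg hS.kc2_pos.le (Nat.cast_nonneg N))
      (Finset.sum_nonneg fun i _ => S.inner_Lam_nonneg _ v))

theorem inner_regressor_le (hS : S.Standing) (t : ℝ) (v : E L) :
    ⟪v, tr.regressor t v⟫ ≤ (S.kc1 + S.kc2) / (4 * S.γ1) * ‖v‖ ^ 2 := by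
  rw [inner_regressor]
  have hN : (0 : ℝ) < N := Nat.cast_pos.2 hS.N_pos
  have h1 := mul_le_mul_of_nonneg_left (inner_Lam_le hS (tr.om t) v) hS.kc1_pos.le
  have h4 : ∑ i, ⟪v, S.Lam (tr.omi i t) v⟫ ≤ N * (1 / (4 * S.γ1) * ‖v‖ ^ 2) := by
    refine (Finset.sum_le_card_nsmul _ _ _ fun i _ => inner_Lam_le hS (tr.omi i t) v).trans ?_
    simp
  have h5 := mul_le_mul_of_nonneg_left h4 (div_pos hS.kc2_pos hN).le
  have h6 : S.kc2 / N * (N * (1 / (4 * S.γ1) * ‖v‖ ^ 2)) = S.kc2 * (1 / (4 * S.γ1) * ‖v‖ ^ 2) := by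
    field_simp
  rw [h6] at h5
  refine (add_le_add h1 h5).trans (le_of_eq ?_)
  ring

theorem isGain_critic (hS : S.Standing) (h : tr.IsSolution) :
    IsGain S.β tr.Γ tr.regressor where
  pos := hS.β_pos
  sol := by
    have : (fun t => S.β • tr.Γ t - tr.Γ t ∘L tr.regressor t ∘L tr.Γ t) = tr.ΓRHS := by
      funext t
      ext1 v
      simp only [ΓRHS, regressor, sub_apply, smul_apply, ContinuousLinearMap.comp_apply, add_apply,
        map_add, map_smul]
      abel
    rw [this]
    exact h.Γ_sol
  init := h.Γ_init ▸ hS.Γ0_posDef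
  symm := fun t _ => by
    refine isSelfAdjoint_of_inner fun v w => ?_
    simp only [regressor, add_apply, smul_apply, sum_apply, inner_add_left, inner_add_right,
      inner_smul_left, inner_smul_right, sum_inner, inner_sum,
      isSelfAdjoint_inner (S.isSelfAdjoint_Lam _), RCLike.conj_to_real]
  bdd := fun t => by
    refine ⟨‖S.kc1‖ * (1 / (4 * S.γ1)) + ‖S.kc2 / N‖ * ∑ _i : Fin N, 1 / (4 * S.γ1), ?_⟩
    intro s _
    refine (norm_add_le _ _).trans ?_
    rw [norm_smul, norm_smul]
    refine add_le_add (mul_le_mul_of_nonneg_left (norm_Lam_le hS _) (norm_nonneg _))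
      (mul_le_mul_of_nonneg_left ?_ (norm_nonneg _))
    exact (norm_sum_le _ _).trans (Finset.sum_le_sum fun i _ => norm_Lam_le hS _)

theorem critic_form_le (hS : S.Standing) (h : tr.IsSolution) {t : ℝ} (ht : 0 ≤ t) (v : E L) :
    ⟪v, (tr.Γ t).inverse v⟫
      ≤ max (lamMax S.Γ0.inverse) ((S.kc1 + S.kc2) / (4 * S.γ1 * S.β)) * ‖v‖ ^ 2 := by
  have := (isGain_critic hS h).form_le ht v fun s _ => inner_regressor_le hS s v
  rwa [h.Γ_init, div_div] at this

theorem critic_form_nonneg (hS : S.Standing) (h : tr.IsSolution) {t : ℝ} (ht : 0 ≤ t) (v : E L) :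
    0 ≤ ⟪v, (tr.Γ t).inverse v⟫ :=
  (isGain_critic hS h).form_nonneg ht v fun s _ => inner_regressor_nonneg hS s v

theorem le_critic_form (hS : S.Standing) (hX : X.Admissible) (h : tr.IsSolution)
    (hE : tr.Excited X) {t : ℝ} (ht : 0 ≤ t) (v : E L) :
    Real.exp (-S.β * X.T) *
      min (S.kc1 * X.c3 + S.kc2 * max X.c1 (X.c2 * X.T)) (lamMin S.Γ0.inverse) * ‖v‖ ^ 2
      ≤ ⟪v, (tr.Γ t).inverse v⟫ := by
  rcases eq_or_ne v 0 with rfl | hv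
  · simp
  have hnt : Nontrivial (E L) := ⟨v, 0, hv⟩
  have hlam := lamMin_pos (isPosDef_inverse hS.Γ0_posDef)
  have hg := isGain_critic hS h
  have hN : (0 : ℝ) < N := Nat.cast_pos.2 hS.N_pos
  rw [mul_assoc]
  -- Before time `T` the initial value has decayed by at most `exp (-β T)`. Afterwards the
  -- excitation over `[t - T, t]` replaces it. The minimum in the bound covers both regimes.
  rcases le_total t X.T with hT | hT
  · refine le_trans ?_ (hg.exp_mul_form_le le_rfl ht v fun s _ => inner_regressor_nonneg hS s v)
    have h1 := lamMin_mul_le (isPosDef_inverse hS.Γ0_posDef).1 v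
    rw [h.Γ_init]
    refine mul_le_mul ?_ ?_ ?_ (Real.exp_pos _).le
    · refine Real.exp_le_exp.2 ?_
      have := hS.β_pos
      nlinarith
    · exact (mul_le_mul_of_nonneg_right (min_le_right _ _) (sq_nonneg _)).trans h1
    · refine mul_nonneg (le_min ?_ hlam.le) (sq_nonneg _)
      have := hS.kc1_pos
      have := hS.kc2_pos
      have := hX.c3_nonneg
      have := hX.c1_nonneg.trans (le_max_left X.c1 (X.c2 * X.T))
      positivity
  · have ha : 0 ≤ t - X.T := by linarith
    have hab : t - X.T ≤ t := by linarith [hX.T_pos]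
    have e1 : t - X.T + X.T = t := by ring
    obtain ⟨g3, hi3, hle3, hint3⟩ := exists_integrable_minorant (c := X.c3) hab
      (fun s v => S.inner_Lam_nonneg (tr.om s) v)
      (by have := hE.2.2 _ ha; rwa [e1] at this) v
    obtain ⟨g1, hi1, hle1, hint1⟩ : ∃ g : ℝ → ℝ, IntegrableOn g (Icc (t - X.T) t) ∧
        (∀ s, 0 ≤ s → g s ≤ 1 / N * ∑ i, ⟪v, S.Lam (tr.omi i s) v⟫) ∧
        max X.c1 (X.c2 * X.T) * ‖v‖ ^ 2 ≤ ∫ s in (t - X.T)..t, g s := by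
      have hform : ∀ s, ⟪v, ((1 / N : ℝ) • ∑ i, S.Lam (tr.omi i s)) v⟫
          = 1 / N * ∑ i, ⟪v, S.Lam (tr.omi i s) v⟫ := by
        intro s
        simp [inner_smul_right, inner_sum]
      rcases le_total (X.c2 * X.T) X.c1 with hc | hc
      · rw [max_eq_left hc]
        obtain ⟨g, h1, h2, h3⟩ := exists_integrable_minorant
          (A := fun s => (1 / N : ℝ) • ∑ i, S.Lam (tr.omi i s)) (c := X.c1) hab
          (fun s v => by
            simp only [smul_apply, sum_apply, inner_smul_right, inner_sum]
            exact mul_nonneg (by positivity)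
              (Finset.sum_nonneg fun i _ => S.inner_Lam_nonneg _ v))
          (by have := hE.1 _ ha; rwa [e1, ← intervalIntegral.integral_smul] at this) v
        exact ⟨g, h1, fun s _ => (h2 s).trans (hform s).le, h3⟩
      · rw [max_eq_right hc]
        -- The pointwise condition yields a constant minorant, whose integral over the window is `c2
        -- T ‖v‖²`.
        refine ⟨fun _ => X.c2 * ‖v‖ ^ 2, continuousOn_const.integrableOn_Icc, fun s hs => ?_, ?_⟩
        · have := loewner_inner (hE.2.1 s hs) v
          rwa [inner_smul_one, hform] at this
        · rw [intervalIntegral.integral_const, smul_eq_mul]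
          exact le_of_eq (by ring)
    have hgi : IntegrableOn (fun s => S.kc1 * g3 s + S.kc2 * g1 s) (Icc (t - X.T) t) :=
      (hi3.const_mul _).add (hi1.const_mul _)
    have h1 := hg.exp_mul_integral_le_form ha hab v hgi (fun s hs => by
        rw [inner_regressor]
        have a1 := mul_le_mul_of_nonneg_left (hle3 s) hS.kc1_pos.le
        have a2 := mul_le_mul_of_nonneg_left (hle1 s (ha.trans hs.1)) hS.kc2_pos.le
        have a3 : S.kc2 * (1 / N * ∑ i, ⟪v, S.Lam (tr.omi i s) v⟫)
          = S.kc2 / N * ∑ i, ⟪v, S.Lam (tr.omi i s) v⟫ := by ring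
        linarith) (fun s _ => inner_regressor_nonneg hS s v)
    refine le_trans ?_ h1
    rw [sub_sub_cancel]
    refine mul_le_mul_of_nonneg_left ?_ (Real.exp_pos _).le
    have i3 := (intervalIntegrable_iff_integrableOn_Icc_of_le hab).2 hi3
    have i1 := (intervalIntegrable_iff_integrableOn_Icc_of_le hab).2 hi1
    rw [intervalIntegral.integral_add (i3.const_mul _) (i1.const_mul _),
      intervalIntegral.integral_const_mul, intervalIntegral.integral_const_mul]
    have a1 := mul_le_mul_of_nonneg_left hint3 hS.kc1_pos.le
    have a2 := mul_le_mul_of_nonneg_left hint1 hS.kc2_pos.le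
    have a3 := mul_le_mul_of_nonneg_right (min_le_left
      (S.kc1 * X.c3 + S.kc2 * max X.c1 (X.c2 * X.T)) (lamMin S.Γ0.inverse)) (sq_nonneg ‖v‖)
    linarith

theorem critic_loewner (hS : S.Standing) (hX : X.Admissible) (h : tr.IsSolution)
    (hE : tr.Excited X) {t : ℝ} (ht : 0 ≤ t) :
    S.ΓLow • (1 : E L →L[ℝ] E L) ≤ tr.Γ t ∧ tr.Γ t ≤ S.ΓUp X • (1 : E L →L[ℝ] E L) := by
  have h1 := hS.kc1_pos
  have h2 := hS.kc2_pos
  have h3 := hS.γ1_pos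
  have h4 := hS.β_pos
  refine (isGain_critic hS h).loewner_bounds ht (lt_max_of_lt_right (by positivity))
    (critic_form_le hS h ht) (le_critic_form hS hX h hE ht) (fun hnt => ?_)
    (critic_form_nonneg hS h ht)
  refine mul_pos (Real.exp_pos _) (lt_min ?_ (lamMin_pos (isPosDef_inverse hS.Γ0_posDef)))
  have h5 := hX.c3_nonneg
  have h6 := hX.c1_nonneg.trans (le_max_left X.c1 (X.c2 * X.T))
  rcases hX.some_pos with h | h | h
  · have := h.trans_le (le_max_left X.c1 (X.c2 * X.T)); positivity
  · have := (mul_pos h hX.T_pos).trans_le (le_max_right X.c1 (X.c2 * X.T)); positivity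
  · positivity

/-! ## The history stack and the identification gain -/

theorem continuousOn_x (h : tr.IsSolution) : ContinuousOn tr.x (Ici 0) :=
  S.continuous_z.comp_continuousOn h.e_sol.1

theorem continuousOn_Yx (hS : S.Standing) (h : tr.IsSolution) :
    ContinuousOn (fun τ => S.Y (tr.x τ)) (Ici 0) :=
  hS.Y_cont.comp_continuousOn (continuousOn_x h)

/-- The window length is exactly `min s Δt`: the bound `Δt` is used in general, the bound `s` just
after the start. -/
theorem norm_window_le {H : Type*} [NormedAddCommGroup H] [NormedSpace ℝ H] {φ : ℝ → H} {C s t : ℝ}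
    (hS : S.Standing) (hs : s ∈ Icc 0 t) (hφ : ∀ τ ∈ Icc 0 t, ‖φ τ‖ ≤ C) :
    ‖∫ τ in (max 0 (s - S.Δt))..s, φ τ‖ ≤ C * min s S.Δt := by
  have hle : max 0 (s - S.Δt) ≤ s := max_le hs.1 (by linarith [hS.Δt_pos])
  have h1 := intervalIntegral.norm_integral_le_of_norm_le_const (a := max 0 (s - S.Δt)) (b := s)
    (f := φ) (C := C) fun τ hτ => by
      rw [uIoc_of_le hle] at hτ
      exact hφ τ ⟨(le_max_left _ _).trans hτ.1.le, hτ.2.trans hs.2⟩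
  rw [abs_of_nonneg (sub_nonneg.2 hle)] at h1
  rwa [show s - max 0 (s - S.Δt) = min s S.Δt by
    rcases le_total s S.Δt with h | h
    · rw [max_eq_left (by linarith), min_eq_left h, sub_zero]
    · rw [max_eq_right (by linarith), min_eq_right h]; ring] at h1

theorem isSelfAdjoint_stackMat (t : ℝ) : IsSelfAdjoint (tr.stackMat t) :=
  isSelfAdjoint_of_inner fun v w => by
    simp only [stackMat, sum_apply, sum_inner, inner_sum,
      isSelfAdjoint_inner (isSelfAdjoint_selfOuter _)]

theorem inner_stackMat_nonneg (t : ℝ) (v : E p) : 0 ≤ ⟪v, tr.stackMat t v⟫ := by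
  simp only [stackMat, sum_apply, inner_sum, inner_selfOuter]
  exact Finset.sum_nonneg fun _ _ => sq_nonneg _

theorem inner_stackMat_le {t C : ℝ} (hC : ∀ i, ‖tr.intY (tr.stamp i t)‖ ≤ C) (v : E p) :
    ⟪v, tr.stackMat t v⟫ ≤ M * C ^ 2 * ‖v‖ ^ 2 := by
  simp only [stackMat, sum_apply, inner_sum, inner_selfOuter]
  refine (Finset.sum_le_card_nsmul _ _ (C ^ 2 * ‖v‖ ^ 2) fun i _ => ?_).trans ?_
  · rw [← sq_abs, ← mul_pow]
    refine pow_le_pow_left₀ (abs_nonneg _) ?_ 2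
    exact (abs_real_inner_le_norm _ _).trans (mul_le_mul_of_nonneg_right (hC i) (norm_nonneg _))
  · simp only [Finset.card_univ, Fintype.card_fin, nsmul_eq_mul]
    exact le_of_eq (by ring)

theorem isGain_ident (hS : S.Standing) (h : tr.IsSolution) :
    IsGain S.βθ tr.Γθ (fun t => S.kθ • tr.stackMat t) where
  pos := hS.βθ_pos
  sol := by
    have : (fun t => S.βθ • tr.Γθ t - tr.Γθ t ∘L (S.kθ • tr.stackMat t) ∘L tr.Γθ t)
        = tr.ΓθRHS := by
      funext t
      ext1 v
      simp only [ΓθRHS, sub_apply, smul_apply, ContinuousLinearMap.comp_apply, map_smul]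
    rw [this]
    exact h.Γθ_sol
  init := h.Γθ_init ▸ hS.Γθ0_posDef
  symm := fun t _ => isSelfAdjoint_of_inner fun v w => by
    simp only [smul_apply, inner_smul_left, inner_smul_right,
      isSelfAdjoint_inner (isSelfAdjoint_stackMat t), RCLike.conj_to_real]
  bdd := fun t => by
    obtain ⟨C, hC⟩ := isCompact_Icc.exists_bound_of_continuousOn
      ((continuousOn_Yx hS h).mono (fun x hx => hx.1 : Icc 0 t ⊆ Ici 0))
    refine ⟨‖S.kθ‖ * ∑ _i : Fin M, (|C| * S.Δt) ^ 2, fun s hs => ?_⟩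
    rw [norm_smul]
    refine mul_le_mul_of_nonneg_left ((norm_sum_le _ _).trans
      (Finset.sum_le_sum fun i _ => ?_)) (norm_nonneg _)
    refine (norm_selfOuter_le _).trans (pow_le_pow_left₀ (norm_nonneg _) ?_ 2)
    have hst := h.stamp_mem i s hs.1
    refine (norm_window_le hS ⟨hst.1, hst.2.trans hs.2⟩
      fun τ hτ => (hC τ hτ).trans (le_abs_self C)).trans ?_
    exact mul_le_mul_of_nonneg_left (min_le_right _ _) (abs_nonneg _)

theorem ident_form_nonneg (hS : S.Standing) (h : tr.IsSolution) {t : ℝ} (ht : 0 ≤ t) (v : E p) :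
    0 ≤ ⟪v, (tr.Γθ t).inverse v⟫ :=
  (isGain_ident hS h).form_nonneg ht v fun s _ => by
    rw [smul_apply, inner_smul_right]
    exact mul_nonneg hS.kθ_pos.le (inner_stackMat_nonneg s v)

theorem ident_form_le (hS : S.Standing) (h : tr.IsSolution) {t C : ℝ} (ht : 0 ≤ t)
    (hC : ∀ s ∈ Ico 0 t, ∀ i, ‖tr.intY (tr.stamp i s)‖ ≤ C) (v : E p) :
    ⟪v, (tr.Γθ t).inverse v⟫
      ≤ max (lamMax S.Γθ0.inverse) (S.kθ * M * C ^ 2 / S.βθ) * ‖v‖ ^ 2 := by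
  have := (isGain_ident hS h).form_le (c := S.kθ * M * C ^ 2) ht v fun s hs => by
    rw [smul_apply, inner_smul_right]
    have := mul_le_mul_of_nonneg_left (inner_stackMat_le (hC s hs) v) hS.kθ_pos.le
    linarith
  rwa [h.Γθ_init] at this

theorem le_ident_form (hS : S.Standing) (hX : X.Admissible) (h : tr.IsSolution)
    (hE : tr.RichStack X) {t : ℝ} (ht : 0 ≤ t) (v : E p) :
    min (Real.exp (-S.βθ * X.Tθ) * lamMin S.Γθ0.inverse) (S.kθ * X.lamθ / S.βθ) * ‖v‖ ^ 2
      ≤ ⟪v, (tr.Γθ t).inverse v⟫ := by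
  rcases eq_or_ne v 0 with rfl | hv
  · simp
  have hnt : Nontrivial (E p) := ⟨v, 0, hv⟩
  have hlam := lamMin_pos (isPosDef_inverse hS.Γθ0_posDef)
  have hg := isGain_ident hS h
  -- Up to `Tθ` only the decay of the initial value is available. From `Tθ` on, the rich stack keeps
  -- the form above the smaller of its value at `Tθ` and `kθ λθ / βθ`, times `‖v‖²`.
  have early : ∀ s, 0 ≤ s → s ≤ X.Tθ →
      Real.exp (-S.βθ * X.Tθ) * lamMin S.Γθ0.inverse * ‖v‖ ^ 2 ≤ ⟪v, (tr.Γθ s).inverse v⟫ := by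
    intro s hs hsT
    refine le_trans ?_ (hg.exp_mul_form_le le_rfl hs v fun s _ => by
      rw [smul_apply, inner_smul_right]
      exact mul_nonneg hS.kθ_pos.le (inner_stackMat_nonneg s v))
    have h1 := lamMin_mul_le (isPosDef_inverse hS.Γθ0_posDef).1 v
    rw [h.Γθ_init, mul_assoc]
    refine mul_le_mul ?_ h1 (by positivity) (Real.exp_pos _).le
    refine Real.exp_le_exp.2 ?_
    have := hS.βθ_pos
    nlinarith
  rcases le_total t X.Tθ with hT | hT
  · exact (mul_le_mul_of_nonneg_right (min_le_left _ _) (sq_nonneg _)).trans (early t ht hT)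
  · refine le_trans ?_ (hg.min_le_form (c := S.kθ * X.lamθ * ‖v‖ ^ 2) hX.Tθ_pos.le hT v
      fun s hs => ?_)
    · rw [min_mul_of_nonneg _ _ (sq_nonneg _)]
      refine min_le_min (early _ hX.Tθ_pos.le le_rfl) ?_
      rw [div_mul_eq_mul_div]
    · rw [smul_apply, inner_smul_right, mul_assoc]
      refine mul_le_mul_of_nonneg_left ?_ hS.kθ_pos.le
      exact (mul_le_mul_of_nonneg_right (hE s hs.1) (sq_nonneg _)).trans
        (lamMin_mul_le (isSelfAdjoint_stackMat s) v)

/-- With no features the spectrum of the stack matrix is empty, so `lamMin` is `0`, which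
contradicts `λθ > 0`. -/
theorem nontrivial_of_richStack (hX : X.Admissible) (hE : tr.RichStack X) : Nontrivial (E p) := by
  by_contra hcon
  rw [not_nontrivial_iff_subsingleton] at hcon
  have h1 := hE X.Tθ le_rfl
  have h2 : spectrum ℝ (tr.stackMat X.Tθ) = ∅ := by
    rw [eq_empty_iff_forall_notMem]
    intro μ hμ
    obtain ⟨v, hv, -⟩ := exists_eigenvector_of_mem_spectrum hμ
    exact hv (Subsingleton.elim _ _)
  rw [lamMin, h2, Real.sInf_empty] at h1
  linarith [hX.lamθ_pos]

/-- Upper bound of the inverse of the identification gain. -/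
noncomputable def identUpper (S : Setup n m L p N M O) : ℝ :=
  max (lamMax S.Γθ0.inverse)
    (S.kθ * M * S.Δt ^ 2 * S.supBall (fun e => ‖S.Y (S.z e)‖) ^ 2 / S.βθ)

theorem norm_intY_le (hS : S.Standing) {s t : ℝ} (hs : s ∈ Icc 0 t)
    (he : ∀ τ ∈ Icc 0 t, ‖tr.e τ‖ ≤ S.ζ) :
    ‖tr.intY s‖ ≤ S.supBall (fun e => ‖S.Y (S.z e)‖) * S.Δt := by
  refine (norm_window_le hS hs fun τ hτ => le_supBall (φ := fun e => ‖S.Y (S.z e)‖)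
    (continuous_Yz hS).norm.continuousOn (he τ hτ)).trans ?_
  exact mul_le_mul_of_nonneg_left (min_le_right _ _) (supBall_nonneg fun _ => norm_nonneg _)

/-- The features are bounded by `ν` only on the analysis ball, and a recorded window may lie
anywhere in the past; hence the requirement on all of `[0, t]`. -/
theorem ident_form_le_of_mem_ball (hS : S.Standing) (h : tr.IsSolution) {t : ℝ} (ht : 0 ≤ t)
    (he : ∀ τ ∈ Icc 0 t, ‖tr.e τ‖ ≤ S.ζ) (v : E p) :
    ⟪v, (tr.Γθ t).inverse v⟫ ≤ identUpper S * ‖v‖ ^ 2 := by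
  refine (ident_form_le hS h ht (C := S.supBall (fun e => ‖S.Y (S.z e)‖) * S.Δt)
    (fun s hs i => ?_) v).trans (le_of_eq ?_)
  · have hst := h.stamp_mem i s hs.1
    exact norm_intY_le hS ⟨hst.1, hst.2.trans hs.2.le⟩ he
  · rw [identUpper]
    ring_nf

/-- Shortly after the start the history stack is too poor to violate the bound. -/
theorem exists_ident_form_le_early (hS : S.Standing) (hnt : Nontrivial (E p))
    (h : tr.IsSolution) : ∃ t₀ > 0, ∀ t ∈ Icc 0 t₀, ∀ v : E p,
      ⟪v, (tr.Γθ t).inverse v⟫ ≤ identUpper S * ‖v‖ ^ 2 := by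
  obtain ⟨C, hC⟩ := isCompact_Icc.exists_bound_of_continuousOn
    ((continuousOn_Yx hS h).mono (fun x hx => hx.1 : Icc (0 : ℝ) 1 ⊆ Ici 0))
  have hC0 : 0 ≤ C := (norm_nonneg _).trans (hC 0 ⟨le_rfl, zero_le_one⟩)
  have hpd := isPosDef_inverse hS.Γθ0_posDef
  have hlam : 0 < lamMax S.Γθ0.inverse := (lamMin_pos hpd).trans_le (lamMin_le_lamMax hpd.1)
  -- Windows recorded by time `s` have integrals of size at most `C s`, so the contribution of the
  -- stack tends to zero while the initial eigenvalue is positive.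
  have hcont : Continuous fun s : ℝ => S.kθ * M * (C * s) ^ 2 / S.βθ := by fun_prop
  have hev := (hcont.tendsto 0).eventually_lt_const (u := lamMax S.Γθ0.inverse) (by simpa)
  obtain ⟨δ, hδ, hball⟩ := Metric.eventually_nhds_iff.1 hev
  refine ⟨min 1 (δ / 2), by positivity, fun t ht v => ?_⟩
  refine (ident_form_le hS h ht.1 (C := C * t) (fun s hs i => ?_) v).trans ?_
  · have hst := h.stamp_mem i s hs.1
    refine (norm_window_le hS (t := 1) ⟨hst.1, hst.2.trans
      (hs.2.le.trans (ht.2.trans (min_le_left _ _)))⟩ hC).trans ?_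
    exact mul_le_mul_of_nonneg_left ((min_le_left _ _).trans (hst.2.trans hs.2.le)) hC0
  · refine mul_le_mul_of_nonneg_right ?_ (sq_nonneg _)
    refine max_le (le_max_left _ _) ((hball ?_).le.trans (le_max_left _ _))
    rw [Real.dist_eq, sub_zero, abs_of_nonneg ht.1]
    have := ht.2.trans (min_le_right _ _)
    linarith

theorem ident_loewner (hS : S.Standing) (hX : X.Admissible) (h : tr.IsSolution)
    (hE : tr.RichStack X) {t : ℝ} (ht : 0 ≤ t)
    (hup : ∀ v : E p, ⟪v, (tr.Γθ t).inverse v⟫ ≤ identUpper S * ‖v‖ ^ 2) :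
    S.ΓθLow • (1 : E p →L[ℝ] E p) ≤ tr.Γθ t ∧ tr.Γθ t ≤ S.ΓθUp X • (1 : E p →L[ℝ] E p) := by
  have hnt := nontrivial_of_richStack hX hE
  have hpd := isPosDef_inverse hS.Γθ0_posDef
  have hlam : 0 < lamMax S.Γθ0.inverse := (lamMin_pos hpd).trans_le (lamMin_le_lamMax hpd.1)
  exact (isGain_ident hS h).loewner_bounds ht (lt_max_of_lt_left hlam) hup
    (le_ident_form hS hX h hE ht) (fun _ => lt_min (mul_pos (Real.exp_pos _) (lamMin_pos hpd))
      (div_pos (mul_pos hS.kθ_pos hX.lamθ_pos) hS.βθ_pos)) (ident_form_nonneg hS h ht)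

/-! ## The prediction error of the history stack -/

theorem continuousOn_u (hS : S.Standing) (h : tr.IsSolution) {t : ℝ}
    (he : ∀ τ ∈ Icc 0 t, ‖tr.e τ‖ ≤ S.ζ) : ContinuousOn tr.u (Icc 0 t) := by
  have hec : ContinuousOn tr.e (Icc 0 t) := h.e_sol.1.mono fun x hx => hx.1
  have hwc : ContinuousOn tr.wa (Icc 0 t) := h.wa_sol.1.mono fun x hx => hx.1
  have hmaps : MapsTo tr.e (Icc 0 t) (Metric.closedBall 0 S.ζ) :=
    fun τ hτ => by simpa using he τ hτ
  have h1 := (continuousOn_ball_of_smp hS (φ := fun e y => adjoint (S.dσ e y))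
    (continuousOn_smp_adjoint_dσ hS)).comp hec hmaps
  have h2 := (continuousOn_ball_gradient_Bbar hS).comp hec hmaps
  have h3 : ContinuousOn (fun τ => adjoint (S.G (tr.e τ))) (Icc 0 t) :=
    (LinearIsometryEquiv.continuous _).comp_continuousOn
      ((continuous_G hS).comp_continuousOn hec)
  have h4 := h3.clm_apply ((h1.clm_apply hwc).add h2)
  exact continuousOn_const.add
    (((continuousOn_const (c := S.R.inverse)).clm_apply h4).const_smul (1 / 2 : ℝ)).neg

/-- The fundamental theorem of calculus for `ẋ = θᵀ Y + ε_θ + g u`. Known terms on the left isolate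
the unknown parameters, without differentiating the state. -/
theorem window_increment (hS : S.Standing) (h : tr.IsSolution) {s t : ℝ} (hs : s ∈ Icc 0 t)
    (he : ∀ τ ∈ Icc 0 t, ‖tr.e τ‖ ≤ S.ζ) :
    tr.x s - tr.x (max 0 (s - S.Δt)) - tr.intU s
      = tmul S.θ (tr.intY s) + ∫ τ in (max 0 (s - S.Δt))..s, S.epsθ (tr.x τ) := by
  have hle : max 0 (s - S.Δt) ≤ s := max_le hs.1 (by linarith [hS.Δt_pos])
  have hsub : Icc (max 0 (s - S.Δt)) s ⊆ Icc 0 t :=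
    Icc_subset_Icc (le_max_left _ _) hs.2
  have hsub' : Icc (max 0 (s - S.Δt)) s ⊆ Ici 0 := fun τ hτ => (hsub hτ).1
  have cY := (continuousOn_Yx hS h).mono hsub'
  have cx := (continuousOn_x h).mono hsub'
  have cε : ContinuousOn (fun τ => S.epsθ (tr.x τ)) (Icc (max 0 (s - S.Δt)) s) := by
    unfold epsθ
    exact (hS.f_lip.continuous.comp_continuousOn cx).sub
      ((continuous_tmul_right S.θ).comp_continuousOn cY)
  have cU : ContinuousOn (fun τ => S.g (tr.x τ) (tr.u τ)) (Icc (max 0 (s - S.Δt)) s) :=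
    (hS.g_lip.continuous.comp_continuousOn cx).clm_apply ((continuousOn_u hS h he).mono hsub)
  have cT : ContinuousOn (fun τ => tmul S.θ (S.Y (tr.x τ))) (Icc (max 0 (s - S.Δt)) s) :=
    (continuous_tmul_right S.θ).comp_continuousOn cY
  have iY := cY.intervalIntegrable_of_Icc (μ := volume) hle
  have iε := cε.intervalIntegrable_of_Icc (μ := volume) hle
  have iU := cU.intervalIntegrable_of_Icc (μ := volume) hle
  have iT := cT.intervalIntegrable_of_Icc (μ := volume) hle
  have hder : ∀ τ ∈ Ioo (max 0 (s - S.Δt)) s, HasDerivWithinAt tr.x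
      (tmul S.θ (S.Y (tr.x τ)) + S.epsθ (tr.x τ) + S.g (tr.x τ) (tr.u τ)) (Ioi τ) τ := by
    intro τ hτ
    have h1 := (h.e_sol.2 τ ((le_max_left _ _).trans hτ.1.le)).add_const S.xd
    refine (h1.mono Ioi_subset_Ici_self).congr_deriv ?_
    simp only [F, G, epsθ, u, x, map_add]
    abel
  have hftc := intervalIntegral.integral_eq_sub_of_hasDeriv_right_of_le hle cx hder
    ((iT.add iε).add iU)
  rw [intervalIntegral.integral_add (iT.add iε) iU, intervalIntegral.integral_add iT iε] at hftc
  rw [intY, intU, tmul_intervalIntegral S.θ iY, ← hftc]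
  abel

/-- `Σ_i 𝒴_i (θ̃ᵀ 𝒴_i + ∫ ε_θ)ᵀ`. -/
theorem stackErr_eq (hS : S.Standing) (h : tr.IsSolution) {t : ℝ} (ht : 0 ≤ t)
    (he : ∀ τ ∈ Icc 0 t, ‖tr.e τ‖ ≤ S.ζ) :
    tr.stackErr t = ∑ i, outer (tr.intY (tr.stamp i t))
      (tmul (S.θ - tr.ϑ t) (tr.intY (tr.stamp i t))
        + ∫ τ in (max 0 (tr.stamp i t - S.Δt))..(tr.stamp i t), S.epsθ (tr.x τ)) := by
  unfold stackErr
  refine Finset.sum_congr rfl fun i _ => ?_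
  rw [window_increment hS h (h.stamp_mem i t ht) he, tmul_sub]
  congr 1
  abel

theorem norm_window_epsθ_le (hS : S.Standing) {s t : ℝ} (hs : s ∈ Icc 0 t)
    (he : ∀ τ ∈ Icc 0 t, ‖tr.e τ‖ ≤ S.ζ) :
    ‖∫ τ in (max 0 (s - S.Δt))..s, S.epsθ (tr.x τ)‖
      ≤ S.supBall (fun e => ‖S.epsθ (S.z e)‖) * S.Δt := by
  have hc : Continuous fun e => S.epsθ (S.z e) :=
    (hS.f_lip.continuous.comp S.continuous_z).sub
      ((continuous_tmul_right S.θ).comp (continuous_Yz hS))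
  refine (norm_window_le hS hs fun τ hτ => le_supBall (φ := fun e => ‖S.epsθ (S.z e)‖)
    hc.norm.continuousOn (he τ hτ)).trans ?_
  exact mul_le_mul_of_nonneg_left (min_le_right _ _) (supBall_nonneg fun _ => norm_nonneg _)

end Trajectory

end Setup


/-! ### Signs of the constants and the Lyapunov derivative -/

namespace Setup

variable {n m L p N M : ℕ} {O : Type*} {S : Setup n m L p N M O} {X : Excitation}

theorem φcθ_nonneg (hS : S.Standing) : 0 ≤ S.φcθ := by
  have h1 := S.supSmp_nonneg (φ := fun e y => ‖S.ΔF e y‖) fun _ _ => norm_nonneg _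
  have h2 := S.supSmp_nonneg (φ := fun _ y => ‖S.Y (S.z y)‖) fun _ _ => norm_nonneg _
  have h3 := S.supSmp_nonneg (φ := fun _ y => ‖S.g (S.z y) ∘L S.gd‖) fun _ _ => norm_nonneg _
  have h4 := hS.kc1_pos
  have h5 := hS.kc2_pos
  unfold φcθ κ
  positivity

theorem ΓLow_pos (hS : S.Standing) : 0 < S.ΓLow := by
  have h1 := hS.kc1_pos
  have h2 := hS.kc2_pos
  have h3 := hS.γ1_pos
  have h4 := hS.β_pos
  unfold ΓLow
  exact one_div_pos.2 (lt_max_of_lt_right (by positivity))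

theorem φac_nonneg (hS : S.Standing) : 0 ≤ S.φac := by
  have h1 := S.supSmp_nonneg (φ := fun e y => ‖S.Gσ e y‖ * ‖S.W e‖)
    fun _ _ => mul_nonneg (norm_nonneg _) (norm_nonneg _)
  have h2 := S.supBall_nonneg (φ := fun e => ‖S.dW e‖ * ‖S.GRσ e‖)
    fun _ => mul_nonneg (norm_nonneg _) (norm_nonneg _)
  have h3 := hS.ka1_pos
  have h4 := hS.kc1_pos
  have h5 := hS.kc2_pos
  have h6 := ΓLow_pos hS
  unfold φac κ
  positivity

namespace Trajectory

variable {tr : S.Trajectory}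

/-! ## The Lyapunov function along a trajectory -/

/-- The Lyapunov function along a trajectory. -/
noncomputable def lyap (tr : S.Trajectory) (t : ℝ) : ℝ :=
  S.VL (tr.Γ t) (tr.Γθ t) (tr.e t) (S.W (tr.e t) - tr.wc t) (S.W (tr.e t) - tr.wa t)
    (S.θ - tr.ϑ t)

/-- Critic and actor parts of the Lyapunov derivative, without the drift of the ideal weights. -/
theorem critic_actor_term_le (hS : S.Standing) (hX : X.Admissible) (h : tr.IsSolution)
    (hE : tr.Excited X) {t : ℝ} (ht : 0 ≤ t) (he : ‖tr.e t‖ ≤ S.ζ) :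
    -⟪S.W (tr.e t) - tr.wc t, (tr.Γ t).inverse (tr.wcRHS t)⟫
      + 1 / 2 * ⟪S.W (tr.e t) - tr.wc t,
          (tr.regressor t - S.β • (tr.Γ t).inverse) (S.W (tr.e t) - tr.wc t)⟫
      - ⟪S.W (tr.e t) - tr.wa t, tr.waRHS t⟫
    ≤ -(S.cLow X * S.kc2) * ‖S.W (tr.e t) - tr.wc t‖ ^ 2
      - (S.ka1 + S.ka2) * ‖S.W (tr.e t) - tr.wa t‖ ^ 2
      + S.ka1 * (‖S.W (tr.e t) - tr.wa t‖ * ‖S.W (tr.e t) - tr.wc t‖)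
      + S.ka2 * S.supBall (fun e => ‖S.W e‖) * ‖S.W (tr.e t) - tr.wa t‖
      + S.κ * S.sampleBound ‖S.W (tr.e t) - tr.wc t‖ ‖S.W (tr.e t) - tr.wa t‖
          ‖S.θ - tr.ϑ t‖ := by
  have hN : (0 : ℝ) < N := Nat.cast_pos.2 hS.N_pos
  have hi := (isGain_critic hS h).isInvertible ht
  have hkc1 := hS.kc1_pos
  have hkc2 := hS.kc2_pos
  have t0 := sample_term_le hS he (Metric.mem_closedBall_self hS.a_pos.le) (tr.wc t) (tr.wa t)
    (tr.ϑ t) hkc1.le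
  have ti := fun i => sample_term_le hS he (hS.smp_mem i (tr.e t) t ht) (tr.wc t) (tr.wa t)
    (tr.ϑ t) (div_pos hkc2 hN).le
  have tsum := Finset.sum_le_sum fun i (_ : i ∈ (Finset.univ : Finset (Fin N))) => ti i
  have hlow := le_critic_form hS hX h hE ht (S.W (tr.e t) - tr.wc t)
  have hc2 := loewner_inner (hE.2.1 t ht) (S.W (tr.e t) - tr.wc t)
  have hW : ‖S.W (tr.e t)‖ ≤ _ := le_supBall (φ := fun e => ‖S.W e‖)
    (continuousOn_ball_W hS).norm he
  change _ * tr.δ t / S.rho (tr.om t) ^ 2 * ⟪_, tr.om t⟫ + _ * ⟪_, S.Lam (tr.om t) _⟫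
    - _ * ⟪tr.om t, _⟫ / (4 * S.rho (tr.om t) ^ 2) * _
    ≤ - (_ / 2) * ⟪_, S.Lam (tr.om t) _⟫ + _ at t0
  change ∑ i, (_ * tr.δi i t / S.rho (tr.omi i t) ^ 2 * ⟪_, tr.omi i t⟫
    + _ * ⟪_, S.Lam (tr.omi i t) _⟫
    - _ * ⟪tr.omi i t, _⟫ / (4 * S.rho (tr.omi i t) ^ 2) * ⟪_, adjoint (S.Gσ (tr.e t) (tr.pt i t)) _⟫)
    ≤ ∑ i, (- (_ / 2) * ⟪_, S.Lam (tr.omi i t) _⟫ + _) at tsum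
  have hwa : tr.wa t = S.W (tr.e t) - (S.W (tr.e t) - tr.wa t) := by abel
  have hwac : tr.wa t - tr.wc t
      = (S.W (tr.e t) - tr.wc t) - (S.W (tr.e t) - tr.wa t) := by abel
  set c := S.W (tr.e t) - tr.wc t with hc
  set a := S.W (tr.e t) - tr.wa t with ha
  set d := S.θ - tr.ϑ t
  set κ₀ := 3 * √3 / (16 * √S.γ1) with hκ₀
  set SB := S.sampleBound ‖c‖ ‖a‖ ‖d‖
  have hκ : S.κ * SB = S.kc1 * κ₀ * SB + S.kc2 * κ₀ * SB := by
    rw [hκ₀, κ]; ring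
  have e1 : ⟪c, (tr.Γ t).inverse (tr.wcRHS t)⟫
      = -(S.kc1 * tr.δ t / S.rho (tr.om t) ^ 2 * ⟪c, tr.om t⟫)
        - ∑ i, S.kc2 / N * tr.δi i t / S.rho (tr.omi i t) ^ 2 * ⟪c, tr.omi i t⟫ := by
    rw [wcRHS]
    simp only [map_sub, map_neg, map_smul, hi.inverse_apply_self, inner_sub_right,
      inner_neg_right, inner_smul_right, inner_sum, Finset.mul_sum]
    congr 1
    exact Finset.sum_congr rfl fun i _ => by ring
  have e2 : ⟪c, (tr.regressor t - S.β • (tr.Γ t).inverse) c⟫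
      = S.kc1 * ⟪c, S.Lam (tr.om t) c⟫ + S.kc2 / N * ∑ i, ⟪c, S.Lam (tr.omi i t) c⟫
        - S.β * ⟪c, (tr.Γ t).inverse c⟫ := by
    rw [sub_apply, inner_sub_right, inner_regressor, smul_apply, inner_smul_right]
  have e3 : ⟪a, tr.waRHS t⟫ = -(S.ka1 * ⟪a, c⟫) + S.ka1 * ‖a‖ ^ 2
      - S.ka2 * ⟪a, S.W (tr.e t)⟫ + S.ka2 * ‖a‖ ^ 2
      + S.kc1 * ⟪tr.om t, tr.wc t⟫ / (4 * S.rho (tr.om t) ^ 2)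
        * ⟪a, adjoint (S.Gσ (tr.e t) (tr.e t)) (tr.wa t)⟫
      + ∑ i, S.kc2 / N * ⟪tr.omi i t, tr.wc t⟫ / (4 * S.rho (tr.omi i t) ^ 2)
        * ⟪a, adjoint (S.Gσ (tr.e t) (tr.pt i t)) (tr.wa t)⟫ := by
    have hs : ∀ i, S.kc2 * ⟪tr.omi i t, tr.wc t⟫ / (4 * N * S.rho (tr.omi i t) ^ 2)
        = S.kc2 / N * ⟪tr.omi i t, tr.wc t⟫ / (4 * S.rho (tr.omi i t) ^ 2) := fun i => by
      have := (rho_pos hS (tr.omi i t)).ne'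
      field_simp
    have e4 : ⟪a, tr.wa t - tr.wc t⟫ = ⟪a, c⟫ - ‖a‖ ^ 2 := by
      rw [hwac, inner_sub_right, real_inner_self_eq_norm_sq]
    have e5 : ⟪a, tr.wa t⟫ = ⟪a, S.W (tr.e t)⟫ - ‖a‖ ^ 2 := by
      conv_lhs => rw [hwa, inner_sub_right, real_inner_self_eq_norm_sq]
    rw [waRHS]
    simp only [inner_add_right, inner_sub_right, inner_neg_right, inner_smul_right, inner_sum, hs]
      at e4 ⊢
    rw [e5] at e4 ⊢
    linear_combination (-S.ka1) * e4
  have b1 := real_inner_le_norm a c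
  have b2 : ⟪a, S.W (tr.e t)⟫ ≤ ‖a‖ * S.supBall (fun e => ‖S.W e‖) :=
    (real_inner_le_norm _ _).trans (mul_le_mul_of_nonneg_left hW (norm_nonneg a))
  have b1' := mul_le_mul_of_nonneg_left b1 hS.ka1_pos.le
  have b2' := mul_le_mul_of_nonneg_left b2 hS.ka2_pos.le
  have b3 := mul_le_mul_of_nonneg_left hlow (half_pos hS.β_pos).le
  have b4 : X.c2 * ‖c‖ ^ 2 ≤ 1 / N * ∑ i, ⟪c, S.Lam (tr.omi i t) c⟫ := by
    rw [inner_smul_one] at hc2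
    simpa only [smul_apply, sum_apply, inner_smul_right, inner_sum] using hc2
  have b4' := mul_le_mul_of_nonneg_left b4 (half_pos hkc2).le
  -- The on-trajectory damping `Λ` is merely discarded. The coefficient `c̲` comes from the sampled
  -- points (`b4'`) and from forgetting (`b3`).
  have b5 := mul_nonneg (half_pos hkc1).le (S.inner_Lam_nonneg (tr.om t) c)
  have hcLow : S.cLow X * S.kc2 = S.kc2 * X.c2 / 2 + S.β / 2 * (Real.exp (-S.β * X.T) *
      min (S.kc1 * X.c3 + S.kc2 * max X.c1 (X.c2 * X.T)) (lamMin S.Γ0.inverse)) := by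
    rw [cLow, ΓUp]
    field_simp
  have e6 : ∑ i : Fin N, (-(S.kc2 / N / 2) * ⟪c, S.Lam (tr.omi i t) c⟫ + S.kc2 / N * κ₀ * SB)
      = -(S.kc2 / 2) * (1 / N * ∑ i, ⟪c, S.Lam (tr.omi i t) c⟫) + S.kc2 * κ₀ * SB := by
    rw [Finset.sum_add_distrib, ← Finset.mul_sum, Finset.sum_const, Finset.card_univ,
      Fintype.card_fin, nsmul_eq_mul]
    field_simp
  rw [e6] at tsum
  have e7 : S.kc2 / N / 2 * ∑ i, ⟪c, S.Lam (tr.omi i t) c⟫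
      = S.kc2 / 2 * (1 / N * ∑ i, ⟪c, S.Lam (tr.omi i t) c⟫) := by ring
  have e8 : S.kc2 / N * ∑ i, ⟪c, S.Lam (tr.omi i t) c⟫
      = S.kc2 * (1 / N * ∑ i, ⟪c, S.Lam (tr.omi i t) c⟫) := by ring
  rw [Finset.sum_sub_distrib, Finset.sum_add_distrib, ← Finset.mul_sum, e7] at tsum
  rw [e1, e2, e3, hcLow, hκ, e8]
  linarith

/-- The composite Lyapunov function decreases where the composite error is large. -/
theorem exists_lyap_deriv (hS : S.Standing) (hX : X.Admissible) {ψ vl vlo vup : ℝ → ℝ}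
    (hK : S.ClassKBounds X ψ vl vlo vup) (hgain : S.GainConditions X vl vlo vup)
    (h : tr.IsSolution) (hR : tr.RichStack X) (hE : tr.Excited X) {t : ℝ} (ht : 0 ≤ t)
    (he : ∀ τ ∈ Icc 0 t, ‖tr.e τ‖ ≤ S.ζ) :
    ∃ v, HasDerivWithinAt tr.lyap v (Ici t) t ∧ v ≤ S.ι X - vl (tr.errNorm t) := by
  have het := he t ⟨ht, le_rfl⟩
  have hΩ := mem_Ω hS het
  have hχ := mem_χ hS het
  have hgc := isGain_critic hS h
  have hgi := isGain_ident hS h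
  have de : HasDerivWithinAt tr.e (S.F (tr.e t) + S.G (tr.e t) (S.muhat (tr.e t) (tr.e t)
    (tr.wa t))) (Ici t) t := h.e_sol.2 t ht
  set vel := S.F (tr.e t) + S.G (tr.e t) (S.muhat (tr.e t) (tr.e t) (tr.wa t)) with hvel
  have dV : HasDerivWithinAt (fun τ => S.V (tr.e τ)) ⟪gradient S.V (tr.e t), vel⟫ (Ici t) t :=
    (hasGradientAt_iff_hasFDerivAt.1 (hasGradientAt_V hS hΩ)).comp_hasDerivWithinAt t de
  have dWe : HasDerivWithinAt (fun τ => S.W (tr.e τ)) (S.dW (tr.e t) vel) (Ici t) t :=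
    (hasFDerivAt_W hS hΩ).comp_hasDerivWithinAt t de
  have dwc : HasDerivWithinAt (fun τ => S.W (tr.e τ) - tr.wc τ)
      (S.dW (tr.e t) vel - tr.wcRHS t) (Ici t) t := dWe.sub (h.wc_sol.2 t ht)
  have dwa : HasDerivWithinAt (fun τ => S.W (tr.e τ) - tr.wa τ)
      (S.dW (tr.e t) vel - tr.waRHS t) (Ici t) t := dWe.sub (h.wa_sol.2 t ht)
  have dϑ : HasDerivWithinAt (fun τ => S.θ - tr.ϑ τ) (-tr.ϑRHS t) (Ici t) t :=
    (h.ϑ_sol.2 t ht).const_sub S.θ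
  have dc := hasDerivWithinAt_inner_apply (P := fun τ => (tr.Γ τ).inverse) (hgc.isSelfAdjoint_inverse ht)
    (hgc.hasDerivWithinAt_inverse ht) dwc
  have da := dwa.norm_sq
  have dd := hasDerivWithinAt_inner_lmul (P := fun τ => (tr.Γθ τ).inverse) (hgi.isSelfAdjoint_inverse ht)
    (hgi.hasDerivWithinAt_inverse ht) dϑ
  have hd := ((dV.fun_add (dc.const_mul (1 / 2 : ℝ))).fun_add
    (da.const_mul (1 / 2 : ℝ))).fun_add dd
  have hlyap : tr.lyap = fun τ => S.V (tr.e τ)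
      + 1 / 2 * ⟪S.W (tr.e τ) - tr.wc τ, (tr.Γ τ).inverse (S.W (tr.e τ) - tr.wc τ)⟫
      + 1 / 2 * ‖S.W (tr.e τ) - tr.wa τ‖ ^ 2
      + ⟪S.θ - tr.ϑ τ, lmul (tr.Γθ τ).inverse (S.θ - tr.ϑ τ)⟫ := rfl
  rw [hlyap]
  refine ⟨_, hd, ?_⟩
  have b1 := value_term_le hS het (tr.wa t)
  have b2 := critic_actor_term_le hS hX h hE ht het
  have b3 := inner_dW_velocity_le hS het (tr.wa t)
  have b4 := norm_dW_velocity_le hS het (tr.wa t)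
  rw [← hvel] at b1 b3 b4
  -- The ideal weights move with `e`. Their drift meets the critic error through `Γ⁻¹`, of norm at
  -- most `1 / ΓLow`.
  have b5 := inner_apply_le_of_form_le (hgc.isSelfAdjoint_inverse ht)
    (critic_form_nonneg hS h ht) (critic_form_le hS h ht) (S.W (tr.e t) - tr.wc t)
    (S.dW (tr.e t) vel)
  have hlo : max (lamMax S.Γ0.inverse) ((S.kc1 + S.kc2) / (4 * S.γ1 * S.β)) = 1 / S.ΓLow := by
    rw [ΓLow, one_div_one_div]
  rw [hlo] at b5
  have b6 := b5.trans (mul_le_mul_of_nonneg_left b4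
    (mul_nonneg (one_div_pos.2 (ΓLow_pos hS)).le (norm_nonneg (S.W (tr.e t) - tr.wc t))))
  have hD : 2 * S.kθ * M * ((S.supBall (fun e => ‖S.Y (S.z e)‖) * S.Δt)
      * (S.supBall (fun e => ‖S.epsθ (S.z e)‖) * S.Δt)) ≤ S.Dθ := by
    rw [Dθ]; exact le_of_eq (by ring)
  have hΓθpos : ∀ v, 0 ≤ ⟪v, tr.Γθ t v⟫ := fun v => by
    have := ident_form_nonneg hS h ht (tr.Γθ t v)
    rwa [(hgi.isInvertible ht).inverse_apply_self, real_inner_comm] at this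
  have b7 := ident_term_le (P := (tr.Γθ t).inverse) (Γ := tr.Γθ t) (θ := S.θ) (ϑ := tr.ϑ t)
    hS.ϱ_pos hS.kθ_pos.le hS.βθ_pos.le hS.θ_bound (hgi.isInvertible ht).inverse_comp_self
    hΓθpos (le_ident_form hS hX h hR ht)
    (fun i => norm_intY_le hS ⟨(h.stamp_mem i t ht).1, (h.stamp_mem i t ht).2⟩ he)
    (fun i => norm_window_epsθ_le hS ⟨(h.stamp_mem i t ht).1, (h.stamp_mem i t ht).2⟩ he)
    (stackErr_eq hS h ht he) hD
  have hKθ : S.βθ * min (Real.exp (-S.βθ * X.Tθ) * lamMin S.Γθ0.inverse)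
      (S.kθ * X.lamθ / S.βθ) = S.Kθ X := by
    rw [Kθ, ΓθUp, div_div_eq_mul_div, div_one]
  rw [hKθ] at b7
  have hvl := hK.vl_le (tr.e t) hχ (S.W (tr.e t) - tr.wc t) (S.W (tr.e t) - tr.wa t)
    (S.θ - tr.ϑ t)
  have hψ := hK.ψ_le (tr.e t) hχ
  -- Only half of `ψ` is needed for `v_l`; the other half is dropped by sign.
  have hψ0 : 0 ≤ ψ ‖tr.e t‖ := by
    have := hK.ψ_K.2.1.monotoneOn (mem_Ici.2 (le_refl (0 : ℝ))) (norm_nonneg (tr.e t))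
      (norm_nonneg (tr.e t))
    rwa [hK.ψ_K.2.2] at this
  have hcrit : S.φcθ + S.φac < S.cLow X * S.kc2 := by
    have := hgain.critic
    rwa [div_lt_iff₀ hS.kc2_pos] at this
  have hy := young_combination (c := ‖S.W (tr.e t) - tr.wc t‖) (a := ‖S.W (tr.e t) - tr.wa t‖)
    (d := ‖S.θ - tr.ϑ t‖) (ιc := S.ιc) (ιa := S.ιa) (D := S.Dθ) (φcθ_nonneg hS) (φac_nonneg hS)
    hcrit hgain.actor (add_pos hS.ka1_pos hS.ka2_pos) hgain.ident
  have herr : tr.errNorm t = normZ (tr.e t) (S.W (tr.e t) - tr.wc t)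
    (S.W (tr.e t) - tr.wa t) (S.θ - tr.ϑ t) := rfl
  rw [← herr] at hvl
  have hmap : ⟪S.W (tr.e t) - tr.wc t, (tr.Γ t).inverse (S.dW (tr.e t) vel - tr.wcRHS t)⟫
      = ⟪S.W (tr.e t) - tr.wc t, (tr.Γ t).inverse (S.dW (tr.e t) vel)⟫
        - ⟪S.W (tr.e t) - tr.wc t, (tr.Γ t).inverse (tr.wcRHS t)⟫ := by
    rw [map_sub, inner_sub_right]
  have hma : ⟪S.W (tr.e t) - tr.wa t, S.dW (tr.e t) vel - tr.waRHS t⟫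
      = ⟪S.W (tr.e t) - tr.wa t, S.dW (tr.e t) vel⟫ - ⟪S.W (tr.e t) - tr.wa t, tr.waRHS t⟫ :=
    inner_sub_right _ _ _
  change _ + 1 / 2 * (2 * ⟪S.W (tr.e t) - tr.wc t,
      (tr.Γ t).inverse (S.dW (tr.e t) vel - tr.wcRHS t)⟫ + ⟪S.W (tr.e t) - tr.wc t,
        (tr.regressor t - S.β • (tr.Γ t).inverse) (S.W (tr.e t) - tr.wc t)⟫)
    + 1 / 2 * (2 * ⟪S.W (tr.e t) - tr.wa t, S.dW (tr.e t) vel - tr.waRHS t⟫)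
    + (2 * ⟪S.θ - tr.ϑ t, lmul (tr.Γθ t).inverse (-tr.ϑRHS t)⟫ + ⟪S.θ - tr.ϑ t,
        lmul (S.kθ • tr.stackMat t - S.βθ • (tr.Γθ t).inverse) (S.θ - tr.ϑ t)⟫) ≤ _
  change 2 * ⟪S.θ - tr.ϑ t, lmul (tr.Γθ t).inverse (-tr.ϑRHS t)⟫ + ⟪S.θ - tr.ϑ t,
        lmul (S.kθ • tr.stackMat t - S.βθ • (tr.Γθ t).inverse) (S.θ - tr.ϑ t)⟫ ≤ _ at b7
  rw [hmap, hma]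
  unfold sampleBound at b2
  simp only [ι, φa, φac, φcθ, ιc, ιa] at hy ⊢
  generalize ‖S.W (tr.e t) - tr.wc t‖ = c at *
  generalize ‖S.W (tr.e t) - tr.wa t‖ = a at *
  generalize ‖S.θ - tr.ϑ t‖ = d at *
  linear_combination b1 + b2 + b3 + b6 + b7 + hvl + hψ + (1 / 2) * hψ0 + hy

end Trajectory

end Setup


/-! ## Class K functions -/

namespace IsClassK

variable {α : ℝ → ℝ} (hα : IsClassK α)

include hα

theorem nonneg {x : ℝ} (hx : 0 ≤ x) : 0 ≤ α x := by
  have := hα.2.1.monotoneOn (mem_Ici.2 (le_refl (0 : ℝ))) hx hx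
  rwa [hα.2.2] at this

theorem lt_iff {x y : ℝ} (hx : 0 ≤ x) (hy : 0 ≤ y) : α x < α y ↔ x < y :=
  hα.2.1.lt_iff_lt hx hy

theorem le_iff {x y : ℝ} (hx : 0 ≤ x) (hy : 0 ≤ y) : α x ≤ α y ↔ x ≤ y :=
  hα.2.1.le_iff_le hx hy

theorem mem_range {x y : ℝ} (hx : 0 ≤ x) (hy : 0 ≤ y) (hyx : y ≤ α x) : y ∈ α '' Ici 0 := by
  obtain ⟨u, hu, hue⟩ := intermediate_value_Icc hx (hα.1.mono fun u hu => hu.1)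
    (show y ∈ Icc (α 0) (α x) from ⟨by rwa [hα.2.2], hyx⟩)
  exact ⟨u, hu.1, hue⟩

end IsClassK

theorem invK_nonneg {α : ℝ → ℝ} {y : ℝ} (h : y ∈ α '' Ici 0) : 0 ≤ invK α y :=
  Function.invFunOn_mem h

theorem apply_invK {α : ℝ → ℝ} {y : ℝ} (h : y ∈ α '' Ici 0) : α (invK α y) = y :=
  Function.invFunOn_eq h

theorem le_of_continuousOn_of_le_Ico {φ : ℝ → ℝ} {a b c : ℝ} (hab : a < b)
    (hφ : ContinuousOn φ (Icc a b)) (h : ∀ t ∈ Ico a b, φ t ≤ c) : φ b ≤ c := by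
  have hmem : b ∈ closure (Ico a b) := by
    rw [closure_Ico hab.ne]; exact right_mem_Icc.2 hab.le
  exact ((hφ b (right_mem_Icc.2 hab.le)).mono Ico_subset_Icc_self).closure_le hmem
    continuousWithinAt_const h

/-! ### Invariance of the ball and ultimate boundedness -/

namespace Setup

variable {n m L p N M : ℕ} {O : Type*} {S : Setup n m L p N M O} {X : Excitation}
  {ψ vl vlo vup : ℝ → ℝ}

theorem normZ_nonneg (e : E n) (wc wa : E L) (ϑ : WMat p n) : 0 ≤ normZ e wc wa ϑ :=
  Real.sqrt_nonneg _

theorem norm_le_normZ (e : E n) (wc wa : E L) (ϑ : WMat p n) : ‖e‖ ≤ normZ e wc wa ϑ := by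
  refine Real.le_sqrt_of_sq_le ?_
  nlinarith [sq_nonneg ‖wc‖, sq_nonneg ‖wa‖, sq_nonneg ‖ϑ‖]

namespace Trajectory

variable {tr : S.Trajectory}

theorem errNorm_nonneg (t : ℝ) : 0 ≤ tr.errNorm t := normZ_nonneg _ _ _ _

theorem norm_e_le_errNorm (t : ℝ) : ‖tr.e t‖ ≤ tr.errNorm t := norm_le_normZ _ _ _ _

theorem continuousWithinAt_errNorm (hS : S.Standing) (h : tr.IsSolution) {t : ℝ} (ht : 0 ≤ t)
    (he : ‖tr.e t‖ ≤ S.ζ) : ContinuousWithinAt tr.errNorm (Ici 0) t := by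
  have c1 := h.e_sol.1 t ht
  have c2 := (hasFDerivAt_W hS (mem_Ω hS he)).continuousAt.comp_continuousWithinAt c1
  have c3 := c2.sub (h.wc_sol.1 t ht)
  have c4 := c2.sub (h.wa_sol.1 t ht)
  have c5 : ContinuousWithinAt (fun t => S.θ - tr.ϑ t) (Ici 0) t :=
    continuousWithinAt_const.sub (h.ϑ_sol.1 t ht)
  exact ((((c1.norm.pow 2).add (c3.norm.pow 2)).add (c4.norm.pow 2)).add (c5.norm.pow 2)).sqrt

theorem continuousWithinAt_lyap (hS : S.Standing) (h : tr.IsSolution) {t : ℝ} (ht : 0 ≤ t)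
    (he : ‖tr.e t‖ ≤ S.ζ) : ContinuousWithinAt tr.lyap (Ici 0) t := by
  have c1 := h.e_sol.1 t ht
  have c2 := (hasFDerivAt_W hS (mem_Ω hS he)).continuousAt.comp_continuousWithinAt c1
  have cV := (hS.V_smooth.continuousOn.continuousAt
    (hS.Ω_open.mem_nhds (mem_Ω hS he))).comp_continuousWithinAt c1
  have c3 := c2.sub (h.wc_sol.1 t ht)
  have c4 := c2.sub (h.wa_sol.1 t ht)
  have c5 : ContinuousWithinAt (fun t => S.θ - tr.ϑ t) (Ici 0) t :=
    continuousWithinAt_const.sub (h.ϑ_sol.1 t ht)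
  have c6 := (isGain_critic hS h).continuousOn_inverse t ht
  have c7 := (isGain_ident hS h).continuousOn_inverse t ht
  have c8 : ContinuousWithinAt (fun t => ⟪S.θ - tr.ϑ t, lmul (tr.Γθ t).inverse (S.θ - tr.ϑ t)⟫)
      (Ici 0) t := by
    simp only [inner_eq_sum_col, col_lmul]
    refine tendsto_finsetSum _ fun i _ => ?_
    have c9 := (col i).continuous.continuousAt.comp_continuousWithinAt c5
    exact c9.inner (c7.clm_apply c9)
  exact ((cV.add (continuousWithinAt_const.mul (c3.inner (c6.clm_apply c3)))).add
    (continuousWithinAt_const.mul (c4.norm.pow 2))).add c8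

theorem lyap_bounds (hS : S.Standing) (hX : X.Admissible) (hK : S.ClassKBounds X ψ vl vlo vup)
    (h : tr.IsSolution) (hR : tr.RichStack X) (hE : tr.Excited X) {t : ℝ} (ht : 0 ≤ t)
    (he : tr.e t ∈ S.χ)
    (hup : ∀ v : E p, ⟪v, (tr.Γθ t).inverse v⟫ ≤ identUpper S * ‖v‖ ^ 2) :
    vlo (tr.errNorm t) ≤ tr.lyap t ∧ tr.lyap t ≤ vup (tr.errNorm t) := by
  obtain ⟨h1, h2⟩ := critic_loewner hS hX h hE ht
  obtain ⟨h3, h4⟩ := ident_loewner hS hX h hR ht hup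
  exact hK.VL_bounds _ _ h1 h2 h3 h4 _ he _ _ _

/-- Decay of the Lyapunov function down to the level `v̄(r)`, for `r > v_l⁻¹(ι)`. -/
theorem lyap_decay (hS : S.Standing) (hX : X.Admissible) (hK : S.ClassKBounds X ψ vl vlo vup)
    (hgain : S.GainConditions X vl vlo vup)
    (h : tr.IsSolution) (hR : tr.RichStack X) (hE : tr.Excited X) {T r : ℝ} (hT : 0 ≤ T)
    (he : ∀ t ∈ Icc 0 T, ‖tr.e t‖ ≤ S.ζ) (hr0 : 0 ≤ r) (hr : S.ι X < vl r) :
    tr.lyap T ≤ max (vup r) (tr.lyap 0 - (vl r - S.ι X) * T) := by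
  have hder : ∀ t, ∃ v, t ∈ Icc 0 T →
      HasDerivWithinAt tr.lyap v (Ici t) t ∧ v ≤ S.ι X - vl (tr.errNorm t) := by
    intro t
    by_cases ht : t ∈ Icc 0 T
    · obtain ⟨v, hv⟩ := exists_lyap_deriv hS hX hK hgain h hR hE ht.1
        fun τ hτ => he τ ⟨hτ.1, hτ.2.trans ht.2⟩
      exact ⟨v, fun _ => hv⟩
    · exact ⟨0, fun h => absurd h ht⟩
  choose v hv using hder
  have := le_max_of_right_deriv_le (φ := tr.lyap) (φ' := v) (m := vup r) (c := vl r - S.ι X)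
    (by linarith) hT
    (fun t ht => (continuousWithinAt_lyap hS h ht.1 (he t ht)).mono fun x hx => hx.1)
    (fun t ht => (hv t (Ico_subset_Icc_self ht)).1) fun t ht hm => ?_
  · rwa [sub_zero] at this
  -- Where the function is at least `v̄(r)`, the error norm is at least `r`, so the derivative is at
  -- most `ι - v_l(r) < 0`.
  · have h1 := (hv t (Ico_subset_Icc_self ht)).2
    have h2 := (lyap_bounds hS hX hK h hR hE ht.1 (mem_χ hS (he t (Ico_subset_Icc_self ht)))
      (ident_form_le_of_mem_ball hS h ht.1
        fun τ hτ => he τ ⟨hτ.1, hτ.2.trans ht.2.le⟩)).2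
    have h3 := (hK.vup_K.le_iff hr0 (errNorm_nonneg t)).1 (hm.trans h2)
    have h4 := (hK.vl_K.le_iff hr0 (errNorm_nonneg t)).2 h3
    linarith

/-- The ordering `hζ` puts `v̲(ζ)` in the range of `v̄`, which makes `invK` a genuine preimage
there. -/
theorem region_facts (hS : S.Standing) (hK : S.ClassKBounds X ψ vl vlo vup)
    (hgain : S.GainConditions X vl vlo vup) (hζ : vlo S.ζ ≤ vup S.ζ) :
    vup (invK vup (vlo S.ζ)) = vlo S.ζ ∧ invK vup (vlo S.ζ) ≤ S.ζ ∧
      0 ≤ invK vl (S.ι X) ∧ vl (invK vl (S.ι X)) = S.ι X ∧ vup (invK vl (S.ι X)) < vlo S.ζ := by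
  have hζ0 := hS.ζ_pos.le
  have hmem := hK.vup_K.mem_range hζ0 (hK.vlo_K.nonneg hζ0) hζ
  have h1 := apply_invK hmem
  have h0 := invK_nonneg hmem
  have h2 := invK_nonneg hgain.ι_mem
  refine ⟨h1, ?_, h2, apply_invK hgain.ι_mem, ?_⟩
  · exact (hK.vup_K.le_iff h0 hζ0).1 (h1.trans_le hζ)
  · have := (hK.vup_K.lt_iff h2 h0).2 hgain.region
    rwa [h1] at this

/-- The composite error does not leave the ball of radius `ζ`. -/
theorem errNorm_le (hS : S.Standing) (hX : X.Admissible) (hK : S.ClassKBounds X ψ vl vlo vup)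
    (hgain : S.GainConditions X vl vlo vup) (hζ : vlo S.ζ ≤ vup S.ζ)
    (htr : tr.Covered X vlo vup) {t : ℝ} (ht : 0 ≤ t) : tr.errNorm t ≤ S.ζ := by
  obtain ⟨h, hR, hE, hinit⟩ := htr
  have hζ0 := hS.ζ_pos.le
  obtain ⟨hR0, hR0ζ, hs0, hs, -⟩ := region_facts hS hK hgain hζ
  have hreg := hgain.region
  set R₀ := invK vup (vlo S.ζ)
  set s := invK vl (S.ι X)
  by_contra hcon
  push Not at hcon
  set bad : Set ℝ := {t | 0 ≤ t ∧ S.ζ < tr.errNorm t} with hbad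
  have hne : bad.Nonempty := ⟨t, ht, hcon⟩
  have hbdd : BddBelow bad := ⟨0, fun t ht => ht.1⟩
  -- The first exit time. Bad times accumulate at `T` from the right, so it is enough to exclude
  -- them from a right neighbourhood of `T`.
  set T := sInf bad with hT
  have hglb : IsGLB bad T := isGLB_csInf hne hbdd
  have hT0 : 0 ≤ T := le_csInf hne fun t ht => ht.1
  have hlt : ∀ τ ∈ Ico 0 T, tr.errNorm τ ≤ S.ζ := fun τ hτ => by
    by_contra hc
    push Not at hc
    exact absurd (csInf_le hbdd (show τ ∈ bad from ⟨hτ.1, hc⟩)) (not_le.2 hτ.2)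
  have h0 : tr.errNorm 0 ≤ S.ζ := hinit.trans hR0ζ
  have hI : ∀ τ ∈ Icc 0 T, tr.errNorm τ ≤ S.ζ := by
    rcases hT0.eq_or_lt with h1 | h1
    · intro τ hτ
      rw [← h1] at hτ
      rw [le_antisymm hτ.2 hτ.1]
      exact h0
    · have hlte : ∀ τ ∈ Ico 0 T, ‖tr.e τ‖ ≤ S.ζ := fun τ hτ =>
        (norm_e_le_errNorm τ).trans (hlt τ hτ)
      -- The bound on `e` has to come first: the error norm is continuous only where `W` is, which
      -- requires `e T` to be in the ball.
      have heT : ‖tr.e T‖ ≤ S.ζ := le_of_continuousOn_of_le_Ico h1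
        (h.e_sol.1.mono fun x hx => hx.1).norm hlte
      have hIe : ∀ τ ∈ Icc 0 T, ‖tr.e τ‖ ≤ S.ζ := fun τ hτ => by
        rcases hτ.2.eq_or_lt with h2 | h2
        · rw [h2]; exact heT
        · exact hlte τ ⟨hτ.1, h2⟩
      have hTT := le_of_continuousOn_of_le_Ico h1 (fun τ hτ =>
        (continuousWithinAt_errNorm hS h hτ.1 (hIe τ hτ)).mono fun x hx => hx.1) hlt
      intro τ hτ
      rcases hτ.2.eq_or_lt with h2 | h2
      · rw [h2]; exact hTT
      · exact hlt τ ⟨hτ.1, h2⟩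
  have hIe : ∀ τ ∈ Icc 0 T, ‖tr.e τ‖ ≤ S.ζ := fun τ hτ => (norm_e_le_errNorm τ).trans (hI τ hτ)
  have hfreq : ∃ᶠ τ in 𝓝[≥] T, τ ∈ bad := hglb.frequently_mem hne
  refine hfreq ?_
  have hTm : T ∈ Icc 0 T := ⟨hT0, le_rfl⟩
  have of_lt : tr.errNorm T < S.ζ → ∀ᶠ τ in 𝓝[≥] T, τ ∉ bad := by
    intro hl
    have hc := (continuousWithinAt_errNorm hS h hT0 (hIe T hTm)).mono (Ici_subset_Ici.2 hT0)
    filter_upwards [hc.eventually_lt_const hl] with τ hτ hb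
    exact absurd hb.2 (not_lt.2 hτ.le)
  have hlyap0 : tr.lyap 0 ≤ vlo S.ζ := by
    have h00 : ∀ τ ∈ Icc (0 : ℝ) 0, ‖tr.e τ‖ ≤ S.ζ := fun τ hτ => by
      rw [le_antisymm hτ.2 hτ.1]
      exact (norm_e_le_errNorm 0).trans h0
    have h1 := (lyap_bounds hS hX hK h hR hE le_rfl (mem_χ hS (h00 0 ⟨le_rfl, le_rfl⟩))
      (ident_form_le_of_mem_ball hS h le_rfl h00)).2
    refine h1.trans ?_
    rw [← hR0]
    exact (hK.vup_K.le_iff (errNorm_nonneg 0) ((errNorm_nonneg 0).trans hinit)).2 hinit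
  rcases hT0.eq_or_lt with h1 | h1
  -- The delicate case is an exit at time `0` from norm exactly `ζ`. The derivative of the Lyapunov
  -- function is negative there, so its value drops at once. Its lower bound remains usable just
  -- outside the ball, since `e` stays within `a` of `e(0)`, hence in `χ`, and the early bound holds
  -- for the identification gain.
  · rcases h0.eq_or_lt with h2 | h2
    · obtain ⟨v, hv, hvle⟩ := exists_lyap_deriv hS hX hK hgain h hR hE hT0 hIe
      rw [← h1] at hv hvle ⊢
      have hvneg : v < 0 := by
        have := (hK.vl_K.lt_iff hs0 hζ0).2 (hreg.trans_le hR0ζ)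
        rw [h2] at hvle
        linarith
      have ev1 := hv.limsup_slope_le hvneg
      rw [Ici_sdiff_left] at ev1
      have hec : ContinuousWithinAt tr.e (Ioi 0) 0 :=
        (h.e_sol.1 0 (mem_Ici.2 le_rfl)).mono Ioi_subset_Ici_self
      have ev2 := hec.eventually (Metric.closedBall_mem_nhds (tr.e 0) hS.a_pos)
      obtain ⟨t₀, ht₀, hearly⟩ := exists_ident_form_le_early hS
        (nontrivial_of_richStack hX hR) h
      have ev3 : ∀ᶠ τ in 𝓝[>] (0 : ℝ), τ ∈ Ioo 0 t₀ := Ioo_mem_nhdsGT ht₀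
      have ev : ∀ᶠ τ in 𝓝[>] (0 : ℝ), τ ∉ bad := by
        filter_upwards [ev1, ev2, ev3] with τ h3 h4 h5 hb
        have h6 := (lyap_bounds hS hX hK h hR hE h5.1.le
          (hS.ball_sub _ (hIe 0 ⟨le_rfl, hT0⟩) h4) (hearly τ ⟨h5.1.le, h5.2.le⟩)).1
        rw [slope_def_field, sub_zero, div_neg_iff] at h3
        have h7 : tr.lyap τ < tr.lyap 0 := by
          rcases h3 with h3 | h3
          · exact absurd h5.1 (not_lt.2 h3.2.le)
          · linarith [h3.1]
        have h8 := (hK.vlo_K.lt_iff (errNorm_nonneg τ) hζ0).1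
          (h6.trans_lt (h7.trans_le hlyap0))
        exact absurd hb.2 (not_lt.2 h8.le)
      rw [← Ioi_insert, nhdsWithin_insert, eventually_sup]
      exact ⟨by simpa [hbad] using h0, ev⟩
    · exact of_lt (by rwa [← h1])
  · refine of_lt ?_
    -- At a positive exit time, decay toward the midpoint level puts the function strictly below
    -- `v̲(ζ)`, so the norm at `T` is strictly less than `ζ`.
    have hr : s < (s + R₀) / 2 := by linarith
    have hr' : (s + R₀) / 2 < R₀ := by linarith
    have hr0 : 0 ≤ (s + R₀) / 2 := by linarith
    have hvl := (hK.vl_K.lt_iff hs0 hr0).2 hr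
    rw [hs] at hvl
    have hvup := (hK.vup_K.lt_iff hr0 (hr0.trans hr'.le)).2 hr'
    rw [hR0] at hvup
    have hdec := lyap_decay hS hX hK hgain h hR hE hT0 hIe hr0 hvl
    have hlow := (lyap_bounds hS hX hK h hR hE hT0 (mem_χ hS (hIe T hTm))
      (ident_form_le_of_mem_ball hS h hT0 hIe)).1
    refine (hK.vlo_K.lt_iff (errNorm_nonneg T) hζ0).1 (hlow.trans_lt (hdec.trans_lt ?_))
    refine max_lt hvup ?_
    have := mul_pos (sub_pos.2 hvl) h1
    linarith

/-- Uniform ultimate boundedness. -/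
theorem exists_uniform_time (hS : S.Standing) (hX : X.Admissible)
    (hK : S.ClassKBounds X ψ vl vlo vup) (hgain : S.GainConditions X vl vlo vup)
    (hζ : vlo S.ζ ≤ vup S.ζ) {η : ℝ} (hη : 0 < η) :
    ∃ τ : ℝ, ∀ tr : S.Trajectory, tr.Covered X vlo vup →
      ∀ t, 0 ≤ t → τ ≤ t → tr.errNorm t ≤ S.ultBound X vl vlo vup + η := by
  have hζ0 := hS.ζ_pos.le
  obtain ⟨hR0, hR0ζ, hs0, hs, hvs⟩ := region_facts hS hK hgain hζ
  unfold ultBound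
  set R₀ := invK vup (vlo S.ζ)
  set s := invK vl (S.ι X)
  have hmem := hK.vlo_K.mem_range hζ0 (hK.vup_K.nonneg hs0) hvs.le
  have hb0 := invK_nonneg hmem
  have hb := apply_invK hmem
  set b := invK vlo (vup s)
  have hbη : vup s < vlo (b + η) := by
    conv_lhs => rw [← hb]
    exact (hK.vlo_K.lt_iff hb0 (by linarith)).2 (by linarith)
  -- A radius slightly above `v_l⁻¹(ι)`: the decay rate becomes positive, while continuity of `v̄`
  -- keeps the level below `v̲(b + η)`.
  obtain ⟨r, hrlt, hsr⟩ : ∃ r, vup r < vlo (b + η) ∧ r ∈ Ioi s := by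
    have hc : ContinuousWithinAt vup (Ioi s) s :=
      (hK.vup_K.1 s hs0).mono fun x hx => hs0.trans (le_of_lt hx)
    exact ((hc.eventually_lt_const hbη).and self_mem_nhdsWithin).exists
  have hr0 : 0 ≤ r := hs0.trans (le_of_lt hsr)
  have hvl := (hK.vl_K.lt_iff hs0 hr0).2 hsr
  rw [hs] at hvl
  -- Initial level over decay rate: both are common to all covered trajectories.
  refine ⟨vlo S.ζ / (vl r - S.ι X), fun tr htr t ht hτ => ?_⟩
  have hball : ∀ τ ∈ Icc 0 t, ‖tr.e τ‖ ≤ S.ζ := fun τ hτ =>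
    (norm_e_le_errNorm τ).trans (errNorm_le hS hX hK hgain hζ htr hτ.1)
  obtain ⟨h, hR, hE, hinit⟩ := htr
  have hdec := lyap_decay hS hX hK hgain h hR hE ht hball hr0 hvl
  have h00 : ∀ τ ∈ Icc (0 : ℝ) 0, ‖tr.e τ‖ ≤ S.ζ := fun τ hτ => hball τ ⟨hτ.1, hτ.2.trans ht⟩
  have h1 := (lyap_bounds hS hX hK h hR hE le_rfl (mem_χ hS (h00 0 ⟨le_rfl, le_rfl⟩))
    (ident_form_le_of_mem_ball hS h le_rfl h00)).2
  have h2 : vup (tr.errNorm 0) ≤ vlo S.ζ := by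
    rw [← hR0]
    exact (hK.vup_K.le_iff (errNorm_nonneg 0) ((errNorm_nonneg 0).trans hinit)).2 hinit
  have h3 := (lyap_bounds hS hX hK h hR hE ht (mem_χ hS (hball t ⟨ht, le_rfl⟩))
    (ident_form_le_of_mem_ball hS h ht hball)).1
  rw [div_le_iff₀ (sub_pos.2 hvl)] at hτ
  have h4 : tr.lyap t ≤ vup r :=
    hdec.trans (max_le le_rfl (by linarith [hK.vup_K.nonneg hr0]))
  exact ((hK.vlo_K.lt_iff (errNorm_nonneg t) (by linarith)).1
    ((h3.trans h4).trans_lt hrlt)).le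

theorem limsup_errNorm_le {b : ℝ}
    (h : ∀ η > 0, ∃ τ : ℝ, ∀ t, 0 ≤ t → τ ≤ t → tr.errNorm t ≤ b + η) :
    limsup tr.errNorm atTop ≤ b := by
  refine le_of_forall_pos_le_add fun η hη => ?_
  obtain ⟨τ, hτ⟩ := h η hη
  refine limsup_le_of_le
    (isCoboundedUnder_le_of_eventually_le atTop (Eventually.of_forall errNorm_nonneg)) ?_
  filter_upwards [eventually_ge_atTop 0, eventually_ge_atTop τ] with t h0 h1 using hτ t h0 h1

theorem mem_interior_safe (hS : S.Standing) {t : ℝ} (he : ‖tr.e t‖ ≤ S.ζ) {o : O}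
    (ho : o ∈ S.neg) : tr.x t ∈ interior {x | S.h o x ≤ 0} := by
  refine mem_interior.2 ⟨{x | S.h o x < 0}, fun x (hx : S.h o x < 0) => hx.le,
    isOpen_lt (hS.h_smooth o).continuous continuous_const, mem_safe hS he o ho⟩

/-- With a composite error of norm `ζ`, the bounds of the Lyapunov function are ordered. -/
theorem vlo_ζ_le_vup_ζ (hS : S.Standing) (hX : X.Admissible)
    (hK : S.ClassKBounds X ψ vl vlo vup) (htr : tr.Covered X vlo vup)
    (hne : Nontrivial (E n) ∨ Nontrivial (E L)) :
    vlo S.ζ ≤ vup S.ζ := by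
  -- An error of norm `ζ` is placed in `e` or in `W̃_c`. The covered trajectory at time `0` provides
  -- gain matrices within the bounds, at which both inequalities for `V_L` hold.
  obtain ⟨e, wc, heχ, hnorm⟩ : ∃ (e : E n) (wc : E L), e ∈ S.χ ∧
      normZ e wc (0 : E L) (0 : WMat p n) = S.ζ := by
    have hζ0 := hS.ζ_pos.le
    rcases hne with hn | hn
    · obtain ⟨e, he⟩ := exists_norm_eq (E n) hζ0
      exact ⟨e, 0, mem_χ hS he.le, by simp [normZ, he, hζ0]⟩
    · obtain ⟨wc, hw⟩ := exists_norm_eq (E L) hζ0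
      exact ⟨0, wc, mem_χ hS (by simpa using hζ0), by simp [normZ, hw, hζ0]⟩
  obtain ⟨h, hR, hE, -⟩ := htr
  obtain ⟨t₀, ht₀, hearly⟩ := exists_ident_form_le_early hS (nontrivial_of_richStack hX hR) h
  obtain ⟨h1, h2⟩ := critic_loewner hS hX h hE le_rfl
  obtain ⟨h3, h4⟩ := ident_loewner hS hX h hR le_rfl (hearly 0 ⟨le_rfl, ht₀.le⟩)
  obtain ⟨h5, h6⟩ := hK.VL_bounds _ _ h1 h2 h3 h4 e heχ wc 0 0
  rw [hnorm] at h5 h6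
  exact h5.trans h6

end Trajectory

/-! ## The zero-dimensional case -/

theorem normZ_of_subsingleton [Subsingleton (E n)] [Subsingleton (E L)] (e : E n) (wc wa : E L)
    (ϑ : WMat p n) : normZ e wc wa ϑ = 0 := by
  have : ϑ = 0 := by
    ext1 j
    exact Subsingleton.elim (α := E n) _ _
  simp [normZ, Subsingleton.elim e 0, Subsingleton.elim wc 0, Subsingleton.elim wa 0, this]

theorem supBall_of_forall_eq_zero {φ : E n → ℝ} (h : ∀ e, φ e = 0) : S.supBall φ = 0 :=
  le_antisymm (Real.sSup_nonpos (by rintro _ ⟨e, -, rfl⟩; exact (h e).le))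
    (supBall_nonneg fun e => (h e).ge)

theorem supSmp_of_forall_eq_zero {φ : E n → E n → ℝ} (h : ∀ e y, φ e y = 0) : S.supSmp φ = 0 :=
  le_antisymm (Real.sSup_nonpos (by rintro _ ⟨q, -, rfl⟩; exact (h _ _).le))
    (supSmp_nonneg fun e y => (h e y).ge)

/-- Every error component vanishes when `n = L = 0`, so the ultimate bound has to be shown to be `0`
rather than an arbitrary value of `invK`. In `Δ` only `Q` and `B` at the origin could survive, and
both are zero. -/
theorem ι_of_subsingleton (hS : S.Standing) [Subsingleton (E n)] [Subsingleton (E L)] :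
    S.ι X = 0 := by
  have zn : ∀ v : E n, v = 0 := fun v => Subsingleton.elim v 0
  have zL : ∀ v : E L, v = 0 := fun v => Subsingleton.elim v 0
  have hΔ : ∀ e y, |S.Δ e y| = 0 := fun e y => by
    rw [abs_eq_zero, Δ, bellman, zn (gradient _ _), inner_zero_left, add_zero, r, zn y,
      hS.Q_zero, muhat, zn (_ + _)]
    simp [B, z]
  have h1 : S.supSmp (fun e y => |S.Δ e y|) = 0 := supSmp_of_forall_eq_zero hΔ
  have h2 : S.supBall (fun e => ‖S.dW e‖) = 0 := supBall_of_forall_eq_zero fun e => by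
    rw [Subsingleton.elim (S.dW e) 0, norm_zero]
  have h3 : S.supBall (fun e => ‖S.W e‖) = 0 := supBall_of_forall_eq_zero fun e => by
    rw [zL (S.W e), norm_zero]
  have h4 : S.supSmp (fun e y => ‖S.Gσ e y‖ * ‖S.W e‖ ^ 2) = 0 :=
    supSmp_of_forall_eq_zero fun e y => by rw [zL (S.W e)]; simp
  have h5 : S.supBall (fun e => ‖gradient S.V e‖) = 0 := supBall_of_forall_eq_zero fun e => by
    rw [zn (gradient S.V e), norm_zero]
  have h6 : S.supBall (fun e => ‖S.epsθ (S.z e)‖) = 0 := supBall_of_forall_eq_zero fun e => by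
    rw [zn (S.epsθ (S.z e)), norm_zero]
  have h7 : S.supBall (fun e =>
      ‖gradient S.V e‖ * ‖S.GR e‖ * ‖gradient (fun y => S.eps e y) e‖) = 0 :=
    supBall_of_forall_eq_zero fun e => by rw [zn (gradient S.V e)]; simp
  rw [ι, ιc, ιa, Dθ, h1, h2, h3, h4, h5, h6, h7]
  simp

theorem ultBound_of_subsingleton (hS : S.Standing) (hK : S.ClassKBounds X ψ vl vlo vup)
    [Subsingleton (E n)] [Subsingleton (E L)] : S.ultBound X vl vlo vup = 0 := by
  have inv0 : ∀ {α : ℝ → ℝ}, IsClassK α → invK α 0 = 0 := fun {α} hα => by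
    have hmem : (0 : ℝ) ∈ α '' Ici 0 := ⟨0, mem_Ici.2 le_rfl, hα.2.2⟩
    refine hα.2.1.injOn (invK_nonneg hmem) (mem_Ici.2 le_rfl) ?_
    rw [apply_invK hmem, hα.2.2]
  rw [ultBound, ι_of_subsingleton hS, inv0 hK.vl_K, hK.vup_K.2.2, inv0 hK.vlo_K]

end Setup

end StaF

/-! ### Assembly of the theorem -/

theorem proposition2 {n m L p N M : ℕ} {O : Type*} (S : StaF.Setup n m L p N M O)
    (X : StaF.Excitation) (ψ vl vlo vup : ℝ → ℝ)
    (hS : S.Standing) (hg : S.InputAssumption) (hX : X.Admissible)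
    (hK : S.ClassKBounds X ψ vl vlo vup) (hgain : S.GainConditions X vl vlo vup) :
    (∀ η > 0, ∃ τ : ℝ, ∀ tr : S.Trajectory, tr.Covered X vlo vup →
      ∀ t, 0 ≤ t → τ ≤ t → tr.errNorm t ≤ S.ultBound X vl vlo vup + η) ∧
    ∀ tr : S.Trajectory, tr.Covered X vlo vup →
      (∀ t, 0 ≤ t → tr.errNorm t ≤ S.ζ) ∧
      limsup tr.errNorm atTop ≤ S.ultBound X vl vlo vup ∧
      ∀ t, 0 ≤ t → ∀ o ∈ S.neg, tr.x t ∈ interior {x | S.h o x ≤ 0} := by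
  open StaF StaF.Setup StaF.Setup.Trajectory in
  -- Without a covered trajectory everything is vacuous; with one, the ordering of `v̲` and `v̄` at
  -- `ζ` can be extracted from its gain matrices.
  by_cases hcov : ∃ tr : S.Trajectory, tr.Covered X vlo vup
  swap
  · push Not at hcov
    exact ⟨fun η _ => ⟨0, fun tr htr => absurd htr (hcov tr)⟩,
      fun tr htr => absurd htr (hcov tr)⟩
  suffices hmain : (∀ η > 0, ∃ τ : ℝ, ∀ tr : S.Trajectory, tr.Covered X vlo vup →
      ∀ t, 0 ≤ t → τ ≤ t → tr.errNorm t ≤ S.ultBound X vl vlo vup + η) ∧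
      ∀ tr : S.Trajectory, tr.Covered X vlo vup → ∀ t, 0 ≤ t → tr.errNorm t ≤ S.ζ by
    refine ⟨hmain.1, fun tr htr => ⟨hmain.2 tr htr, limsup_errNorm_le fun η hη => ?_,
      fun t ht o ho => mem_interior_safe hS ((norm_e_le_errNorm t).trans (hmain.2 tr htr t ht)) ho⟩⟩
    obtain ⟨τ, hτ⟩ := hmain.1 η hη
    exact ⟨τ, hτ tr htr⟩
  obtain ⟨tr₀, htr₀⟩ := hcov
  by_cases hne : Nontrivial (E n) ∨ Nontrivial (E L)
  · have hζ := vlo_ζ_le_vup_ζ hS hX hK htr₀ hne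
    exact ⟨fun η hη => exists_uniform_time hS hX hK hgain hζ hη,
      fun tr htr t ht => errNorm_le hS hX hK hgain hζ htr ht⟩
  · rw [not_or, not_nontrivial_iff_subsingleton, not_nontrivial_iff_subsingleton] at hne
    obtain ⟨hn, hL⟩ := hne
    have hzero : ∀ (tr : S.Trajectory) (t : ℝ), tr.errNorm t = 0 := fun tr t =>
      normZ_of_subsingleton _ _ _ _
    refine ⟨fun η hη => ⟨0, fun tr _ t _ _ => ?_⟩, fun tr _ t _ => ?_⟩
    · rw [hzero, ultBound_of_subsingleton hS hK, zero_add]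
      exact hη.le
    · rw [hzero]
      exact hS.ζ_pos.le
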